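/- For an integer $r\ge 1$, positive integers $k_1,\dots,k_r$ and signs $\sigma_1,\dots,\sigma_r\in\{\pm1\}$ with $(k_r,\sigma_r)\ne(1,1)$, let $$T(k_1,\dots,k_r;\sigma_1,\dots,\sigma_r):=2^r\sum_{0<n_1<\cdots<n_r}\frac{\sigma_1^{n_1}\cdots\sigma_r^{n_r}}{(2n_1-1)^{k_1}(2n_2-2)^{k_2}\cdots(2n_r-r)^{k_r}},$$ where the (possibly only conditionally convergent) series is the limit for $N\to\infty$ of its partial sums over $n_r\le N$. For integers $0\le l\le r$, $r\ge1$, and $k\ge r$ let $$W_l(k,r):=\sum_{\substack{k_1+\cdots+k_r=k\\ k_1,\dots,k_r\ge1}}T(k_1,\dots,k_r;\sigma_1,\dots,\sigma_r),$$ where $\sigma_j=-1$ if $j=l$ or $j=r$, and $\sigma_j=1$ otherwise (so that only $\sigma_r=-1$ if $l=0$ or $l=r$). Let $\alpha_n:=(-1)^n\pi^{2n}/(2n+1)!$ for $n\ge0$. Theorem. For all integers $m,p\ge1$ and $l\ge0$, all the series that occur in the following sums converge, and $$(-1)^m\sum_{j=1}^p\alpha_{p-j}\,W_l(2j+2m+l-3,\,2m+l-1)=(-1)^p\sum_{j=1}^m\alpha_{m-j}\,W_l(2j+2p+l-3,\,2p+l-1).$$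 -/

import Mathlib

open Filter Topology

noncomputable section

/-- The partial sum `n_r ≤ N` of the multiple `T`-series with exponents `κ` and signs `σ`:
`2 ^ r * ∑_{0 < n₁ < ⋯ < n_r ≤ N} ∏_j σ_j ^ n_j / (2 n_j - j) ^ κ_j`.
The entries of `Fin r` are `0, …, r - 1`, so that the `j` of the formula is `(j : ℝ) + 1` here. -/
def multipleTPartial {r : ℕ} (κ : Fin r → ℕ) (σ : Fin r → ℤˣ) (N : ℕ) : ℝ :=
  2 ^ r * ∑ n ∈ (Fintype.piFinset fun _ : Fin r => Finset.Icc 1 N).filter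
      (fun n => ∀ i j : Fin r, i < j → n i < n j),
    ∏ j : Fin r, ((σ j : ℤ) : ℝ) ^ (n j) / (2 * (n j : ℝ) - ((j : ℝ) + 1)) ^ (κ j)

/-- The (alternating) multiple `T`-value `T(κ₁, …, κ_r; σ₁, …, σ_r)`: the limit of the partial
sums `n_r ≤ N`. The series need not converge absolutely. -/
def multipleT {r : ℕ} (κ : Fin r → ℕ) (σ : Fin r → ℤˣ) : ℝ :=
  limUnder atTop (multipleTPartial κ σ)

/-- The signs of `T(k₁, …, k_{l-1}, \bar k_l, k_{l+1}, …, k_{r-1}, \bar k_r)`: `-1` at the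
positions `l` and `r` (counted from `1`), and `1` elsewhere. For `l = 0` or `l = r` only the
last entry is barred. -/
def barSigns (l r : ℕ) : Fin r → ℤˣ :=
  fun j => if (j : ℕ) + 1 = l ∨ (j : ℕ) + 1 = r then -1 else 1

/-- The `r`-tuples of positive integers with sum `k`. -/
def positiveTuples (k r : ℕ) : Finset (Fin r → ℕ) :=
  (Finset.Nat.antidiagonalTuple r k).filter (fun κ => ∀ j, 1 ≤ κ j)

/-- The weighted sum `W_l(k, r)`, the sum of all
`T(k₁, …, k_{l-1}, \bar k_l, k_{l+1}, …, k_{r-1}, \bar k_r)` of weight `k` and depth `r`. -/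
def weightedSumW (l k r : ℕ) : ℝ :=
  ∑ κ ∈ positiveTuples k r, multipleT κ (barSigns l r)

/-- Each of the series whose values are added up in `W_l(k, r)` converges to its value. -/
def WConverges (l k r : ℕ) : Prop :=
  ∀ κ ∈ positiveTuples k r,
    Tendsto (multipleTPartial κ (barSigns l r)) atTop (𝓝 (multipleT κ (barSigns l r)))

/-- `α_n = (-1) ^ n π ^ (2 n) / (2 n + 1)!`. -/
def alphaCoeff (n : ℕ) : ℝ :=
  (-1) ^ n * Real.pi ^ (2 * n) / ((2 * n + 1).factorial : ℝ)

end

/-! The weighted sums are iterated integrals, and the theorem evaluates one contour integral in two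
ways.

Substitute n_j = m_j + j, so that 2n_j - j = j + 2m_j, and attach exp(-(r + 2m)s) to the largest
index m = m_r. After summation over all exponents of fixed weight the generating series
`weightSeries` satisfy a triangular first-order system. Multiplying by s^i/i! and summing removes
the coupling between weights: `weightIntegral`, written G_{r,q}, satisfies G_{0,q} = s^q/q! and
G_{r+1,q}' = -K_r G_{r,q}, and for r ≥ 1 it decays at infinity. Here K_r is 1/sinh s for r < l and
-1/cosh s for r ≥ l. By Abel's theorem G_{r,q}(0+) = W_l(q + r, r) when r > l.

Since gd' = 1/cosh for the Gudermann function gd, integration by parts gives W_l(q + l + 2a + 1, l +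
2a + 1) = -∫ G_{l,q} gd^{2a}/(2a)! ds/cosh s over (0, ∞). Integrating by parts l more times moves
the kernels 1/sinh to the other factor (`weightIntegral_mul_integral`) and leaves s^q/q! against
iterates of gd^{2a+1}/(2a+1)!.

Put m = a + 1 and p = b + 1. Let g_k be the iterated integrals from 0 of z^{2b+1}/(2b+1)! along
dz/sinh z (`sinhIterate`), and let V = π - gd z (`coGudermann`). Integrate g_l d(V^{2a+1}/(2a+1)!)
around the half strip Re z ≥ 0, 0 ≤ Im z ≤ π, and take imaginary parts. On the top edge V = gd s and
sinh changes sign. The coefficients α arise from Im (s + πi)^{2b+1}/(2b+1)! = π Σ α_{b-j}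
s^{2j}/(2j)!, so `sinhIterate_add_pi_mul_I_im` yields one side of the identity. On the imaginary
axis set z = i gd s. Then dz/sinh z becomes ds/sinh s and V = π - is, so the powers of V produce the
α's and g_l produces the dual integrals, which is the other side (`axis_integral`). The bottom edge
is real, the right edge decays, and the axis above iπ/2 contributes nothing by parity. Near iπ/2 the
pole of V' is avoided by an integration by parts, because V itself has only a logarithmic
singularity there. -/

open MeasureTheory
open scoped ComplexConjugate

/-! ### Nested coefficients and the bookkeeping of signs -/

/-- The coefficients of the nested series in the variables `n_j = m_j + j`, where the step from
level `j` to level `j + 1` carries the sign `e j`. -/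
noncomputable def nestedCoeff (e : ℕ → ℝ) : (r : ℕ) → (Fin r → ℕ) → ℕ → ℝ
  | 0, _, m => if m = 0 then 1 else 0
  | r + 1, κ, m => 2 / ((r : ℝ) + 1 + 2 * m) ^ κ (Fin.last r) *
      ∑ i ∈ Finset.range (m + 1), e r ^ (m - i + 1) * nestedCoeff e r (Fin.init κ) i

theorem multipleTPartial_zero (κ : Fin 0 → ℕ) (σ : Fin 0 → ℤˣ) (N : ℕ) :
    multipleTPartial κ σ N = 1 := by
  simp [multipleTPartial]

theorem multipleTPartial_succ {r : ℕ} (κ : Fin (r + 1) → ℕ) (σ : Fin (r + 1) → ℤˣ) (N : ℕ) :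
    multipleTPartial κ σ N = ∑ n ∈ Finset.Icc 1 N,
      2 * ((σ (Fin.last r) : ℤ) : ℝ) ^ n / (2 * (n : ℝ) - (r + 1)) ^ κ (Fin.last r) *
        multipleTPartial (Fin.init κ) (Fin.init σ) (n - 1) := by
  simp only [multipleTPartial, Finset.mul_sum]
  rw [Finset.sum_sigma']
  refine Finset.sum_bij' (fun n _ => ⟨n (Fin.last r), Fin.init n⟩)
    (fun x _ => Fin.snoc x.2 x.1) ?_ ?_ ?_ ?_ ?_
  · intro n hn
    simp only [Finset.mem_filter, Fintype.mem_piFinset, Finset.mem_Icc, Finset.mem_sigma,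
      Fin.init] at hn ⊢
    refine ⟨hn.1 _, fun j => ⟨(hn.1 _).1, ?_⟩, fun i j h => hn.2 _ _ (by simpa using h)⟩
    have := hn.2 j.castSucc (Fin.last r) (Fin.castSucc_lt_last j)
    omega
  · rintro ⟨a, n⟩ hn
    simp only [Finset.mem_filter, Fintype.mem_piFinset, Finset.mem_Icc, Finset.mem_sigma] at hn ⊢
    constructor
    · intro j
      refine Fin.lastCases ?_ (fun j => ?_) j
      · simpa using hn.1
      · have := hn.2.1 j
        simp only [Fin.snoc_castSucc]
        omega
    · intro i j hij
      induction j using Fin.lastCases with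
      | last =>
        induction i using Fin.lastCases with
        | last => simp at hij
        | cast i =>
          have := hn.2.1 i
          simp only [Fin.snoc_castSucc, Fin.snoc_last]
          omega
      | cast j =>
        induction i using Fin.lastCases with
        | last => exact absurd hij (not_lt.2 (Fin.le_last _))
        | cast i =>
          simp only [Fin.snoc_castSucc]
          exact hn.2.2 i j (by simpa using hij)
  · intro n _
    exact Fin.snoc_init_self n
  · rintro ⟨a, n⟩ _
    simp
  · intro n _
    rw [Fin.prod_univ_castSucc]
    simp only [Fin.init, Fin.val_castSucc, Fin.val_last]
    ring

/-- Writing each σ as a product of two consecutive step signs regroups the sign product: each step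
sign gets the sum of two neighbouring summation indices as exponent, which has the parity of their
difference, and that is the exponent in `nestedCoeff`. The free sign `c` replaces the step sign
after the last level; in the induction the inner tuple takes `e r` for it. -/
theorem multipleTPartial_eq_of_forall_sq {e : ℕ → ℝ} (he : ∀ j, e j * e j = 1) :
    ∀ {r : ℕ} (κ : Fin r → ℕ) (σ : Fin r → ℤˣ) (c : ℝ), c * c = 1 →
      (∀ j : Fin r, ((σ j : ℤ) : ℝ) = e j * if (j : ℕ) + 1 = r then c else e (j + 1)) →
      ∀ N : ℕ, multipleTPartial κ σ N =
        ∑ m ∈ Finset.range (N + 1 - r), c ^ (m + r) * nestedCoeff e r κ m := by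
  intro r
  induction r with
  | zero =>
    intro κ σ c hc hσ N
    rw [multipleTPartial_zero, Finset.sum_eq_single 0] <;> simp +contextual [nestedCoeff]
  | succ r ih =>
    intro κ σ c hc hσ N
    have h0 : ∀ n, multipleTPartial (Fin.init κ) (Fin.init σ) n =
        ∑ m ∈ Finset.range (n + 1 - r), e r ^ (m + r) * nestedCoeff e r (Fin.init κ) m := by
      refine ih _ _ (e r) (he r) fun j => ?_
      have := hσ j.castSucc
      have hj := j.2
      simp only [Fin.init]
      rw [this]
      simp only [Fin.val_castSucc]
      rw [if_neg (by omega)]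
      split_ifs with h
      · rw [h]
      · rfl
    have hlast : ((σ (Fin.last r) : ℤ) : ℝ) = e r * c := by
      simpa using hσ (Fin.last r)
    have hsq : ∀ {x : ℝ}, x * x = 1 → ∀ a b : ℕ, x ^ (a + 2 * b) = x ^ a := by
      intro x hx a b
      rw [pow_add, pow_mul, pow_two, hx, one_pow, mul_one]
    rw [multipleTPartial_succ]
    -- Terms with n ≤ r vanish, since r smaller positive indices do not fit below n.
    have hsub : Finset.Icc (r + 1) N ⊆ Finset.Icc 1 N := Finset.Icc_subset_Icc (by omega) le_rfl
    rw [← Finset.sum_subset hsub]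
    · have : Finset.Icc (r + 1) N = Finset.Ico (r + 1) (N + 1) := by ext; simp
      rw [this, Finset.sum_Ico_eq_sum_range]
      refine Finset.sum_congr (by congr 1) fun m _ => ?_
      rw [h0, nestedCoeff, hlast, show r + 1 + m - 1 + 1 - r = m + 1 by omega]
      have h1 : ∀ i ∈ Finset.range (m + 1), e r ^ (m - i + 1) * nestedCoeff e r (Fin.init κ) i =
          e r ^ (r + 1 + m) * (e r ^ (i + r) * nestedCoeff e r (Fin.init κ) i) := by
        intro i hi
        rw [← mul_assoc, ← pow_add, ← hsq (he r) (m - i + 1) (i + r)]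
        congr 2
        simp at hi
        omega
      rw [Finset.sum_congr rfl h1, ← Finset.mul_sum, mul_pow, add_comm m (r + 1)]
      push_cast
      rw [show 2 * ((r : ℝ) + 1 + m) - (r + 1) = r + 1 + 2 * m by ring]
      ring
    · intro n hn hn'
      simp only [Finset.mem_Icc] at hn hn'
      rw [h0, show n - 1 + 1 - r = 0 by omega]
      simp

/-- The signs `e j` belonging to `barSigns l r`. -/
noncomputable def stepSign (l j : ℕ) : ℝ := if j < l then 1 else -1

theorem stepSign_mul_self (l j : ℕ) : stepSign l j * stepSign l j = 1 := by
  unfold stepSign; split_ifs <;> norm_num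

theorem abs_stepSign (l j : ℕ) : |stepSign l j| = 1 := by
  unfold stepSign; split_ifs <;> norm_num

/-- The step signs drop from 1 to -1 at l, which is the bar at position l. The closing sign 1 after
a final -1 is the bar at position r, and the final step sign is -1 because l < r. -/
theorem multipleTPartial_barSigns {l r : ℕ} (h : l < r) (κ : Fin r → ℕ) (N : ℕ) :
    multipleTPartial κ (barSigns l r) N =
      ∑ m ∈ Finset.range (N + 1 - r), nestedCoeff (stepSign l) r κ m := by
  rw [multipleTPartial_eq_of_forall_sq (stepSign_mul_self l) κ _ 1 (by norm_num)]
  · simp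
  · intro j
    have := j.2
    unfold barSigns stepSign
    by_cases h1 : (j : ℕ) + 1 = r
    · have : ¬ (j : ℕ) < l := by omega
      simp [h1, this]
    · by_cases h2 : (j : ℕ) + 1 = l
      · have h3 : (j : ℕ) < l := by omega
        have h4 : l ≠ r := by omega
        simp [h2, h3, h4]
      · by_cases h3 : (j : ℕ) < l
        · have : (j : ℕ) + 1 < l := by omega
          simp [h1, h2, h3, this]
        · have : ¬ (j : ℕ) + 1 < l := by omega
          simp [h1, h2, h3, this]

/-! ### Size of the coefficients and conditional convergence -/

theorem sum_range_inv_sqrt_le (n : ℕ) :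
    ∑ i ∈ Finset.range n, (√((i : ℝ) + 1))⁻¹ ≤ 2 * √(n : ℝ) := by
  induction n with
  | zero => simp
  | succ n ih =>
    rw [Finset.sum_range_succ]
    have h1 : 0 < √((n : ℝ) + 1) := by positivity
    have h2 : √(n : ℝ) ≤ √((n : ℝ) + 1) := Real.sqrt_le_sqrt (by linarith)
    have h3 : √((n : ℝ) + 1) ^ 2 = n + 1 := Real.sq_sqrt (by positivity)
    have h4 : √(n : ℝ) ^ 2 = n := Real.sq_sqrt (by positivity)
    have h5 : (√((n : ℝ) + 1))⁻¹ ≤ 2 * (√((n : ℝ) + 1) - √(n : ℝ)) := by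
      rw [inv_le_iff_one_le_mul₀ h1]
      nlinarith
    push_cast
    linarith

theorem summable_inv_mul_sqrt : Summable fun m : ℕ => (((m : ℝ) + 1) * √((m : ℝ) + 1))⁻¹ := by
  have h := (summable_nat_add_iff 1).2 (Real.summable_nat_rpow_inv.2 (show (1 : ℝ) < 3 / 2 by norm_num))
  refine h.congr fun m => ?_
  push_cast
  congr 1
  rw [Real.sqrt_eq_rpow, show (3 / 2 : ℝ) = 1 + 1 / 2 by norm_num,
    Real.rpow_add (by positivity), Real.rpow_one]

theorem tendsto_inv_sqrt_add_one :
    Tendsto (fun m : ℕ => (√((m : ℝ) + 1))⁻¹) atTop (𝓝 0) := by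
  refine tendsto_inv_atTop_zero.comp (Real.tendsto_sqrt_atTop.comp ?_)
  exact tendsto_atTop_add_const_right _ _ tendsto_natCast_atTop_atTop

theorem abs_sum_nestedCoeff_le {e : ℕ → ℝ} {r : ℕ} {κ : Fin r → ℕ}
    {C : ℝ} (hC : ∀ m : ℕ, |nestedCoeff e r κ m| ≤ C * (√((m : ℝ) + 1))⁻¹) (f : ℕ → ℕ) (x : ℝ)
    (hx : |x| = 1) (m : ℕ) :
    |∑ i ∈ Finset.range (m + 1), x ^ f i * nestedCoeff e r κ i| ≤ 2 * C * √((m : ℝ) + 1) := by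
  refine (Finset.abs_sum_le_sum_abs _ _).trans ?_
  have hC0 : 0 ≤ C := by simpa using (abs_nonneg _).trans (hC 0)
  calc _ ≤ ∑ i ∈ Finset.range (m + 1), C * (√((i : ℝ) + 1))⁻¹ :=
        Finset.sum_le_sum fun i _ => by rw [abs_mul, abs_pow, hx, one_pow, one_mul]; exact hC i
    _ ≤ C * (2 * √((m + 1 : ℕ) : ℝ)) := by
        rw [← Finset.mul_sum]
        exact mul_le_mul_of_nonneg_left (sum_range_inv_sqrt_le _) hC0
    _ = _ := by push_cast; ring

theorem inv_pow_le_inv_add_one {r k : ℕ} (hk : 1 ≤ k) (m : ℕ) :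
    (((r : ℝ) + 1 + 2 * m) ^ k)⁻¹ ≤ ((m : ℝ) + 1)⁻¹ := by
  have hr : (0 : ℝ) ≤ r := r.cast_nonneg
  have hm : (0 : ℝ) ≤ m := m.cast_nonneg
  refine inv_anti₀ (by positivity) ?_
  calc (m : ℝ) + 1 ≤ (r : ℝ) + 1 + 2 * m := by linarith
    _ ≤ _ := le_self_pow₀ (by linarith) (by omega)

/-- A crude substitute for logarithmic estimates: the order m^(-1/2) reproduces itself, because its
partial sums are O(√m) and the new denominator divides by at least m + 1. -/
theorem exists_abs_nestedCoeff_le {e : ℕ → ℝ} (he : ∀ j, |e j| = 1) :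
    ∀ {r : ℕ} (κ : Fin r → ℕ), (∀ j, 1 ≤ κ j) →
      ∃ C : ℝ, ∀ m : ℕ, |nestedCoeff e r κ m| ≤ C * (√((m : ℝ) + 1))⁻¹ := by
  intro r
  induction r with
  | zero =>
    intro κ _
    refine ⟨1, fun m => ?_⟩
    unfold nestedCoeff
    split_ifs with h
    · simp [h]
    · simp only [abs_zero]; positivity
  | succ r ih =>
    intro κ hκ
    obtain ⟨C, hC⟩ := ih (Fin.init κ) fun j => hκ _
    refine ⟨4 * C, fun m => ?_⟩
    have hC0 : 0 ≤ C := by simpa using (abs_nonneg _).trans (hC 0)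
    have h1 := abs_sum_nestedCoeff_le hC (fun i => m - i + 1) (e r) (he r) m
    have hs : 0 < √((m : ℝ) + 1) := by positivity
    have hs2 : √((m : ℝ) + 1) * √((m : ℝ) + 1) = m + 1 := Real.mul_self_sqrt (by positivity)
    rw [nestedCoeff, abs_mul, div_eq_mul_inv, abs_of_nonneg (a := 2 * _) (by positivity)]
    calc _ ≤ 2 * ((m : ℝ) + 1)⁻¹ * (2 * C * √((m : ℝ) + 1)) := by
          exact mul_le_mul (mul_le_mul_of_nonneg_left (inv_pow_le_inv_add_one (hκ _) m) zero_le_two)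
            h1 (abs_nonneg _) (by positivity)
      _ = _ := by
          generalize √((m : ℝ) + 1) = s at *
          rw [← hs2]; field_simp; ring

/-- Dirichlet's test by Abel summation, with bounded variation in place of monotonicity. -/
theorem exists_tendsto_sum_neg_one_pow {b : ℕ → ℝ} (hb : Tendsto b atTop (𝓝 0))
    (hs : Summable fun m => |b m - b (m + 1)|) :
    ∃ L, Tendsto (fun n => ∑ m ∈ Finset.range n, (-1) ^ m * b m) atTop (𝓝 L) := by
  set E : ℕ → ℝ := fun n => ∑ m ∈ Finset.range n, (-1 : ℝ) ^ m with hE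
  have hE1 : ∀ n, |E n| ≤ 1 := by
    intro n
    simp only [hE, neg_one_geom_sum]
    split_ifs <;> simp
  have hsum : Summable fun m => E (m + 1) * (b m - b (m + 1)) := by
    refine Summable.of_norm_bounded hs fun m => ?_
    rw [Real.norm_eq_abs, abs_mul]
    exact mul_le_of_le_one_left (abs_nonneg _) (hE1 _)
  refine ⟨0 + ∑' m, E (m + 1) * (b m - b (m + 1)), ?_⟩
  have h0 : Tendsto (fun n => E n * b n) atTop (𝓝 0) := by
    refine squeeze_zero_norm (fun n => ?_) (by simpa using hb.abs)
    rw [Real.norm_eq_abs, abs_mul]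
    exact mul_le_of_le_one_left (abs_nonneg _) (hE1 _)
  refine (h0.add hsum.hasSum.tendsto_sum_nat).congr fun n => ?_
  induction n with
  | zero => simp [hE]
  | succ n ih =>
    rw [Finset.sum_range_succ _ n, Finset.sum_range_succ _ n, ← ih]
    have : E (n + 1) = E n + (-1) ^ n := Finset.sum_range_succ _ n
    rw [this]; ring

/-- The last step sign -1 turns the coefficients into (-1)^m b_m with b = -2 a^k S. The differences
of b are O(m^(-3/2)): a^k varies by O(m^(-2)) against S = O(√m), and S varies by O(m^(-1/2)) against
a^k = O(1/m). -/
theorem exists_tendsto_sum_nestedCoeff {e : ℕ → ℝ} (he : ∀ j, |e j| = 1) {r : ℕ} (her : e r = -1)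
    (κ : Fin (r + 1) → ℕ) (hκ : ∀ j, 1 ≤ κ j) :
    ∃ L, Tendsto (fun n => ∑ m ∈ Finset.range n, nestedCoeff e (r + 1) κ m) atTop (𝓝 L) := by
  obtain ⟨C, hC⟩ := exists_abs_nestedCoeff_le he (Fin.init κ) fun j => hκ _
  obtain ⟨C', hC'⟩ := exists_abs_nestedCoeff_le he κ hκ
  have hC0 : 0 ≤ C := by simpa using (abs_nonneg _).trans (hC 0)
  set k := κ (Fin.last r) with hk
  set S : ℕ → ℝ := fun m => ∑ i ∈ Finset.range (m + 1), (-1) ^ i * nestedCoeff e r (Fin.init κ) i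
  set a : ℕ → ℝ := fun m => ((r : ℝ) + 1 + 2 * m)⁻¹ with ha
  have hS : ∀ m : ℕ, |S m| ≤ 2 * C * √((m : ℝ) + 1) := fun m =>
    abs_sum_nestedCoeff_le hC id (-1) (by norm_num) m
  set b : ℕ → ℝ := fun m => -2 * a m ^ k * S m with hb
  have hbA : ∀ m, nestedCoeff e (r + 1) κ m = (-1) ^ m * b m := by
    intro m
    simp only [nestedCoeff, her, hb, S, ha, ← hk, inv_pow, Finset.mul_sum]
    refine Finset.sum_congr rfl fun i hi => ?_
    have : (-1 : ℝ) ^ (m - i + 1) = - ((-1) ^ m * (-1) ^ i) := by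
      have h2 : (-1 : ℝ) ^ m = (-1) ^ (m - i) * (-1) ^ i := by
        rw [← pow_add]; congr 1; simp at hi; omega
      have h3 : (-1 : ℝ) ^ i * (-1) ^ i = 1 := by rw [← mul_pow]; simp
      rw [h2, mul_assoc, h3, pow_succ]; ring
    rw [this]; ring
  have hb0 : Tendsto b atTop (𝓝 0) := by
    have h1 : Tendsto (fun m : ℕ => C' * (√((m : ℝ) + 1))⁻¹) atTop (𝓝 0) := by
      simpa using tendsto_inv_sqrt_add_one.const_mul C'
    refine squeeze_zero_norm (fun m => ?_) h1
    have := hC' m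
    rwa [hbA, abs_mul, abs_pow, abs_neg, abs_one, one_pow, one_mul] at this
  simp_rw [hbA]
  refine exists_tendsto_sum_neg_one_pow hb0 ?_
  refine Summable.of_nonneg_of_le (fun _ => abs_nonneg _) (fun m => ?_)
    (summable_inv_mul_sqrt.mul_left (8 * k * C + 2 * C))
  have hr : (0 : ℝ) ≤ r := r.cast_nonneg
  have hm : (0 : ℝ) ≤ m := m.cast_nonneg
  have hs : 0 < √((m : ℝ) + 1) := by positivity
  have hs2 : √((m : ℝ) + 1) * √((m : ℝ) + 1) = m + 1 := Real.mul_self_sqrt (by positivity)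
  have ha0 : ∀ m, 0 ≤ a m := fun m => by positivity
  have ha1 : ∀ m, a m ≤ 1 := fun m => inv_le_one_of_one_le₀ (by
    have : (0 : ℝ) ≤ m := m.cast_nonneg
    linarith)
  have h1 : S (m + 1) = S m + (-1) ^ (m + 1) * nestedCoeff e r (Fin.init κ) (m + 1) :=
    Finset.sum_range_succ _ _
  have h2 : |a m ^ k - a (m + 1) ^ k| ≤ 2 * k * (((m : ℝ) + 1) * (m + 1))⁻¹ := by
    have h3 := abs_pow_sub_pow_le (a m) (a (m + 1)) k
    have h4 : max |a m| |a (m + 1)| ^ (k - 1) ≤ 1 :=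
      pow_le_one₀ (by positivity) (by simp [abs_of_nonneg, ha0, ha1])
    have h5 : |a m - a (m + 1)| ≤ 2 * (((m : ℝ) + 1) * (m + 1))⁻¹ := by
      have h6 : a m - a (m + 1) = 2 * (((r : ℝ) + 1 + 2 * m) * (r + 1 + 2 * (m + 1)))⁻¹ := by
        simp only [ha]
        push_cast
        field_simp
        ring
      rw [h6, abs_of_nonneg (by positivity)]
      exact mul_le_mul_of_nonneg_left (inv_anti₀ (by positivity) (mul_le_mul (by linarith)
        (by linarith) (by positivity) (by positivity))) zero_le_two
    calc _ ≤ |a m - a (m + 1)| * k * max |a m| |a (m + 1)| ^ (k - 1) := h3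
      _ ≤ |a m - a (m + 1)| * k * 1 := by gcongr
      _ ≤ (2 * (((m : ℝ) + 1) * (m + 1))⁻¹) * k * 1 := by gcongr
      _ = _ := by ring
  have h3 : |nestedCoeff e r (Fin.init κ) (m + 1)| ≤ C * (√((m : ℝ) + 1))⁻¹ := by
    refine (hC _).trans ?_
    push_cast
    gcongr
    linarith
  have h4 : a (m + 1) ^ k ≤ ((m : ℝ) + 1)⁻¹ := by
    have := inv_pow_le_inv_add_one (r := r) (hκ (Fin.last r)) (m + 1)
    simp only [ha, inv_pow]
    refine this.trans (inv_anti₀ (by positivity) ?_)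
    push_cast; linarith
  have h5 : b m - b (m + 1) = -2 * (a m ^ k - a (m + 1) ^ k) * S m +
      2 * a (m + 1) ^ k * ((-1) ^ (m + 1) * nestedCoeff e r (Fin.init κ) (m + 1)) := by
    simp only [hb, h1]; ring
  rw [h5]
  refine (abs_add_le _ _).trans ?_
  rw [abs_mul, abs_mul, abs_mul, abs_mul, abs_mul, abs_pow (-1 : ℝ), abs_neg, abs_neg, abs_one,
    one_pow, one_mul, abs_two, abs_of_nonneg (pow_nonneg (ha0 (m + 1)) k)]
  calc _ ≤ 2 * (2 * k * (((m : ℝ) + 1) * (m + 1))⁻¹) * (2 * C * √((m : ℝ) + 1)) +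
        2 * ((m : ℝ) + 1)⁻¹ * (C * (√((m : ℝ) + 1))⁻¹) := by
        gcongr
        exact hS m
    _ = _ := by
        clear h1 h5
        generalize √((m : ℝ) + 1) = s at *
        rw [← hs2]; field_simp; ring

/-! ### Sums over all exponents of a given weight -/

theorem mem_positiveTuples {k r : ℕ} {κ : Fin r → ℕ} :
    κ ∈ positiveTuples k r ↔ ∑ j, κ j = k ∧ ∀ j, 1 ≤ κ j := by
  simp [positiveTuples, Finset.Nat.mem_antidiagonalTuple]

theorem le_sum_of_forall_one_le {r : ℕ} {κ : Fin r → ℕ} (h : ∀ j, 1 ≤ κ j) : r ≤ ∑ j, κ j := by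
  simpa using Finset.sum_le_sum fun j (_ : j ∈ Finset.univ) => h j

/-- Weight is recorded as its excess q over the depth; a last entry i + 1 uses up i of that excess.
-/
theorem sum_positiveTuples_succ {M : Type*} [AddCommMonoid M] (q r : ℕ)
    (f : (Fin (r + 1) → ℕ) → M) :
    ∑ κ ∈ positiveTuples (q + (r + 1)) (r + 1), f κ =
      ∑ i ∈ Finset.range (q + 1), ∑ κ ∈ positiveTuples (q - i + r) r,
        f (Fin.snoc (α := fun _ => ℕ) κ (i + 1)) := by
  rw [Finset.sum_sigma']
  refine Finset.sum_bij' (fun κ _ => ⟨κ (Fin.last r) - 1, Fin.init κ⟩)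
    (fun x _ => Fin.snoc (α := fun _ => ℕ) x.2 (x.1 + 1)) ?_ ?_ ?_ ?_ ?_
  · intro κ hκ
    rw [mem_positiveTuples, Fin.sum_univ_castSucc] at hκ
    have h1 := hκ.2 (Fin.last r)
    have h2 := le_sum_of_forall_one_le fun j => hκ.2 (Fin.castSucc j)
    simp only [Finset.mem_sigma, Finset.mem_range, mem_positiveTuples, Fin.init]
    refine ⟨by omega, by omega, fun j => hκ.2 _⟩
  · rintro ⟨i, κ⟩ h
    simp only [Finset.mem_sigma, Finset.mem_range, mem_positiveTuples] at h
    rw [mem_positiveTuples, Fin.sum_univ_castSucc]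
    simp only [Fin.snoc_castSucc, Fin.snoc_last]
    refine ⟨by omega, fun j => ?_⟩
    induction j using Fin.lastCases with
    | last => simp
    | cast j => simpa using h.2.2 j
  · intro κ hκ
    have h1 := (mem_positiveTuples.1 hκ).2 (Fin.last r)
    simp only
    rw [Nat.sub_add_cancel h1]
    exact Fin.snoc_init_self κ
  · rintro ⟨i, κ⟩ h
    simp
  · intro κ hκ
    have h1 := (mem_positiveTuples.1 hκ).2 (Fin.last r)
    simp only
    rw [Nat.sub_add_cancel h1]
    exact congrArg f (Fin.snoc_init_self κ).symm

/-- The sum of the coefficients `nestedCoeff` over all positive tuples of weight `q + r`. -/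
noncomputable def weightCoeff (e : ℕ → ℝ) (r q m : ℕ) : ℝ :=
  ∑ κ ∈ positiveTuples (q + r) r, nestedCoeff e r κ m

/-- The signed partial sums of `weightCoeff`. -/
noncomputable def weightCoeffSum (e : ℕ → ℝ) (r q m : ℕ) : ℝ :=
  ∑ i ∈ Finset.range (m + 1), e r ^ (m - i + 1) * weightCoeff e r q i

theorem weightCoeff_zero (e : ℕ → ℝ) (q m : ℕ) :
    weightCoeff e 0 q m = if q = 0 ∧ m = 0 then 1 else 0 := by
  have : ∀ q, positiveTuples (q + 0) 0 = if q = 0 then Finset.univ else ∅ := by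
    intro q
    ext κ
    rw [mem_positiveTuples]
    split_ifs with h
    · exact ⟨fun _ => Finset.mem_univ _, fun _ => ⟨by simp [h], fun j => j.elim0⟩⟩
    · simp [eq_comm, h]
  rw [weightCoeff, this]
  by_cases hq : q = 0 <;> simp [hq, nestedCoeff]

theorem weightCoeff_succ_eq_sum (e : ℕ → ℝ) (r q m : ℕ) :
    weightCoeff e (r + 1) q m = ∑ i ∈ Finset.range (q + 1),
      2 / ((r : ℝ) + 1 + 2 * m) ^ (i + 1) * weightCoeffSum e r (q - i) m := by
  rw [weightCoeff, sum_positiveTuples_succ]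
  refine Finset.sum_congr rfl fun i _ => ?_
  simp only [nestedCoeff, Fin.snoc_last, Fin.init_snoc, weightCoeffSum, weightCoeff,
    ← Finset.mul_sum]
  rw [Finset.sum_comm]
  simp only [← Finset.mul_sum]

theorem mul_weightCoeff_succ_zero (e : ℕ → ℝ) (r m : ℕ) :
    ((r : ℝ) + 1 + 2 * m) * weightCoeff e (r + 1) 0 m = 2 * weightCoeffSum e r 0 m := by
  rw [weightCoeff_succ_eq_sum]
  have : (r : ℝ) + 1 + 2 * m ≠ 0 := by positivity
  simp
  field_simp

/-- The factor lowers the last exponent by one: exponents at least 2 give the same depth with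
smaller excess, and exponent 1 gives the partial sum of the level below. For the generating series
this becomes a differential equation. -/
theorem mul_weightCoeff_succ_succ (e : ℕ → ℝ) (r q m : ℕ) :
    ((r : ℝ) + 1 + 2 * m) * weightCoeff e (r + 1) (q + 1) m =
      weightCoeff e (r + 1) q m + 2 * weightCoeffSum e r (q + 1) m := by
  rw [weightCoeff_succ_eq_sum, weightCoeff_succ_eq_sum, Finset.sum_range_succ' _ (q + 1)]
  have : (r : ℝ) + 1 + 2 * m ≠ 0 := by positivity
  rw [mul_add, Finset.mul_sum]
  congr 1
  · refine Finset.sum_congr rfl fun i _ => ?_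
    rw [Nat.add_sub_add_right]
    field_simp
    ring
  · simp
    field_simp

theorem nestedCoeff_nonneg {e : ℕ → ℝ} :
    ∀ {r : ℕ} (κ : Fin r → ℕ), (∀ j < r, 0 ≤ e j) → ∀ m, 0 ≤ nestedCoeff e r κ m := by
  intro r
  induction r with
  | zero => intro κ _ m; unfold nestedCoeff; split_ifs <;> norm_num
  | succ r ih =>
    intro κ h m
    rw [nestedCoeff]
    refine mul_nonneg (by positivity) (Finset.sum_nonneg fun i _ => ?_)
    exact mul_nonneg (pow_nonneg (h r (by omega)) _) (ih _ (fun j hj => h j (by omega)) i)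

theorem weightCoeff_nonneg {e : ℕ → ℝ} {r : ℕ} (h : ∀ j < r, 0 ≤ e j) (q m : ℕ) :
    0 ≤ weightCoeff e r q m :=
  Finset.sum_nonneg fun κ _ => nestedCoeff_nonneg κ h m

theorem exists_abs_weightCoeff_le {e : ℕ → ℝ} (he : ∀ j, |e j| = 1) (r q : ℕ) :
    ∃ C : ℝ, ∀ m : ℕ, |weightCoeff e r q m| ≤ C * (√((m : ℝ) + 1))⁻¹ := by
  have : ∀ κ : Fin r → ℕ, ∃ C : ℝ, κ ∈ positiveTuples (q + r) r →
      ∀ m : ℕ, |nestedCoeff e r κ m| ≤ C * (√((m : ℝ) + 1))⁻¹ := by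
    intro κ
    by_cases h : κ ∈ positiveTuples (q + r) r
    · obtain ⟨C, hC⟩ := exists_abs_nestedCoeff_le he κ (mem_positiveTuples.1 h).2
      exact ⟨C, fun _ => hC⟩
    · exact ⟨0, fun h' => absurd h' h⟩
  choose C hC using this
  refine ⟨∑ κ ∈ positiveTuples (q + r) r, C κ, fun m => ?_⟩
  rw [Finset.sum_mul]
  exact (Finset.abs_sum_le_sum_abs _ _).trans (Finset.sum_le_sum fun κ hκ => hC κ hκ m)

theorem exists_abs_weightCoeff_le_const {e : ℕ → ℝ} (he : ∀ j, |e j| = 1) (r q : ℕ) :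
    ∃ C : ℝ, ∀ m : ℕ, |weightCoeff e r q m| ≤ C := by
  obtain ⟨C, hC⟩ := exists_abs_weightCoeff_le he r q
  have hC0 : 0 ≤ C := by simpa using (abs_nonneg _).trans (hC 0)
  refine ⟨C, fun m => (hC m).trans (mul_le_of_le_one_right hC0 (inv_le_one_of_one_le₀ ?_))⟩
  rw [Real.one_le_sqrt]
  have : (0 : ℝ) ≤ m := m.cast_nonneg
  linarith

theorem tendsto_weightCoeff {e : ℕ → ℝ} (he : ∀ j, |e j| = 1) (r q : ℕ) :
    Tendsto (weightCoeff e r q) atTop (𝓝 0) := by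
  obtain ⟨C, hC⟩ := exists_abs_weightCoeff_le he r q
  exact squeeze_zero_norm hC (by simpa using tendsto_inv_sqrt_add_one.const_mul C)

theorem tendsto_multipleTPartial {l r : ℕ} (h : l ≤ r) {κ : Fin (r + 1) → ℕ}
    (hκ : ∀ j, 1 ≤ κ j) :
    Tendsto (multipleTPartial κ (barSigns l (r + 1))) atTop
        (𝓝 (multipleT κ (barSigns l (r + 1)))) ∧
      Tendsto (fun n => ∑ m ∈ Finset.range n, nestedCoeff (stepSign l) (r + 1) κ m) atTop
        (𝓝 (multipleT κ (barSigns l (r + 1)))) := by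
  obtain ⟨L, hL⟩ := exists_tendsto_sum_nestedCoeff (abs_stepSign l)
    (show stepSign l r = -1 by simp [stepSign, h]) κ hκ
  have h1 : Tendsto (multipleTPartial κ (barSigns l (r + 1))) atTop (𝓝 L) := by
    refine (hL.comp ((tendsto_sub_atTop_nat (r + 1)).comp (tendsto_add_atTop_nat 1))).congr
      fun N => ?_
    rw [multipleTPartial_barSigns (by omega)]
    rfl
  rw [multipleT, h1.limUnder_eq]
  exact ⟨h1, hL⟩

theorem WConverges_of_le {l r : ℕ} (h : l ≤ r) (k : ℕ) : WConverges l k (r + 1) :=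
  fun _ hκ => (tendsto_multipleTPartial h (mem_positiveTuples.1 hκ).2).1

theorem tendsto_sum_weightCoeff {l r : ℕ} (h : l ≤ r) (q : ℕ) :
    Tendsto (fun n => ∑ m ∈ Finset.range n, weightCoeff (stepSign l) (r + 1) q m) atTop
      (𝓝 (weightedSumW l (q + (r + 1)) (r + 1))) := by
  refine (tendsto_finsetSum _ fun κ hκ =>
    (tendsto_multipleTPartial h (mem_positiveTuples.1 hκ).2).2).congr fun n => ?_
  rw [Finset.sum_comm]
  rfl

/-! ### Exponential series and their behaviour at 0 and infinity -/

/-- The series `∑ c m * exp (-(a + 2 m) s)`. -/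
noncomputable def expSeries (c : ℕ → ℝ) (a s : ℝ) : ℝ :=
  ∑' m : ℕ, c m * Real.exp (-(a + 2 * m) * s)

theorem exp_neg_mul_eq_pow (a s : ℝ) (m : ℕ) :
    Real.exp (-(a + 2 * m) * s) = Real.exp (-a * s) * Real.exp (-2 * s) ^ m := by
  rw [← Real.exp_nat_mul, ← Real.exp_add]; congr 1; ring

theorem expSeries_eq (c : ℕ → ℝ) (a s : ℝ) :
    expSeries c a s = Real.exp (-a * s) * ∑' m, c m * Real.exp (-2 * s) ^ m := by
  rw [expSeries, ← tsum_mul_left]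
  congr 1; ext m
  rw [exp_neg_mul_eq_pow]; ring

theorem summable_mul_pow_of_abs_le {c : ℕ → ℝ} {C : ℝ} (hc : ∀ m, |c m| ≤ C) {x : ℝ} (hx : 0 ≤ x)
    (hx1 : x < 1) : Summable fun m => c m * x ^ m := by
  refine Summable.of_norm_bounded ((summable_geometric_of_lt_one hx hx1).mul_left C) fun m => ?_
  rw [norm_mul, Real.norm_eq_abs, norm_pow, Real.norm_of_nonneg hx]
  exact mul_le_mul_of_nonneg_right (hc m) (by positivity)

theorem exp_neg_two_mul_lt_one {s : ℝ} (hs : 0 < s) : Real.exp (-2 * s) < 1 :=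
  Real.exp_lt_one_iff.2 (by linarith)

theorem summable_expSeries {c : ℕ → ℝ} {C : ℝ} (hc : ∀ m, |c m| ≤ C) (a : ℝ) {s : ℝ}
    (hs : 0 < s) : Summable fun m : ℕ => c m * Real.exp (-(a + 2 * m) * s) := by
  refine ((summable_mul_pow_of_abs_le hc (Real.exp_nonneg _)
    (exp_neg_two_mul_lt_one hs)).mul_left (Real.exp (-a * s))).congr fun m => ?_
  rw [exp_neg_mul_eq_pow]; ring

theorem hasDerivAt_expSeries {c : ℕ → ℝ} {C : ℝ} (hc : ∀ m, |c m| ≤ C) {a : ℝ} (ha : 0 ≤ a)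
    {s : ℝ} (hs : 0 < s) :
    HasDerivAt (expSeries c a) (-expSeries (fun m => (a + 2 * m) * c m) a s) s := by
  have hx := exp_neg_two_mul_lt_one (half_pos hs)
  set x := Real.exp (-2 * (s / 2)) with hxdef
  have hsum : Summable fun m : ℕ => C * ((a + 2 * m) * x ^ m) := by
    have h1 := (summable_geometric_of_lt_one (Real.exp_nonneg _) hx).mul_left a
    have h2 := (summable_pow_mul_geometric_of_norm_lt_one 1
      (show ‖x‖ < 1 by rwa [Real.norm_of_nonneg (Real.exp_nonneg _)])).mul_left 2
    refine ((h1.add h2).mul_left C).congr fun m => ?_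
    ring
  have key := hasDerivAt_tsum_of_isPreconnected (t := Set.Ioi (s / 2)) (y₀ := s) (y := s)
    (g := fun (m : ℕ) s => c m * Real.exp (-(a + 2 * m) * s))
    (g' := fun (m : ℕ) s => c m * (Real.exp (-(a + 2 * m) * s) * (-(a + 2 * m)))) hsum isOpen_Ioi
    isPreconnected_Ioi ?_ ?_ (by simp [hs]) (summable_expSeries hc a hs) (by simp [hs])
  · refine (show HasDerivAt (expSeries c a) _ s from key).congr_deriv ?_
    simp only [expSeries]
    rw [← tsum_neg]
    congr 1; ext m; ring
  · intro m y _
    refine HasDerivAt.const_mul _ (HasDerivAt.exp ?_)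
    simpa using (hasDerivAt_id y).const_mul (-(a + 2 * (m : ℝ)))
  · intro m y hy
    have h0 : 0 ≤ a + 2 * (m : ℝ) := by positivity
    have hy' : s / 2 < y := hy
    rw [norm_mul, norm_mul, norm_neg, Real.norm_eq_abs, Real.norm_of_nonneg h0,
      Real.norm_of_nonneg (Real.exp_nonneg _), hxdef, ← Real.exp_nat_mul, mul_comm (a + _)]
    refine mul_le_mul (hc m) (mul_le_mul_of_nonneg_right (Real.exp_le_exp.2 ?_) h0)
      (by positivity) ((abs_nonneg _).trans (hc m))
    nlinarith [mul_nonneg ha (hs.trans (by linarith : s < 2 * y)).le,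
      mul_nonneg (Nat.cast_nonneg (α := ℝ) m) (by linarith : 0 ≤ y - s / 2)]

/-- The factor that takes the generating series of one level to the next one. -/
noncomputable def stepKernel (ε s : ℝ) : ℝ := expSeries (fun m => 2 * ε ^ (m + 1)) 1 s

theorem stepKernel_eq {ε s : ℝ} (hε : |ε| = 1) (hs : 0 < s) :
    stepKernel ε s = 2 * ε * Real.exp (-s) / (1 - ε * Real.exp (-2 * s)) := by
  have h1 : ‖ε * Real.exp (-2 * s)‖ < 1 := by
    rw [norm_mul, Real.norm_eq_abs, hε, one_mul, Real.norm_of_nonneg (Real.exp_nonneg _)]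
    exact exp_neg_two_mul_lt_one hs
  have h2 : ∀ m : ℕ, 2 * ε ^ (m + 1) * Real.exp (-2 * s) ^ m =
      2 * ε * (ε * Real.exp (-2 * s)) ^ m := fun m => by rw [mul_pow]; ring
  rw [stepKernel, expSeries_eq]
  simp_rw [h2]
  rw [tsum_mul_left, tsum_geometric_of_norm_lt_one h1, neg_one_mul]
  ring

theorem stepKernel_one {s : ℝ} (hs : 0 < s) : stepKernel 1 s = (Real.sinh s)⁻¹ := by
  have h1 : Real.exp (-2 * s) = Real.exp (-s) * Real.exp (-s) := by
    rw [← Real.exp_add]; congr 1; ring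
  have h2 : Real.exp s * Real.exp (-s) = 1 := by rw [← Real.exp_add]; simp
  have h3 := exp_neg_two_mul_lt_one hs
  have h4 : 0 < Real.sinh s := Real.sinh_pos_iff.2 hs
  rw [stepKernel_eq (by simp) hs]
  refine eq_inv_of_mul_eq_one_left ?_
  rw [Real.sinh_eq, div_mul_eq_mul_div, div_eq_one_iff_eq (by linarith)]
  linear_combination h2 + h1

theorem stepKernel_neg_one {s : ℝ} (hs : 0 < s) : stepKernel (-1) s = -(Real.cosh s)⁻¹ := by
  have h1 : Real.exp (-2 * s) = Real.exp (-s) * Real.exp (-s) := by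
    rw [← Real.exp_add]; congr 1; ring
  have h2 : Real.exp s * Real.exp (-s) = 1 := by rw [← Real.exp_add]; simp
  have h3 := Real.exp_pos (-2 * s)
  have h4 : 0 < Real.cosh s := Real.cosh_pos s
  rw [stepKernel_eq (by simp) hs, ← inv_neg]
  refine eq_inv_of_mul_eq_one_left ?_
  rw [Real.cosh_eq, div_mul_eq_mul_div, div_eq_one_iff_eq (by linarith)]
  linear_combination h2 - h1

/-- A Cauchy product: the signed partial summation that adds a level is multiplication by an
elementary function. -/
theorem stepKernel_mul_expSeries {c : ℕ → ℝ} {C : ℝ} (hc : ∀ m, |c m| ≤ C) (a : ℝ) {ε : ℝ}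
    (hε : |ε| = 1) {s : ℝ} (hs : 0 < s) :
    stepKernel ε s * expSeries c a s =
      expSeries (fun m => 2 * ∑ i ∈ Finset.range (m + 1), ε ^ (m - i + 1) * c i) (a + 1) s := by
  have h1 : ∀ m : ℕ, |2 * ε ^ (m + 1)| ≤ 2 := fun m => by simp [abs_mul, abs_pow, hε]
  have h2 := (summable_expSeries h1 1 hs).norm
  have h3 := (summable_expSeries hc a hs).norm
  rw [mul_comm, stepKernel, expSeries, expSeries,
    tsum_mul_tsum_eq_tsum_sum_range_of_summable_norm h3 h2, expSeries]
  congr 1; ext m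
  rw [Finset.mul_sum, Finset.sum_mul]
  refine Finset.sum_congr rfl fun i hi => ?_
  have hi' : i ≤ m := by simp at hi; omega
  have h4 : Real.exp (-(a + 1 + 2 * m) * s) =
      Real.exp (-(a + 2 * i) * s) * Real.exp (-(1 + 2 * (m - i : ℕ)) * s) := by
    rw [← Real.exp_add, Nat.cast_sub hi']; congr 1; ring
  rw [h4]; ring

theorem tendsto_exp_neg_two_mul : Tendsto (fun s : ℝ => Real.exp (-2 * s)) (𝓝[>] 0) (𝓝[<] 1) := by
  refine tendsto_nhdsWithin_iff.2 ⟨?_, ?_⟩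
  · have : Continuous fun s : ℝ => Real.exp (-2 * s) := by fun_prop
    simpa using (this.tendsto 0).mono_left nhdsWithin_le_nhds
  · filter_upwards [self_mem_nhdsWithin] with s hs using exp_neg_two_mul_lt_one hs

theorem tendsto_exp_neg_mul (a : ℝ) : Tendsto (fun s : ℝ => Real.exp (-a * s)) (𝓝[>] 0) (𝓝 1) := by
  have : Continuous fun s : ℝ => Real.exp (-a * s) := by fun_prop
  simpa using (this.tendsto 0).mono_left nhdsWithin_le_nhds

/-- Abel's limit theorem in the variable exp(-2s), so conditional convergence is enough. -/
theorem tendsto_expSeries_nhdsGT {c : ℕ → ℝ} {L : ℝ}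
    (h : Tendsto (fun n => ∑ m ∈ Finset.range n, c m) atTop (𝓝 L)) (a : ℝ) :
    Tendsto (expSeries c a) (𝓝[>] 0) (𝓝 L) := by
  have h1 := (Real.tendsto_tsum_powerSeries_nhdsWithin_lt h).comp tendsto_exp_neg_two_mul
  have h2 := (tendsto_exp_neg_mul a).mul h1
  rw [one_mul] at h2
  exact h2.congr fun s => (expSeries_eq c a s).symm

/-- The series may blow up at 0, but multiplication by 1 - exp(-2s) replaces the coefficients by
their differences. These have partial sums c n, so Abel's theorem gives limit 0, and s is at most a
bounded multiple of 1 - exp(-2s) near 0. -/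
theorem tendsto_mul_expSeries_nhdsGT {c : ℕ → ℝ} {C : ℝ} (hc : ∀ m, |c m| ≤ C)
    (h : Tendsto c atTop (𝓝 0)) (a : ℝ) :
    Tendsto (fun s => s * expSeries c a s) (𝓝[>] 0) (𝓝 0) := by
  set d : ℕ → ℝ := fun m => c m - if m = 0 then 0 else c (m - 1) with hd
  have hd1 : ∀ n, ∑ m ∈ Finset.range (n + 1), d m = c n := by
    intro n
    induction n with
    | zero => simp [hd]
    | succ n ih => rw [Finset.sum_range_succ, ih]; simp [hd]
  have hd2 : Tendsto (fun n => ∑ m ∈ Finset.range n, d m) atTop (𝓝 0) := by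
    rw [← tendsto_add_atTop_iff_nat 1]
    exact h.congr fun n => (hd1 n).symm
  have hd3 : ∀ s : ℝ, 0 < s → expSeries d a s = (1 - Real.exp (-2 * s)) * expSeries c a s := by
    intro s hs
    rw [expSeries_eq, expSeries_eq, mul_left_comm]
    congr 1
    have h1 := summable_mul_pow_of_abs_le hc (Real.exp_nonneg _) (exp_neg_two_mul_lt_one hs)
    have h2 : Summable fun m => (if m = 0 then 0 else c (m - 1)) * Real.exp (-2 * s) ^ m := by
      refine (summable_nat_add_iff 1).1 ((h1.mul_left (Real.exp (-2 * s))).congr fun m => ?_)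
      simp [pow_succ]; ring
    simp_rw [hd, sub_mul]
    rw [h1.tsum_sub h2, h2.tsum_eq_zero_add]
    simp only [if_true, zero_mul, zero_add, Nat.add_sub_cancel, Nat.add_eq_zero_iff, one_ne_zero,
      and_false, if_false, one_mul]
    rw [← tsum_mul_left]
    congr 2; ext m; ring
  have h4 : Tendsto (fun s : ℝ => Real.exp (2 * s) / 2 * |expSeries d a s|) (𝓝[>] 0) (𝓝 0) := by
    have h5 : Continuous fun s : ℝ => Real.exp (2 * s) / 2 := by fun_prop
    simpa using ((h5.tendsto 0).mono_left nhdsWithin_le_nhds).mul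
      (tendsto_expSeries_nhdsGT hd2 a).abs
  refine squeeze_zero_norm' ?_ h4
  filter_upwards [self_mem_nhdsWithin] with s hs
  have hs' : 0 < s := hs
  have h6 := exp_neg_two_mul_lt_one hs'
  rw [hd3 s hs, norm_mul, Real.norm_eq_abs, Real.norm_eq_abs, abs_mul, ← mul_assoc,
    abs_of_pos hs', abs_of_pos (sub_pos.2 h6)]
  refine mul_le_mul_of_nonneg_right ?_ (abs_nonneg _)
  have h7 := Real.add_one_le_exp (2 * s)
  have h8 : Real.exp (2 * s) * Real.exp (-2 * s) = 1 := by rw [← Real.exp_add]; simp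
  nlinarith

theorem tendsto_pow_mul_expSeries_atTop {c : ℕ → ℝ} {C : ℝ} (hc : ∀ m, |c m| ≤ C) {a : ℝ}
    (ha : 1 ≤ a) (n : ℕ) : Tendsto (fun s => s ^ n * expSeries c a s) atTop (𝓝 0) := by
  have h1 := (Real.tendsto_pow_mul_exp_neg_atTop_nhds_zero n).mul_const
    (∑' m : ℕ, C * Real.exp (-2) ^ m)
  rw [zero_mul] at h1
  refine squeeze_zero_norm' ?_ h1
  filter_upwards [eventually_ge_atTop 1] with s hs
  have hs0 : 0 < s := by linarith
  rw [expSeries_eq, norm_mul, norm_mul, norm_pow, Real.norm_of_nonneg hs0.le, mul_assoc,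
    Real.norm_of_nonneg (Real.exp_nonneg _)]
  have h2 := (summable_geometric_of_lt_one (Real.exp_nonneg (-2))
    (Real.exp_lt_one_iff.2 (by norm_num))).mul_left C
  have hC := (abs_nonneg _).trans (hc 0)
  refine mul_le_mul_of_nonneg_left (mul_le_mul (Real.exp_le_exp.2 (by nlinarith))
    (tsum_of_norm_bounded h2.hasSum fun m => ?_) (norm_nonneg _) (Real.exp_nonneg _))
    (by positivity)
  rw [norm_mul, norm_pow, Real.norm_of_nonneg (Real.exp_nonneg _)]
  exact mul_le_mul (hc m) (pow_le_pow_left₀ (Real.exp_nonneg _)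
    (Real.exp_le_exp.2 (by linarith)) m) (by positivity) hC

theorem expSeries_nonneg {c : ℕ → ℝ} (hc : ∀ m, 0 ≤ c m) (a s : ℝ) : 0 ≤ expSeries c a s :=
  tsum_nonneg fun m => mul_nonneg (hc m) (Real.exp_nonneg _)

/-! ### The differential system and its iterated integrals -/

/-- The generating series of `weightCoeff`. -/
noncomputable def weightSeries (e : ℕ → ℝ) (r q : ℕ) (s : ℝ) : ℝ :=
  expSeries (weightCoeff e r q) r s

theorem weightSeries_zero (e : ℕ → ℝ) (q : ℕ) (s : ℝ) :
    weightSeries e 0 q s = if q = 0 then 1 else 0 := by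
  rw [weightSeries, expSeries, tsum_eq_single 0]
  · simp [weightCoeff_zero]
  · intro m hm
    simp [weightCoeff_zero, hm]

theorem stepKernel_mul_weightSeries {e : ℕ → ℝ} (he : ∀ j, |e j| = 1) (r q : ℕ) {s : ℝ}
    (hs : 0 < s) : stepKernel (e r) s * weightSeries e r q s =
      expSeries (fun m => 2 * weightCoeffSum e r q m) (r + 1) s := by
  obtain ⟨C, hC⟩ := exists_abs_weightCoeff_le_const he r q
  exact stepKernel_mul_expSeries hC r (he r) hs

theorem hasDerivAt_weightSeries_succ_zero {e : ℕ → ℝ} (he : ∀ j, |e j| = 1) (r : ℕ) {s : ℝ}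
    (hs : 0 < s) : HasDerivAt (weightSeries e (r + 1) 0)
      (-(stepKernel (e r) s * weightSeries e r 0 s)) s := by
  obtain ⟨C, hC⟩ := exists_abs_weightCoeff_le_const he (r + 1) 0
  refine (hasDerivAt_expSeries hC (Nat.cast_nonneg (r + 1)) hs).congr_deriv ?_
  rw [stepKernel_mul_weightSeries he _ _ hs]
  push_cast
  simp_rw [mul_weightCoeff_succ_zero]

theorem hasDerivAt_weightSeries_succ_succ {e : ℕ → ℝ} (he : ∀ j, |e j| = 1) (r q : ℕ) {s : ℝ}
    (hs : 0 < s) : HasDerivAt (weightSeries e (r + 1) (q + 1))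
      (-weightSeries e (r + 1) q s - stepKernel (e r) s * weightSeries e r (q + 1) s) s := by
  obtain ⟨C, hC⟩ := exists_abs_weightCoeff_le_const he (r + 1) (q + 1)
  obtain ⟨C', hC'⟩ := exists_abs_weightCoeff_le_const he (r + 1) q
  refine (hasDerivAt_expSeries hC (Nat.cast_nonneg (r + 1)) hs).congr_deriv ?_
  rw [stepKernel_mul_weightSeries he _ _ hs, weightSeries, expSeries, expSeries, expSeries,
    ← neg_add', ← Summable.tsum_add]
  · congr 2; ext m
    push_cast
    rw [mul_weightCoeff_succ_succ]; ring
  · exact summable_expSeries hC' _ hs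
  · have h1 := summable_expSeries hC (r + 1 : ℕ) hs
    obtain ⟨D, hD⟩ := exists_abs_weightCoeff_le_const he r (q + 1)
    have h2 := (summable_expSeries hD r hs).norm
    have h3 := (summable_expSeries (c := fun m => 2 * e r ^ (m + 1)) (C := 2)
      (fun m => by simp [abs_mul, abs_pow, he]) 1 hs).norm
    refine (summable_norm_sum_mul_range_of_summable_norm h2 h3).of_norm.congr fun m => ?_
    rw [weightCoeffSum, Finset.mul_sum, Finset.sum_mul]
    refine Finset.sum_congr rfl fun i hi => ?_
    have hi' : i ≤ m := by simp at hi; omega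
    have h4 : Real.exp (-((r : ℝ) + 1 + 2 * m) * s) =
        Real.exp (-(r + 2 * i) * s) * Real.exp (-(1 + 2 * (m - i : ℕ)) * s) := by
      rw [← Real.exp_add, Nat.cast_sub hi']; congr 1; ring
    rw [h4]; ring

/-- The iterated integral `∫ t₁ ^ (-x) ω₁ ⋯ ω_r` over `0 < t₁ < ⋯ < t_r < exp (-s)`, more
precisely its coefficient of `x ^ q`. -/
noncomputable def weightIntegral (e : ℕ → ℝ) (r q : ℕ) (s : ℝ) : ℝ :=
  ∑ i ∈ Finset.range (q + 1), s ^ i / (i.factorial : ℝ) * weightSeries e r (q - i) s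

theorem weightIntegral_zero (e : ℕ → ℝ) (q : ℕ) (s : ℝ) :
    weightIntegral e 0 q s = s ^ q / (q.factorial : ℝ) := by
  rw [weightIntegral, Finset.sum_eq_single q]
  · simp [weightSeries_zero]
  · intro i hi hiq
    have : q - i ≠ 0 := by simp at hi; omega
    simp [weightSeries_zero, this]
  · simp

theorem hasDerivAt_pow_div_factorial (n : ℕ) (s : ℝ) :
    HasDerivAt (fun s : ℝ => s ^ (n + 1) / ((n + 1).factorial : ℝ)) (s ^ n / (n.factorial : ℝ)) s := by
  refine ((hasDerivAt_pow (n + 1) s).div_const _).congr_deriv ?_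
  rw [Nat.factorial_succ]
  push_cast
  have : (n : ℝ) + 1 ≠ 0 := by positivity
  have : (n.factorial : ℝ) ≠ 0 := by positivity
  field_simp

/-- The derivatives of the factors s^i/i! cancel the terms of smaller excess in the derivatives of
`weightSeries`, so only the kernel terms remain. -/
theorem hasDerivAt_weightIntegral_succ {e : ℕ → ℝ} (he : ∀ j, |e j| = 1) (r q : ℕ) {s : ℝ}
    (hs : 0 < s) : HasDerivAt (weightIntegral e (r + 1) q)
      (-(stepKernel (e r) s * weightIntegral e r q s)) s := by
  set K := stepKernel (e r) s
  -- The value at the preceding index, with 0 before index 0, so that both derivative formulas for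
  -- `weightSeries` take one form; `p` does the same for the powers.
  set P : ℕ → ℝ := fun j => Nat.casesOn j 0 fun j => weightSeries e (r + 1) j s with hP
  have hF : ∀ j, HasDerivAt (weightSeries e (r + 1) j) (-P j - K * weightSeries e r j s) s := by
    intro j
    cases j with
    | zero => simpa [hP] using hasDerivAt_weightSeries_succ_zero he r hs
    | succ j => exact hasDerivAt_weightSeries_succ_succ he r j hs
  set p : ℕ → ℝ := fun i => Nat.casesOn i 0 fun i => s ^ i / (i.factorial : ℝ) with hp
  have hpow : ∀ i : ℕ, HasDerivAt (fun s : ℝ => s ^ i / (i.factorial : ℝ)) (p i) s := by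
    intro i
    cases i with
    | zero => simpa [hp] using hasDerivAt_const s (1 : ℝ)
    | succ i => exact hasDerivAt_pow_div_factorial i s
  have h := HasDerivAt.fun_sum (u := Finset.range (q + 1)) fun i _ =>
    (hpow i).mul (hF (q - i))
  refine h.congr_deriv ?_
  have hsplit : ∑ i ∈ Finset.range (q + 1), p i * weightSeries e (r + 1) (q - i) s =
      ∑ i ∈ Finset.range (q + 1), s ^ i / (i.factorial : ℝ) * P (q - i) := by
    rw [Finset.sum_range_succ', Finset.sum_range_succ]
    rw [Nat.sub_self, show P 0 = 0 from rfl, show p 0 = 0 from rfl, zero_mul, mul_zero]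
    congr 1
    refine Finset.sum_congr rfl fun i hi => ?_
    obtain ⟨d, hd⟩ : ∃ d, q = i + 1 + d := Nat.exists_eq_add_of_le (by simp at hi; omega)
    have h1 : q - i = d + 1 := by omega
    have h2 : q - (i + 1) = d := by omega
    rw [h1, h2]
  rw [Finset.sum_add_distrib, hsplit, ← Finset.sum_add_distrib, weightIntegral, Finset.mul_sum,
    ← Finset.sum_neg_distrib]
  refine Finset.sum_congr rfl fun i _ => ?_
  ring

theorem tendsto_pow_mul_weightIntegral_atTop {e : ℕ → ℝ} (he : ∀ j, |e j| = 1) (r q n : ℕ) :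
    Tendsto (fun s => s ^ n * weightIntegral e (r + 1) q s) atTop (𝓝 0) := by
  simp only [weightIntegral, Finset.mul_sum]
  rw [show (0 : ℝ) = ∑ i ∈ Finset.range (q + 1), 0 by simp]
  refine tendsto_finsetSum _ fun i _ => ?_
  obtain ⟨C, hC⟩ := exists_abs_weightCoeff_le_const he (r + 1) (q - i)
  have h := (tendsto_pow_mul_expSeries_atTop hC
    (show (1 : ℝ) ≤ (r + 1 : ℕ) by push_cast; linarith [r.cast_nonneg (α := ℝ)]) (n + i)).div_const
    (i.factorial : ℝ)
  rw [zero_div] at h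
  exact h.congr fun s => by rw [weightSeries]; ring

theorem tendsto_mul_weightIntegral_nhdsGT {e : ℕ → ℝ} (he : ∀ j, |e j| = 1) (r q : ℕ) :
    Tendsto (fun s => s * weightIntegral e r q s) (𝓝[>] 0) (𝓝 0) := by
  simp only [weightIntegral, Finset.mul_sum]
  rw [← Finset.sum_const_zero (s := Finset.range (q + 1)) (M := ℝ)]
  refine tendsto_finsetSum _ fun i _ => ?_
  rw [Finset.sum_const_zero]
  obtain ⟨C, hC⟩ := exists_abs_weightCoeff_le_const he r (q - i)
  have h1 := tendsto_mul_expSeries_nhdsGT hC (tendsto_weightCoeff he r (q - i)) r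
  have h2 : Continuous fun s : ℝ => s ^ i / (i.factorial : ℝ) := by fun_prop
  have h := ((h2.tendsto 0).mono_left nhdsWithin_le_nhds).mul h1
  rw [mul_zero] at h
  exact h.congr fun s => by rw [weightSeries]; ring

/-- Every series involved has a finite limit at 0, so only the summand without a power of s
survives. -/
theorem tendsto_weightIntegral_nhdsGT {l r : ℕ} (h : l ≤ r) (q : ℕ) :
    Tendsto (weightIntegral (stepSign l) (r + 1) q) (𝓝[>] 0)
      (𝓝 (weightedSumW l (q + (r + 1)) (r + 1))) := by
  have h1 : ∀ i ∈ Finset.range (q + 1), Tendsto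
      (fun s => s ^ i / (i.factorial : ℝ) * weightSeries (stepSign l) (r + 1) (q - i) s) (𝓝[>] 0)
      (𝓝 (0 ^ i / (i.factorial : ℝ) * weightedSumW l (q - i + (r + 1)) (r + 1))) := by
    intro i _
    have h2 : Continuous fun s : ℝ => s ^ i / (i.factorial : ℝ) := by fun_prop
    exact ((h2.tendsto 0).mono_left nhdsWithin_le_nhds).mul
      (tendsto_expSeries_nhdsGT (tendsto_sum_weightCoeff h (q - i)) _)
  have h2 : ∑ i ∈ Finset.range (q + 1), 0 ^ i / (i.factorial : ℝ) *
      weightedSumW l (q - i + (r + 1)) (r + 1) = weightedSumW l (q + (r + 1)) (r + 1) := by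
    rw [Finset.sum_eq_single 0]
    · simp
    · intro i _ hi
      simp [hi]
    · simp
  rw [← h2]
  exact tendsto_finsetSum _ h1

theorem weightIntegral_nonneg {e : ℕ → ℝ} {r : ℕ} (h : ∀ j < r, 0 ≤ e j) (q : ℕ) {s : ℝ}
    (hs : 0 ≤ s) : 0 ≤ weightIntegral e r q s :=
  Finset.sum_nonneg fun _ _ => mul_nonneg (by positivity)
    (expSeries_nonneg (weightCoeff_nonneg h _) _ _)

/-! ### The real Gudermann function -/

/-- The Gudermann function. -/
noncomputable def gudermann (s : ℝ) : ℝ := Real.pi / 2 - 2 * Real.arctan (Real.exp (-s))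

theorem hasDerivAt_gudermann (s : ℝ) : HasDerivAt gudermann (Real.cosh s)⁻¹ s := by
  have h1 : HasDerivAt (fun s : ℝ => Real.exp (-s)) (Real.exp (-s) * -1) s :=
    (hasDerivAt_neg s).exp
  refine ((h1.arctan.const_mul 2).const_sub (Real.pi / 2)).congr_deriv ?_
  have h2 : Real.exp s * Real.exp (-s) = 1 := by rw [← Real.exp_add]; simp
  have h3 := Real.exp_pos s
  have h4 := Real.exp_pos (-s)
  rw [Real.cosh_eq]
  field_simp
  linear_combination h2

theorem gudermann_zero : gudermann 0 = 0 := by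
  simp [gudermann]; ring

theorem continuous_gudermann : Continuous gudermann :=
  continuous_iff_continuousAt.2 fun s => (hasDerivAt_gudermann s).continuousAt

theorem strictMono_gudermann : StrictMono gudermann := by
  refine strictMono_of_deriv_pos fun s => ?_
  rw [(hasDerivAt_gudermann s).deriv]
  exact inv_pos.2 (Real.cosh_pos s)

theorem gudermann_pos {s : ℝ} (hs : 0 < s) : 0 < gudermann s := by
  simpa [gudermann_zero] using strictMono_gudermann hs

theorem gudermann_lt (s : ℝ) : gudermann s < Real.pi / 2 := by
  have := Real.arctan_pos.2 (Real.exp_pos (-s))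
  unfold gudermann
  linarith

theorem gudermann_le_self {s : ℝ} (hs : 0 ≤ s) : gudermann s ≤ s := by
  have h : MonotoneOn (fun s => s - gudermann s) (Set.Ici 0) := by
    refine monotoneOn_of_hasDerivWithinAt_nonneg (convex_Ici 0)
      (continuous_id.sub continuous_gudermann).continuousOn
      (fun x _ => ((hasDerivAt_id x).sub (hasDerivAt_gudermann x)).hasDerivWithinAt) fun x _ => ?_
    exact sub_nonneg.2 (inv_le_one_of_one_le₀ (Real.one_le_cosh x))
  simpa [gudermann_zero] using h Set.self_mem_Ici hs hs

theorem tendsto_gudermann_atTop : Tendsto gudermann atTop (𝓝 (Real.pi / 2)) := by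
  have h1 : Tendsto (fun s : ℝ => Real.arctan (Real.exp (-s))) atTop (𝓝 (Real.arctan 0)) :=
    (Real.continuous_arctan.tendsto 0).comp Real.tendsto_exp_neg_atTop_nhds_zero
  have h2 := (h1.const_mul 2).const_sub (Real.pi / 2)
  rw [Real.arctan_zero, mul_zero, sub_zero] at h2
  exact h2

theorem image_gudermann_Ioi : gudermann '' Set.Ioi 0 = Set.Ioo 0 (Real.pi / 2) := by
  ext v
  constructor
  · rintro ⟨s, hs, rfl⟩
    exact ⟨gudermann_pos hs, gudermann_lt s⟩
  · rintro ⟨h0, h1⟩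
    obtain ⟨b, hb, hb0⟩ := ((tendsto_gudermann_atTop.eventually (lt_mem_nhds h1)).and
      (eventually_gt_atTop 0)).exists
    obtain ⟨s, hs, rfl⟩ := intermediate_value_Ioo hb0.le continuous_gudermann.continuousOn
      (show v ∈ Set.Ioo (gudermann 0) (gudermann b) from ⟨by rwa [gudermann_zero], hb⟩)
    exact ⟨s, hs.1, rfl⟩

theorem hasDerivAt_gudermann_pow (i : ℕ) (s : ℝ) :
    HasDerivAt (fun s => gudermann s ^ (i + 1) / ((i + 1).factorial : ℝ))
      (gudermann s ^ i / (i.factorial : ℝ) / Real.cosh s) s := by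
  refine ((hasDerivAt_pow_div_factorial i (gudermann s)).comp s
    (hasDerivAt_gudermann s)).congr_deriv ?_
  ring

/-- These are the boundary terms of the integrations by parts: a factor O(s) absorbs the possible
blow-up at 0 and is dominated by the decay at infinity. -/
theorem tendsto_weightIntegral_mul {e : ℕ → ℝ} (he : ∀ j, |e j| = 1) (r q : ℕ) {Y : ℝ → ℝ} {C : ℝ}
    (hY : ∀ s, 0 < s → |Y s| ≤ C * s) :
    Tendsto (fun s => weightIntegral e (r + 1) q s * Y s) (𝓝[>] 0) (𝓝 0) ∧
      Tendsto (fun s => weightIntegral e (r + 1) q s * Y s) atTop (𝓝 0) := by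
  have hb : ∀ s, 0 < s → ‖weightIntegral e (r + 1) q s * Y s‖ ≤
      C * (|s| * |weightIntegral e (r + 1) q s|) := by
    intro s hs
    rw [norm_mul, Real.norm_eq_abs, Real.norm_eq_abs, abs_of_pos hs, mul_comm, ← mul_assoc]
    exact mul_le_mul_of_nonneg_right (hY s hs) (abs_nonneg _)
  constructor
  · refine squeeze_zero_norm' ?_
      (by simpa using (tendsto_mul_weightIntegral_nhdsGT he (r + 1) q).abs.const_mul C)
    filter_upwards [self_mem_nhdsWithin] with s hs using hb s hs
  · refine squeeze_zero_norm' ?_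
      (by simpa using (tendsto_pow_mul_weightIntegral_atTop he r q 1).abs.const_mul C)
    filter_upwards [eventually_gt_atTop 0] with s hs using hb s hs

/-! ### Duality by integration by parts on the half line -/

/-- `f` has a primitive on `(0, ∞)` with limit `L` at `0` and limit `0` at infinity. -/
def HasPrimitiveLimits (f : ℝ → ℝ) (L : ℝ) : Prop :=
  ∃ D : ℝ → ℝ, (∀ s, 0 < s → HasDerivAt D (f s) s) ∧ Tendsto D (𝓝[>] 0) (𝓝 L) ∧
    Tendsto D atTop (𝓝 0)

theorem HasPrimitiveLimits.congr {f g : ℝ → ℝ} {L : ℝ} (h : HasPrimitiveLimits f L)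
    (hfg : ∀ s, 0 < s → f s = g s) : HasPrimitiveLimits g L := by
  obtain ⟨D, h1, h2⟩ := h
  exact ⟨D, fun s hs => hfg s hs ▸ h1 s hs, h2⟩

theorem HasPrimitiveLimits.const_mul {f : ℝ → ℝ} {L : ℝ} (h : HasPrimitiveLimits f L) (c : ℝ) :
    HasPrimitiveLimits (fun s => c * f s) (c * L) := by
  obtain ⟨D, h1, h2, h3⟩ := h
  exact ⟨fun s => c * D s, fun s hs => (h1 s hs).const_mul c, h2.const_mul c,
    by simpa using h3.const_mul c⟩

/-- Integration by parts with vanishing boundary terms, phrased through primitives so that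
intermediate integrands need no integrability. -/
theorem HasPrimitiveLimits.sub_deriv {f g g' : ℝ → ℝ} {L : ℝ} (h : HasPrimitiveLimits f L)
    (hg : ∀ s, 0 < s → HasDerivAt g (g' s) s) (h0 : Tendsto g (𝓝[>] 0) (𝓝 0))
    (h1 : Tendsto g atTop (𝓝 0)) : HasPrimitiveLimits (fun s => f s - g' s) L := by
  obtain ⟨D, hD, hD0, hD1⟩ := h
  exact ⟨fun s => D s - g s, fun s hs => (hD s hs).sub (hg s hs), by simpa using hD0.sub h0,
    by simpa using hD1.sub h1⟩

theorem HasPrimitiveLimits.integral_eq {f : ℝ → ℝ} {L : ℝ} (h : HasPrimitiveLimits f L)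
    (hf : ∀ s, 0 < s → 0 ≤ f s) :
    IntegrableOn f (Set.Ioi 0) ∧ ∫ s in Set.Ioi 0, f s = -L := by
  obtain ⟨D, hD, hD0, hD1⟩ := h
  -- The primitive is controlled only on (0, ∞); giving it the value L at 0 makes it continuous
  -- there. Nonnegativity of the integrand then yields integrability.
  set E := Function.update D 0 L with hE
  have hEd : ∀ s ∈ Set.Ioi (0 : ℝ), HasDerivAt E (f s) s := by
    intro s hs
    refine (hD s hs).congr_of_eventuallyEq ?_
    filter_upwards [lt_mem_nhds (show (0 : ℝ) < s from hs)] with t ht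
    exact Function.update_of_ne ht.ne' _ _
  have hEc : ContinuousWithinAt E (Set.Ici 0) 0 := by
    rw [hE, continuousWithinAt_update_same, Set.Ici_sdiff_left]
    exact hD0
  have hE1 : Tendsto E atTop (𝓝 0) := by
    refine hD1.congr' ?_
    filter_upwards [eventually_gt_atTop 0] with t ht
    exact (Function.update_of_ne ht.ne' _ _).symm
  refine ⟨integrableOn_Ioi_deriv_of_nonneg hEc hEd hf hE1, ?_⟩
  rw [integral_Ioi_of_hasDerivAt_of_nonneg hEc hEd hf hE1]
  simp [hE]

/-- Each integration by parts trades one level with kernel -1/cosh for one more power of gd, at the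
cost of a sign. -/
theorem hasPrimitiveLimits_weightIntegral_mul_gudermann_pow (l q : ℕ) : ∀ i n : ℕ,
    HasPrimitiveLimits (fun s => (-1) ^ i * (weightIntegral (stepSign l) (l + n) q s *
      (gudermann s ^ i / (i.factorial : ℝ) / Real.cosh s)))
      (weightedSumW l (q + (l + n + i + 1)) (l + n + i + 1)) := by
  have hd : ∀ n s, 0 < s → HasDerivAt (weightIntegral (stepSign l) (l + n + 1) q)
      (weightIntegral (stepSign l) (l + n) q s / Real.cosh s) s := by
    intro n s hs
    refine (hasDerivAt_weightIntegral_succ (abs_stepSign l) (l + n) q hs).congr_deriv ?_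
    rw [show stepSign l (l + n) = -1 by simp [stepSign], stepKernel_neg_one hs]
    ring
  intro i
  induction i with
  | zero =>
    intro n
    refine ⟨weightIntegral (stepSign l) (l + n + 1) q, fun s hs => ?_,
      tendsto_weightIntegral_nhdsGT (by omega) q,
      by simpa using tendsto_pow_mul_weightIntegral_atTop (abs_stepSign l) (l + n) q 0⟩
    refine (hd n s hs).congr_deriv ?_
    simp
    ring
  | succ i ih =>
    intro n
    have hY : ∀ s, 0 < s → |gudermann s ^ (i + 1) / ((i + 1).factorial : ℝ)| ≤
        (Real.pi / 2) ^ i * s := by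
      intro s hs
      have h0 := gudermann_pos hs
      rw [abs_of_nonneg (by positivity)]
      refine (div_le_self (by positivity) (Nat.one_le_cast.2 (Nat.factorial_pos _))).trans ?_
      rw [pow_succ]
      exact mul_le_mul (pow_le_pow_left₀ h0.le (gudermann_lt s).le i) (gudermann_le_self hs.le)
        h0.le (by positivity)
    obtain ⟨h0, h1⟩ := tendsto_weightIntegral_mul (abs_stepSign l) (l + n) q hY
    have h2 := (ih (n + 1)).sub_deriv (fun s hs => (((hd n s hs).mul
      (hasDerivAt_gudermann_pow i s)).const_mul ((-1) ^ i))) (by simpa using h0.const_mul ((-1) ^ i))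
      (by simpa using h1.const_mul ((-1) ^ i))
    rw [show l + n + (i + 1) + 1 = l + (n + 1) + i + 1 by ring]
    refine h2.congr fun s _ => ?_
    rw [← add_assoc l n 1]
    ring

/-- As s ≤ sinh s, the bound C s on one iterate bounds the next integrand by C. -/
theorem iterated_bounds {Q : ℕ → ℝ → ℝ} {y : ℕ → ℝ → ℝ} (hc : ∀ k, ContinuousOn (Q k) (Set.Ici 0))
    (h0 : ∀ k, Q k 0 = 0) (hd : ∀ k s, 0 < s → HasDerivAt (Q k) (y k s) s)
    (hy : ∀ k s, 0 < s → y (k + 1) s = Q k s / Real.sinh s) {C : ℝ}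
    (hC : ∀ s, 0 < s → 0 ≤ Q 0 s ∧ Q 0 s ≤ C * s) :
    ∀ k s, 0 < s → 0 ≤ Q k s ∧ Q k s ≤ C * s := by
  intro k
  induction k with
  | zero => exact hC
  | succ k ih =>
    have hC0 : 0 ≤ C := by simpa using (hC 1 one_pos).1.trans (hC 1 one_pos).2
    have hbd : ∀ s, 0 < s → 0 ≤ y (k + 1) s ∧ y (k + 1) s ≤ C := by
      intro s hs
      have hsh : 0 < Real.sinh s := Real.sinh_pos_iff.2 hs
      rw [hy k s hs]
      refine ⟨div_nonneg (ih s hs).1 hsh.le, ?_⟩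
      rw [div_le_iff₀ hsh]
      exact (ih s hs).2.trans (mul_le_mul_of_nonneg_left (Real.self_le_sinh_iff.2 hs.le) hC0)
    have h1 : MonotoneOn (Q (k + 1)) (Set.Ici 0) := by
      refine monotoneOn_of_hasDerivWithinAt_nonneg (convex_Ici 0) (hc _)
        (fun x hx => (hd (k + 1) x (by simpa using hx)).hasDerivWithinAt) fun x hx => ?_
      exact (hbd x (by simpa using hx)).1
    have h2 : MonotoneOn (fun s => C * s - Q (k + 1) s) (Set.Ici 0) := by
      refine monotoneOn_of_hasDerivWithinAt_nonneg (f' := fun s => C * 1 - y (k + 1) s)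
        (convex_Ici 0) ((continuousOn_const.mul continuousOn_id).sub (hc _))
        (fun x hx => (((hasDerivAt_id x).const_mul C).sub
          (hd (k + 1) x (by simpa using hx))).hasDerivWithinAt) fun x hx => ?_
      have := (hbd x (by simpa using hx)).2
      linarith
    intro s hs
    have h3 := h1 Set.self_mem_Ici (show s ∈ Set.Ici 0 from hs.le) hs.le
    have h4 := h2 Set.self_mem_Ici (show s ∈ Set.Ici 0 from hs.le) hs.le
    simp only [h0, mul_zero, sub_zero] at h3 h4
    exact ⟨h3, by linarith⟩

/-- The value does not depend on how the l kernels 1/sinh are divided between the factors: each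
integration by parts moves one across without a sign. Both factors are nonnegative because only
levels n ≤ l occur, which gives integrability. -/
theorem weightIntegral_mul_integral {Q : ℕ → ℝ → ℝ} {y : ℕ → ℝ → ℝ} {i : ℕ}
    (hc : ∀ k, ContinuousOn (Q k) (Set.Ici 0))
    (h0 : ∀ k, Q k 0 = 0) (hd : ∀ k s, 0 < s → HasDerivAt (Q k) (y k s) s)
    (hy : ∀ k s, 0 < s → y (k + 1) s = Q k s / Real.sinh s)
    (hQ : ∀ s, 0 ≤ s → Q 0 s = gudermann s ^ (i + 1) / ((i + 1).factorial : ℝ))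
    (hy0 : ∀ s, 0 < s → y 0 s = gudermann s ^ i / (i.factorial : ℝ) / Real.cosh s) (l q : ℕ) :
    ∀ k n, n + k = l →
      IntegrableOn (fun s => weightIntegral (stepSign l) n q s * y k s) (Set.Ioi 0) ∧
      ∫ s in Set.Ioi 0, weightIntegral (stepSign l) n q s * y k s =
        (-1) ^ (i + 1) * weightedSumW l (q + (l + i + 1)) (l + i + 1) := by
  have hb := iterated_bounds hc h0 hd hy (C := (Real.pi / 2) ^ i) (fun s hs => by
    have h0 := gudermann_pos hs
    rw [hQ s hs.le]
    refine ⟨by positivity, ?_⟩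
    refine (div_le_self (by positivity) (Nat.one_le_cast.2 (Nat.factorial_pos _))).trans ?_
    rw [pow_succ]
    exact mul_le_mul (pow_le_pow_left₀ h0.le (gudermann_lt s).le i) (gudermann_le_self hs.le)
      h0.le (by positivity))
  have hy_nonneg : ∀ k s, 0 < s → 0 ≤ y k s := by
    intro k s hs
    cases k with
    | zero =>
      rw [hy0 s hs]
      have := gudermann_pos hs
      have := Real.cosh_pos s
      positivity
    | succ k => rw [hy k s hs]; exact div_nonneg (hb k s hs).1 (Real.sinh_pos_iff.2 hs).le
  have key : ∀ k n, n + k = l → HasPrimitiveLimits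
      (fun s => (-1) ^ i * (weightIntegral (stepSign l) n q s * y k s))
      (weightedSumW l (q + (l + i + 1)) (l + i + 1)) := by
    intro k
    induction k with
    | zero =>
      rintro n rfl
      refine (hasPrimitiveLimits_weightIntegral_mul_gudermann_pow n q i 0).congr fun s hs => ?_
      simp only [hy0 s hs, add_zero]
    | succ k ih =>
      intro n hn
      have hsign : stepSign l n = 1 := by simp [stepSign, show n < l by omega]
      obtain ⟨h1, h2⟩ := tendsto_weightIntegral_mul (abs_stepSign l) n q (Y := Q k)
        (fun s hs => by rw [abs_of_nonneg (hb k s hs).1]; exact (hb k s hs).2)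
      have h3 := (ih (n + 1) (by omega)).sub_deriv (fun s hs =>
        (((hasDerivAt_weightIntegral_succ (abs_stepSign l) n q hs).mul (hd k s hs)).const_mul
          ((-1) ^ i))) (by simpa using h1.const_mul ((-1) ^ i))
          (by simpa using h2.const_mul ((-1) ^ i))
      refine h3.congr fun s hs => ?_
      rw [hsign, stepKernel_one hs, hy k s hs]
      ring
  intro k n hn
  have h1 := ((key k n hn).const_mul ((-1) ^ i)).congr
    (g := fun s => weightIntegral (stepSign l) n q s * y k s) fun s _ => by
      rw [← mul_assoc, ← mul_pow]; simp
  have h2 := h1.integral_eq fun s hs => mul_nonneg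
    (weightIntegral_nonneg (fun j hj => by simp [stepSign, show j < l by omega]) q hs.le)
    (hy_nonneg k s hs)
  exact ⟨h2.1, by rw [h2.2]; ring⟩

/-! ### Holomorphic iterated integrals along dz/sinh z -/

/-- The integral of `f` along the segment from `0` to `z`. -/
noncomputable def rayPrimitive (f : ℂ → ℂ) (z : ℂ) : ℂ := ∫ t in (0 : ℝ)..1, z * f (t * z)

theorem rayPrimitive_zero (f : ℂ → ℂ) : rayPrimitive f 0 = 0 := by simp [rayPrimitive]

theorem rayPrimitive_neg {f : ℂ → ℂ} (hf : ∀ z, f (-z) = f z) (z : ℂ) :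
    rayPrimitive f (-z) = -rayPrimitive f z := by
  simp only [rayPrimitive, mul_neg, hf, neg_mul, intervalIntegral.integral_neg]

theorem rayPrimitive_conj {f : ℂ → ℂ} (hf : ∀ z, f (conj z) = conj (f z)) (z : ℂ) :
    rayPrimitive f (conj z) = conj (rayPrimitive f z) := by
  rw [rayPrimitive, rayPrimitive, ← intervalIntegral.intervalIntegral_conj]
  refine intervalIntegral.integral_congr fun t _ => ?_
  simp only [map_mul, ← hf, Complex.conj_ofReal]

/-- Differentiation under the integral sign: the z-derivative of z f(tz) equals the t-derivative of
t f(tz), which integrates to f(z). -/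
theorem hasDerivAt_rayPrimitive {S : Set ℂ} (hS : IsOpen S)
    (hstar : ∀ z ∈ S, ∀ t : ℝ, 0 ≤ t → t ≤ 1 → (t : ℂ) * z ∈ S) {f : ℂ → ℂ}
    (hf : DifferentiableOn ℂ f S) {z₀ : ℂ} (hz₀ : z₀ ∈ S) :
    HasDerivAt (rayPrimitive f) (f z₀) z₀ := by
  have hf' : DifferentiableOn ℂ (deriv f) S := hf.deriv hS
  obtain ⟨ε, hε, hball⟩ := Metric.nhds_basis_closedBall.mem_iff.1 (hS.mem_nhds hz₀)
  set F' : ℂ → ℝ → ℂ := fun z t => f (t * z) + z * (deriv f (t * z) * t) with hF'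
  have hmul : Continuous fun p : ℂ × ℝ => (p.2 : ℂ) * p.1 := by fun_prop
  have hmaps : Set.MapsTo (fun p : ℂ × ℝ => (p.2 : ℂ) * p.1)
      (Metric.closedBall z₀ ε ×ˢ Set.Icc 0 1) S := fun p hp =>
    hstar _ (hball hp.1) _ hp.2.1 hp.2.2
  have hcont : ContinuousOn (fun p : ℂ × ℝ => F' p.1 p.2)
      (Metric.closedBall z₀ ε ×ˢ Set.Icc 0 1) := by
    have h1 := hf.continuousOn.comp hmul.continuousOn hmaps
    have h2 := hf'.continuousOn.comp hmul.continuousOn hmaps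
    exact h1.add (continuousOn_fst.mul (h2.mul (by fun_prop)))
  obtain ⟨C, hC⟩ := ((isCompact_closedBall z₀ ε).prod isCompact_Icc).exists_bound_of_continuousOn
    hcont
  have hcf : ∀ z ∈ S, ContinuousOn (fun t : ℝ => f (t * z)) (Set.uIcc 0 1) := by
    intro z hz
    rw [Set.uIcc_of_le zero_le_one]
    exact hf.continuousOn.comp (by fun_prop) fun t ht => hstar z hz t ht.1 ht.2
  have hcF' : ContinuousOn (F' z₀) (Set.uIcc 0 1) := by
    rw [Set.uIcc_of_le zero_le_one]
    exact hcont.comp (f := fun t : ℝ => (z₀, t)) (by fun_prop)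
      fun t ht => ⟨Metric.mem_closedBall_self hε.le, ht⟩
  have hI : ∀ z ∈ S, IntervalIntegrable (fun t : ℝ => z * f (t * z)) volume 0 1 := fun z hz =>
    (continuousOn_const.mul (hcf z hz)).intervalIntegrable
  have hd : ∀ z ∈ S, ∀ t : ℝ, 0 ≤ t → t ≤ 1 → HasDerivAt f (deriv f (t * z)) (t * z) :=
    fun z hz t h0 h1 => (hf.differentiableAt (hS.mem_nhds (hstar z hz t h0 h1))).hasDerivAt
  have hIoc : ∀ t : ℝ, t ∈ Set.uIoc 0 1 → 0 ≤ t ∧ t ≤ 1 := fun t ht => by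
    rw [Set.uIoc_of_le zero_le_one] at ht
    exact ⟨ht.1.le, ht.2⟩
  have key := (intervalIntegral.hasDerivAt_integral_of_dominated_loc_of_deriv_le (μ := volume)
    (F := fun z (t : ℝ) => z * f (t * z)) (F' := F') (bound := fun _ => C) (x₀ := z₀)
    (a := 0) (b := 1) (Metric.closedBall_mem_nhds z₀ hε) ?_ (hI z₀ hz₀) ?_ ?_ ?_ ?_).2
  · refine (show HasDerivAt (rayPrimitive f) _ z₀ from key).congr_deriv ?_
    have h1 : ∀ t ∈ Set.uIcc (0 : ℝ) 1,
        HasDerivAt (fun t : ℝ => (t : ℂ) * f (t * z₀)) (F' z₀ t) t := by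
      intro t ht
      rw [Set.uIcc_of_le zero_le_one] at ht
      have h2 : HasDerivAt (fun t : ℝ => (t : ℂ)) 1 t := Complex.ofRealCLM.hasDerivAt
      have h3 : HasDerivAt (fun t : ℝ => f (t * z₀)) (deriv f (t * z₀) * (1 * z₀)) t :=
        (hd z₀ hz₀ t ht.1 ht.2).comp t (h2.mul_const z₀)
      refine (h2.mul h3).congr_deriv ?_
      simp only [hF']
      ring
    rw [intervalIntegral.integral_eq_sub_of_hasDerivAt h1 hcF'.intervalIntegrable]
    simp
  · filter_upwards [hS.mem_nhds hz₀] with z hz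
    exact (intervalIntegrable_iff.1 (hI z hz)).aestronglyMeasurable
  · exact (intervalIntegrable_iff.1 hcF'.intervalIntegrable).aestronglyMeasurable
  · exact .of_forall fun t ht z hz => hC (z, t) ⟨hz, hIoc t ht⟩
  · exact intervalIntegrable_const
  · refine .of_forall fun t ht z hz => ?_
    have h1 := (hasDerivAt_id z).mul ((hd z (hball hz) t (hIoc t ht).1 (hIoc t ht).2).comp z
      ((hasDerivAt_id z).const_mul (t : ℂ)))
    refine h1.congr_deriv ?_
    simp [hF']

/-- The complex plane without the rays from `± π * I` to infinity along the imaginary axis. -/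
def slitDomain : Set ℂ := {z | z.re ≠ 0 ∨ |z.im| < Real.pi}

theorem isOpen_slitDomain : IsOpen slitDomain :=
  (isOpen_ne_fun Complex.continuous_re continuous_const).union
    (isOpen_lt Complex.continuous_im.abs continuous_const)

theorem mul_mem_slitDomain : ∀ z ∈ slitDomain, ∀ t : ℝ, 0 ≤ t → t ≤ 1 →
    (t : ℂ) * z ∈ slitDomain := by
  intro z hz t h0 h1
  rcases h0.eq_or_lt with rfl | h0
  · right; simp [Real.pi_pos]
  · rcases hz with hz | hz
    · left; simp [h0.ne', hz]
    · right
      rw [Complex.im_ofReal_mul, abs_mul, abs_of_pos h0]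
      exact (mul_le_of_le_one_left (abs_nonneg _) h1).trans_lt hz

theorem zero_mem_slitDomain : (0 : ℂ) ∈ slitDomain := by
  right; simp [Real.pi_pos]

theorem sinh_eq_re_im (z : ℂ) : Complex.sinh z =
    ((Real.sinh z.re * Real.cos z.im : ℝ) : ℂ) + ((Real.cosh z.re * Real.sin z.im : ℝ) : ℂ) *
      Complex.I := by
  conv_lhs => rw [← Complex.re_add_im z]
  rw [Complex.sinh_add, Complex.sinh_mul_I, Complex.cosh_mul_I]
  push_cast
  ring

theorem cosh_eq_re_im (z : ℂ) : Complex.cosh z =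
    ((Real.cosh z.re * Real.cos z.im : ℝ) : ℂ) + ((Real.sinh z.re * Real.sin z.im : ℝ) : ℂ) *
      Complex.I := by
  conv_lhs => rw [← Complex.re_add_im z]
  rw [Complex.cosh_add, Complex.sinh_mul_I, Complex.cosh_mul_I]
  push_cast
  ring

theorem normSq_sinh (z : ℂ) : ‖Complex.sinh z‖ ^ 2 = Real.sinh z.re ^ 2 + Real.sin z.im ^ 2 := by
  rw [← Complex.normSq_eq_norm_sq, sinh_eq_re_im, Complex.normSq_add_mul_I]
  have h1 := Real.cosh_sq z.re
  have h2 := Real.sin_sq_add_cos_sq z.im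
  linear_combination Real.sin z.im ^ 2 * h1 + Real.sinh z.re ^ 2 * h2

theorem normSq_cosh (z : ℂ) : ‖Complex.cosh z‖ ^ 2 = Real.sinh z.re ^ 2 + Real.cos z.im ^ 2 := by
  rw [← Complex.normSq_eq_norm_sq, cosh_eq_re_im, Complex.normSq_add_mul_I]
  have h1 := Real.cosh_sq z.re
  have h2 := Real.sin_sq_add_cos_sq z.im
  linear_combination Real.cos z.im ^ 2 * h1 + Real.sinh z.re ^ 2 * h2

theorem sinh_ne_zero_of_mem_slitDomain {z : ℂ} (hz : z ∈ slitDomain) (h0 : z ≠ 0) :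
    Complex.sinh z ≠ 0 := by
  intro h
  have h1 := normSq_sinh z
  rw [h, norm_zero] at h1
  have h2 : Real.sinh z.re = 0 := by nlinarith [sq_nonneg (Real.sinh z.re), sq_nonneg (Real.sin z.im)]
  have h3 : Real.sin z.im = 0 := by nlinarith [sq_nonneg (Real.sinh z.re), sq_nonneg (Real.sin z.im)]
  have h4 : z.re = 0 := Real.sinh_eq_zero.1 h2
  rcases hz with hz | hz
  · exact hz h4
  · have h5 := (Real.sin_eq_zero_iff_of_lt_of_lt (abs_lt.1 hz).1 (abs_lt.1 hz).2).1 h3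
    exact h0 (Complex.ext h4 h5)

/-- `g z / sinh z`, extended to `z = 0`. -/
noncomputable def divSinh (g : ℂ → ℂ) (z : ℂ) : ℂ := dslope g 0 z / dslope Complex.sinh 0 z

theorem divSinh_of_ne {g : ℂ → ℂ} (hg : g 0 = 0) {z : ℂ} (hz : z ≠ 0) :
    divSinh g z = g z / Complex.sinh z := by
  rw [divSinh, dslope_of_ne _ hz, dslope_of_ne _ hz, slope_def_field, slope_def_field, hg,
    Complex.sinh_zero, sub_zero, sub_zero, sub_zero, div_div_div_cancel_right₀ hz]

theorem divSinh_zero (g : ℂ → ℂ) : divSinh g 0 = deriv g 0 := by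
  rw [divSinh, dslope_same, dslope_same, Complex.deriv_sinh, Complex.cosh_zero, div_one]

theorem differentiableOn_divSinh {g : ℂ → ℂ} (hg : DifferentiableOn ℂ g slitDomain) :
    DifferentiableOn ℂ (divSinh g) slitDomain := by
  have h0 := isOpen_slitDomain.mem_nhds zero_mem_slitDomain
  refine ((Complex.differentiableOn_dslope h0).2 hg).div
    ((Complex.differentiableOn_dslope h0).2 Complex.differentiable_sinh.differentiableOn) ?_
  intro z hz
  rcases eq_or_ne z 0 with rfl | hz0
  · simp [dslope_same]
  · rw [dslope_of_ne _ hz0, slope_def_field, Complex.sinh_zero, sub_zero, sub_zero]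
    exact div_ne_zero (sinh_ne_zero_of_mem_slitDomain hz hz0) hz0

theorem divSinh_neg {g : ℂ → ℂ} (h0 : g 0 = 0) (hg : ∀ z, g (-z) = -g z) (z : ℂ) :
    divSinh g (-z) = divSinh g z := by
  rcases eq_or_ne z 0 with rfl | hz
  · simp
  · rw [divSinh_of_ne h0 hz, divSinh_of_ne h0 (neg_ne_zero.2 hz), hg, Complex.sinh_neg, neg_div_neg_eq]

theorem divSinh_conj {g : ℂ → ℂ} (h0 : g 0 = 0) (hd : DifferentiableAt ℂ g 0)
    (hg : ∀ z, g (conj z) = conj (g z)) (z : ℂ) : divSinh g (conj z) = conj (divSinh g z) := by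
  rcases eq_or_ne z 0 with rfl | hz
  · have h1 := hd.hasDerivAt.conj_conj
    have h2 : conj ∘ g ∘ conj = g := by ext z; simp [hg]
    rw [h2, map_zero] at h1
    rw [map_zero, divSinh_zero]
    exact h1.deriv
  · rw [divSinh_of_ne h0 hz, divSinh_of_ne h0 (by simpa using hz), hg, Complex.sinh_conj, map_div₀]

/-- The iterated integrals of `z ^ (n + 1) / (n + 1)!` along `dz / sinh z` from `0`. -/
noncomputable def sinhIterate (n : ℕ) : ℕ → ℂ → ℂ
  | 0 => fun z => z ^ (n + 1) / ((n + 1).factorial : ℂ)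
  | k + 1 => rayPrimitive (divSinh (sinhIterate n k))

/-- The derivative of `sinhIterate`. -/
noncomputable def sinhIterateDeriv (n : ℕ) : ℕ → ℂ → ℂ
  | 0 => fun z => z ^ n / (n.factorial : ℂ)
  | k + 1 => divSinh (sinhIterate n k)

theorem sinhIterate_zero (n k : ℕ) : sinhIterate n k 0 = 0 := by
  cases k with
  | zero => simp [sinhIterate]
  | succ k => exact rayPrimitive_zero _

/-- Oddness and conjugation symmetry pass through each step. Together they make the iterates real on
the real axis and purely imaginary on the imaginary axis, which eliminates the unwanted edges of the
contour. -/
theorem sinhIterate_properties {n : ℕ} (hn : Even n) (k : ℕ) :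
    DifferentiableOn ℂ (sinhIterate n k) slitDomain ∧
      (∀ z, sinhIterate n k (-z) = -sinhIterate n k z) ∧
      ∀ z, sinhIterate n k (conj z) = conj (sinhIterate n k z) := by
  induction k with
  | zero =>
    simp only [sinhIterate]
    refine ⟨by fun_prop, fun z => ?_, fun z => ?_⟩
    · rw [(hn.add_one).neg_pow, neg_div]
    · simp
  | succ k ih =>
    obtain ⟨h1, h2, h3⟩ := ih
    have h4 := h1.differentiableAt (isOpen_slitDomain.mem_nhds zero_mem_slitDomain)
    refine ⟨fun z hz => ?_, rayPrimitive_neg (divSinh_neg (sinhIterate_zero n k) h2),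
      rayPrimitive_conj (divSinh_conj (sinhIterate_zero n k) h4 h3)⟩
    exact (hasDerivAt_rayPrimitive isOpen_slitDomain mul_mem_slitDomain
      (differentiableOn_divSinh h1) hz).differentiableAt.differentiableWithinAt

theorem hasDerivAt_sinhIterate {n : ℕ} (hn : Even n) (k : ℕ) {z : ℂ} (hz : z ∈ slitDomain) :
    HasDerivAt (sinhIterate n k) (sinhIterateDeriv n k z) z := by
  cases k with
  | zero =>
    refine ((hasDerivAt_pow (n + 1) z).div_const _).congr_deriv ?_
    simp only [sinhIterateDeriv, Nat.factorial_succ]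
    push_cast
    have : (n : ℂ) + 1 ≠ 0 := by exact_mod_cast n.succ_ne_zero
    have : (n.factorial : ℂ) ≠ 0 := by exact_mod_cast n.factorial_ne_zero
    field_simp
  | succ k =>
    exact hasDerivAt_rayPrimitive isOpen_slitDomain mul_mem_slitDomain
      (differentiableOn_divSinh (sinhIterate_properties hn k).1) hz

theorem differentiableOn_sinhIterateDeriv {n : ℕ} (hn : Even n) (k : ℕ) :
    DifferentiableOn ℂ (sinhIterateDeriv n k) slitDomain := by
  cases k with
  | zero => simp only [sinhIterateDeriv]; fun_prop
  | succ k => exact differentiableOn_divSinh (sinhIterate_properties hn k).1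

theorem sinhIterateDeriv_succ (n k : ℕ) {z : ℂ} (hz : z ≠ 0) :
    sinhIterateDeriv n (k + 1) z = sinhIterate n k z / Complex.sinh z :=
  divSinh_of_ne (sinhIterate_zero n k) hz

theorem sinhIterate_ofReal_im {n : ℕ} (hn : Even n) (k : ℕ) (x : ℝ) :
    (sinhIterate n k x).im = 0 := by
  have h := (sinhIterate_properties hn k).2.2 x
  rw [Complex.conj_ofReal] at h
  exact Complex.conj_eq_iff_im.1 h.symm

theorem sinhIterate_mul_I_re {n : ℕ} (hn : Even n) (k : ℕ) (v : ℝ) :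
    (sinhIterate n k (v * Complex.I)).re = 0 := by
  have h1 := (sinhIterate_properties hn k).2.2 (v * Complex.I)
  have h2 := (sinhIterate_properties hn k).2.1 (v * Complex.I)
  rw [map_mul, Complex.conj_ofReal, Complex.conj_I, mul_neg, h2] at h1
  have := congrArg Complex.re h1
  simp at this
  linarith

/-! ### The complex Gudermann function on the closed half strip -/

/-- The holomorphic function `π - gd z` on the right half plane, where `gd` is the Gudermann
function. -/
noncomputable def coGudermann (z : ℂ) : ℂ :=
  Real.pi / 2 - Complex.I * (Complex.log (1 + Complex.I * Complex.exp (-z)) -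
    Complex.log (1 - Complex.I * Complex.exp (-z)))

theorem I_mul_exp_neg (z : ℂ) : Complex.I * Complex.exp (-z) =
    ((Real.exp (-z.re) * Real.sin z.im : ℝ) : ℂ) +
      ((Real.exp (-z.re) * Real.cos z.im : ℝ) : ℂ) * Complex.I := by
  conv_lhs => rw [← Complex.re_add_im z, neg_add, Complex.exp_add, ← neg_mul, Complex.exp_mul_I]
  push_cast
  rw [Complex.cos_neg, Complex.sin_neg]
  linear_combination (-Complex.exp (-z.re) * Complex.sin z.im) * Complex.I_mul_I

theorem one_add_I_mul_exp_neg_re (z : ℂ) :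
    (1 + Complex.I * Complex.exp (-z)).re = 1 + Real.exp (-z.re) * Real.sin z.im := by
  rw [I_mul_exp_neg, Complex.add_re, Complex.add_re, Complex.one_re, Complex.ofReal_re,
    Complex.re_ofReal_mul, Complex.I_re, mul_zero, add_zero]

theorem one_sub_I_mul_exp_neg (z : ℂ) :
    1 - Complex.I * Complex.exp (-z) = ((1 - Real.exp (-z.re) * Real.sin z.im : ℝ) : ℂ) +
      ((-(Real.exp (-z.re) * Real.cos z.im) : ℝ) : ℂ) * Complex.I := by
  rw [I_mul_exp_neg]; push_cast; ring

/-- The closed half strip without the singularity of `coGudermann`. -/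
def puncturedStrip : Set ℂ :=
  {z | 0 ≤ z.re ∧ 0 ≤ z.im ∧ z.im ≤ Real.pi ∧ (z.re ≠ 0 ∨ z.im ≠ Real.pi / 2)}

theorem one_le_one_add_re {z : ℂ} (h0 : 0 ≤ z.im) (h1 : z.im ≤ Real.pi) :
    1 ≤ (1 + Complex.I * Complex.exp (-z)).re := by
  rw [one_add_I_mul_exp_neg_re]
  have := mul_nonneg (Real.exp_nonneg (-z.re)) (Real.sin_nonneg_of_nonneg_of_le_pi h0 h1)
  linarith

theorem one_sub_mem_slitPlane {z : ℂ} (hz : z ∈ puncturedStrip) :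
    1 - Complex.I * Complex.exp (-z) ∈ Complex.slitPlane := by
  obtain ⟨h0, h1, h2, h3⟩ := hz
  left
  rw [one_sub_I_mul_exp_neg]
  simp only [Complex.add_re, Complex.ofReal_re, Complex.re_ofReal_mul, Complex.I_re, mul_zero,
    add_zero]
  have he : Real.exp (-z.re) ≤ 1 := Real.exp_le_one_iff.2 (by linarith)
  have hs0 := Real.sin_nonneg_of_nonneg_of_le_pi h1 h2
  have hs := Real.sin_le_one z.im
  rcases h3 with h3 | h3
  · have : Real.exp (-z.re) < 1 := Real.exp_lt_one_iff.2 (by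
      have := lt_of_le_of_ne h0 (Ne.symm h3)
      linarith)
    nlinarith [Real.exp_pos (-z.re)]
  · have : Real.sin z.im < 1 := by
      rw [← Real.cos_pi_div_two_sub, ← Real.cos_abs]
      refine (Real.cos_lt_cos_of_nonneg_of_le_pi le_rfl ?_ ?_).trans_eq Real.cos_zero
      · rw [abs_le]; constructor <;> linarith
      · exact abs_pos.2 (sub_ne_zero.2 (Ne.symm h3))
    nlinarith [Real.exp_pos (-z.re)]

theorem hasDerivAt_coGudermann {z : ℂ} (hz : z ∈ puncturedStrip) :
    HasDerivAt coGudermann (-(Complex.cosh z)⁻¹) z := by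
  have hp : 1 + Complex.I * Complex.exp (-z) ∈ Complex.slitPlane :=
    Or.inl (zero_lt_one.trans_le (one_le_one_add_re hz.2.1 hz.2.2.1))
  have hm := one_sub_mem_slitPlane hz
  have h1 : HasDerivAt (fun z => Complex.I * Complex.exp (-z))
      (Complex.I * (Complex.exp (-z) * -1)) z :=
    ((hasDerivAt_neg z).cexp).const_mul _
  have h2 := (h1.const_add 1).clog hp
  have h3 := (h1.const_sub 1).clog hm
  refine (((h2.sub h3).const_mul Complex.I).const_sub ((Real.pi : ℂ) / 2)).congr_deriv ?_
  have hp' := Complex.slitPlane_ne_zero hp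
  have hm' := Complex.slitPlane_ne_zero hm
  have h4 : Complex.exp z * Complex.exp (-z) = 1 := by rw [← Complex.exp_add]; simp
  set t := Complex.exp (-z)
  have hI := Complex.I_mul_I
  -- With t = exp(-z), both sides equal 1 + t².
  have h5 : (1 + Complex.I * t) * (1 - Complex.I * t) = 2 * (Complex.cosh z * t) := by
    rw [Complex.cosh]
    linear_combination -t ^ 2 * hI - h4
  have ht : t ≠ 0 := Complex.exp_ne_zero _
  have h6 : Complex.cosh z ≠ 0 := by
    intro h
    rw [h, zero_mul, mul_zero] at h5
    exact mul_ne_zero hp' hm' h5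
  have h7 : Complex.I * (Complex.I * (t * -1) / (1 + Complex.I * t) -
      -(Complex.I * (t * -1)) / (1 - Complex.I * t)) =
      2 * t / ((1 + Complex.I * t) * (1 - Complex.I * t)) := by
    field_simp
    linear_combination (-2 : ℂ) * hI
  rw [h7, h5]
  field_simp

theorem log_polar {r θ : ℝ} (hr : 0 < r) (h1 : -Real.pi < θ) (h2 : θ ≤ Real.pi) :
    Complex.log (r * Complex.exp (θ * Complex.I)) = Real.log r + θ * Complex.I := by
  rw [Complex.log_ofReal_mul hr (Complex.exp_ne_zero _), Complex.log_exp (by simpa) (by simpa)]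

theorem log_one_add_sub_log_one_sub (τ : ℝ) :
    Complex.log (1 + Complex.I * τ) - Complex.log (1 - Complex.I * τ) =
      2 * Real.arctan τ * Complex.I := by
  set θ := Real.arctan τ with hθ
  have hc : 0 < Real.cos θ := Real.cos_arctan_pos τ
  have hc' : Complex.cos θ ≠ 0 := by exact_mod_cast hc.ne'
  have hτ : (τ : ℂ) * Complex.cos θ = Complex.sin θ := by
    have := Real.tan_mul_cos hc.ne'
    rw [hθ, Real.tan_arctan, ← hθ] at this
    exact_mod_cast this
  have h1 : 1 + Complex.I * τ = ((Real.cos θ)⁻¹ : ℝ) * Complex.exp (θ * Complex.I) := by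
    rw [Complex.exp_mul_I]
    push_cast
    field_simp
    linear_combination Complex.I * hτ
  have h2 : 1 - Complex.I * τ = ((Real.cos θ)⁻¹ : ℝ) * Complex.exp ((-θ : ℝ) * Complex.I) := by
    rw [Complex.exp_mul_I]
    push_cast
    rw [Complex.cos_neg, Complex.sin_neg]
    field_simp
    linear_combination -Complex.I * hτ
  have h3 := Real.neg_pi_div_two_lt_arctan τ
  have h4 := Real.arctan_lt_pi_div_two τ
  have h5 := Real.pi_pos
  rw [h1, h2, log_polar (inv_pos.2 hc) (by linarith) (by linarith),
    log_polar (inv_pos.2 hc) (by linarith) (by linarith)]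
  push_cast
  ring

theorem coGudermann_ofReal (x : ℝ) :
    coGudermann x = (Real.pi / 2 + 2 * Real.arctan (Real.exp (-x)) : ℝ) := by
  rw [coGudermann, ← Complex.ofReal_neg, ← Complex.ofReal_exp, log_one_add_sub_log_one_sub]
  generalize Real.arctan _ = a
  push_cast
  linear_combination (-2 * (a : ℂ)) * Complex.I_mul_I

theorem coGudermann_add_pi_mul_I (s : ℝ) :
    coGudermann (s + Real.pi * Complex.I) = gudermann s := by
  have h1 : Complex.exp (-(s + Real.pi * Complex.I)) = ((-Real.exp (-s) : ℝ) : ℂ) := by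
    rw [neg_add, Complex.exp_add, Complex.exp_neg (_ * _), Complex.exp_pi_mul_I]
    push_cast
    norm_num
  rw [coGudermann, h1, log_one_add_sub_log_one_sub, Real.arctan_neg, gudermann]
  generalize Real.arctan _ = a
  push_cast
  linear_combination (2 * (a : ℂ)) * Complex.I_mul_I

theorem one_add_exp_two_mul (θ : ℝ) : 1 + Complex.exp (2 * θ * Complex.I) =
    ((2 * Real.cos θ : ℝ) : ℂ) * Complex.exp (θ * Complex.I) := by
  rw [show (2 * θ * Complex.I : ℂ) = θ * Complex.I + θ * Complex.I by ring, Complex.exp_add,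
    Complex.exp_mul_I]
  push_cast
  have h1 := Complex.sin_sq_add_cos_sq (θ : ℂ)
  linear_combination (Complex.sin θ ^ 2) * Complex.I_mul_I - h1

theorem one_sub_exp_two_mul (θ : ℝ) : 1 - Complex.exp (2 * θ * Complex.I) =
    ((2 * Real.sin θ : ℝ) : ℂ) * Complex.exp ((θ - Real.pi / 2 : ℝ) * Complex.I) := by
  rw [show (2 * θ * Complex.I : ℂ) = θ * Complex.I + θ * Complex.I by ring, Complex.exp_add,
    Complex.exp_mul_I, Complex.exp_mul_I, ← Complex.ofReal_cos, ← Complex.ofReal_sin,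
    ← Complex.ofReal_cos, ← Complex.ofReal_sin, Real.cos_sub_pi_div_two, Real.sin_sub_pi_div_two]
  push_cast
  have h1 := Complex.sin_sq_add_cos_sq (θ : ℂ)
  linear_combination (-Complex.sin θ ^ 2) * Complex.I_mul_I - h1

theorem I_mul_exp_neg_mul_I (θ : ℝ) :
    Complex.I * Complex.exp (-((Real.pi / 2 - 2 * θ : ℝ) * Complex.I)) =
      Complex.exp (2 * θ * Complex.I) := by
  rw [show -(((Real.pi / 2 - 2 * θ : ℝ) : ℂ) * Complex.I) =
    2 * θ * Complex.I + -(Real.pi / 2 * Complex.I) by push_cast; ring, Complex.exp_add,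
    Complex.exp_neg (_ / _ * _), Complex.exp_pi_div_two_mul_I]
  simp
  rw [mul_left_comm, Complex.I_mul_I]
  ring

/-- With tan θ = exp(-s) the logarithms are taken at 1 ± exp(2iθ), whose arguments are θ and θ - π/2
and whose moduli are 2 cos θ and 2 sin θ; the ratio of the moduli contributes s. -/
theorem coGudermann_gudermann_mul_I (s : ℝ) :
    coGudermann (gudermann s * Complex.I) = Real.pi - s * Complex.I := by
  set θ := Real.arctan (Real.exp (-s)) with hθ
  have h0 : 0 < θ := Real.arctan_pos.2 (Real.exp_pos _)
  have h1 : θ < Real.pi / 2 := Real.arctan_lt_pi_div_two _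
  have hpi := Real.pi_pos
  have hc : 0 < Real.cos θ := Real.cos_arctan_pos _
  have hs : 0 < Real.sin θ := Real.sin_pos_of_pos_of_lt_pi h0 (by linarith)
  have hlog : Real.log (2 * Real.sin θ) = Real.log (2 * Real.cos θ) - s := by
    have h2 : Real.sin θ = Real.exp (-s) * Real.cos θ := by
      have := Real.tan_mul_cos hc.ne'
      rw [← this, hθ, Real.tan_arctan]
    rw [h2, mul_left_comm, Real.log_mul (Real.exp_pos _).ne' (by positivity), Real.log_exp]
    ring
  rw [coGudermann, gudermann, ← hθ, I_mul_exp_neg_mul_I, one_add_exp_two_mul, one_sub_exp_two_mul,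
    log_polar (by positivity) (by linarith) (by linarith),
    log_polar (by positivity) (by linarith) (by linarith), hlog]
  push_cast
  linear_combination (-(Real.pi / 2) : ℂ) * Complex.I_mul_I

/-- Above iπ/2 the sine of θ is negative, so the second argument becomes θ + π/2 instead of θ - π/2.
The difference of arguments now cancels the constant π/2. -/
theorem coGudermann_mul_I_re {v : ℝ} (h0 : Real.pi / 2 < v) (h1 : v ≤ Real.pi) :
    (coGudermann (v * Complex.I)).re = 0 := by
  set θ := Real.pi / 4 - v / 2 with hθ
  have hpi := Real.pi_pos
  have hv : v = Real.pi / 2 - 2 * θ := by rw [hθ]; ring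
  have hc : 0 < Real.cos θ := Real.cos_pos_of_mem_Ioo ⟨by linarith, by linarith⟩
  have hs : Real.sin θ < 0 := Real.sin_neg_of_neg_of_neg_pi_lt (by linarith) (by linarith)
  have h3 : ((2 * Real.sin θ : ℝ) : ℂ) * Complex.exp ((θ - Real.pi / 2 : ℝ) * Complex.I) =
      ((-(2 * Real.sin θ) : ℝ) : ℂ) * Complex.exp ((θ + Real.pi / 2 : ℝ) * Complex.I) := by
    rw [show (((θ + Real.pi / 2 : ℝ) : ℂ) * Complex.I) =
      (θ - Real.pi / 2 : ℝ) * Complex.I + Real.pi * Complex.I by push_cast; ring, Complex.exp_add,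
      Complex.exp_pi_mul_I]
    push_cast
    ring
  rw [coGudermann, hv, I_mul_exp_neg_mul_I, one_add_exp_two_mul, one_sub_exp_two_mul, h3,
    log_polar (by positivity) (by linarith) (by linarith),
    log_polar (by linarith) (by linarith) (by linarith)]
  simp

theorem norm_log_le (z : ℂ) : ‖Complex.log z‖ ≤ |Real.log ‖z‖| + Real.pi := by
  rw [Complex.log]
  refine (norm_add_le _ _).trans ?_
  rw [norm_mul, Complex.norm_I, mul_one, Complex.norm_real, Complex.norm_real]
  exact add_le_add le_rfl (Complex.abs_arg_le_pi z)

theorem abs_log_le_of_le_two {a y : ℝ} (ha : 0 < a) (ha1 : a ≤ 1) (h1 : a ≤ y) (h2 : y ≤ 2) :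
    |Real.log y| ≤ Real.log 2 + |Real.log a| := by
  have h3 := Real.log_le_log ha h1
  have h4 := Real.log_le_log (ha.trans_le h1) h2
  have h5 := Real.log_nonpos ha.le ha1
  have h6 : 0 < Real.log 2 := Real.log_pos one_lt_two
  rw [abs_of_nonpos h5, abs_le]
  constructor <;> linarith

theorem norm_coGudermann_le {z : ℂ} (h0 : 0 ≤ z.re) (h1 : 0 ≤ z.im) (h2 : z.im ≤ Real.pi) {a : ℝ}
    (ha : 0 < a) (ha1 : a ≤ 1) (haz : a ≤ ‖1 - Complex.I * Complex.exp (-z)‖) :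
    ‖coGudermann z‖ ≤ 12 + |Real.log a| := by
  have ht : ‖Complex.I * Complex.exp (-z)‖ ≤ 1 := by
    rw [norm_mul, Complex.norm_I, one_mul, Complex.norm_exp]
    exact Real.exp_le_one_iff.2 (by simpa using h0)
  have hp2 : ‖1 + Complex.I * Complex.exp (-z)‖ ≤ 2 := by
    refine (norm_add_le _ _).trans ?_
    rw [norm_one]; linarith
  have hm2 : ‖1 - Complex.I * Complex.exp (-z)‖ ≤ 2 := by
    refine (norm_sub_le _ _).trans ?_
    rw [norm_one]; linarith
  have hp1 := (one_le_one_add_re h1 h2).trans ((le_abs_self _).trans (Complex.abs_re_le_norm _))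
  have h3 := abs_log_le_of_le_two one_pos le_rfl hp1 hp2
  have h4 := abs_log_le_of_le_two ha ha1 haz hm2
  rw [Real.log_one, abs_zero, add_zero] at h3
  have hpi := Real.pi_lt_d2
  have hlog := Real.log_two_lt_d9
  have h5 : ‖(Real.pi : ℂ) / 2‖ = Real.pi / 2 := by
    rw [norm_div, Complex.norm_real, Real.norm_of_nonneg Real.pi_pos.le]; simp
  calc ‖coGudermann z‖ ≤ ‖(Real.pi : ℂ) / 2‖ + ‖Complex.log (1 + Complex.I * Complex.exp (-z)) -
        Complex.log (1 - Complex.I * Complex.exp (-z))‖ := by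
        refine (norm_sub_le _ _).trans ?_
        rw [norm_mul, Complex.norm_I, one_mul]
    _ ≤ Real.pi / 2 + ((|Real.log ‖1 + Complex.I * Complex.exp (-z)‖| + Real.pi) +
        (|Real.log ‖1 - Complex.I * Complex.exp (-z)‖| + Real.pi)) := by
        rw [h5]
        exact add_le_add le_rfl ((norm_sub_le _ _).trans (add_le_add (norm_log_le _) (norm_log_le _)))
    _ ≤ _ := by linarith

/-- For z = x + iv the squared norm is cos² v + (exp(-x) - sin v)². The bound is uniform in x, as
dominated convergence requires. -/
theorem abs_cos_le_norm_one_sub (z : ℂ) : |Real.cos z.im| ≤ ‖1 - Complex.I * Complex.exp (-z)‖ := by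
  refine abs_le_of_sq_le_sq ?_ (norm_nonneg _)
  rw [← Complex.normSq_eq_norm_sq, one_sub_I_mul_exp_neg, Complex.normSq_add_mul_I]
  have h1 := Real.sin_sq_add_cos_sq z.im
  nlinarith [sq_nonneg (Real.exp (-z.re) - Real.sin z.im)]

theorem norm_coGudermann_le_log_cos {z : ℂ} (h0 : 0 ≤ z.re) (h1 : 0 ≤ z.im) (h2 : z.im ≤ Real.pi)
    (h3 : Real.cos z.im ≠ 0) : ‖coGudermann z‖ ≤ 12 + |Real.log (|Real.cos z.im|)| :=
  norm_coGudermann_le h0 h1 h2 (abs_pos.2 h3) (Real.abs_cos_le_one _) (abs_cos_le_norm_one_sub z)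

theorem norm_coGudermann_le_const {z : ℂ} (h0 : 1 ≤ z.re) (h1 : 0 ≤ z.im) (h2 : z.im ≤ Real.pi) :
    ‖coGudermann z‖ ≤ 13 := by
  have h3 : ‖Complex.I * Complex.exp (-z)‖ ≤ 1 / 2 := by
    rw [norm_mul, Complex.norm_I, one_mul, Complex.norm_exp, Complex.neg_re, Real.exp_neg]
    rw [one_div]
    refine inv_anti₀ two_pos ?_
    linarith [Real.add_one_le_exp z.re]
  have h4 : (1 : ℝ) / 2 ≤ ‖1 - Complex.I * Complex.exp (-z)‖ := by
    have := norm_sub_norm_le 1 (Complex.I * Complex.exp (-z))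
    rw [norm_one] at this
    linarith
  refine (norm_coGudermann_le (by linarith) h1 h2 (by norm_num) (by norm_num) h4).trans ?_
  rw [one_div, Real.log_inv, abs_neg, abs_of_pos (Real.log_pos one_lt_two)]
  linarith [Real.log_two_lt_d9]

/-! ### The sinh iterates in the strip and on the line Im z = π -/

theorem im_add_pi_mul_I_pow (a : ℕ) (s : ℝ) :
    (((s : ℂ) + Real.pi * Complex.I) ^ (2 * a + 1) / ((2 * a + 1).factorial : ℂ)).im =
      Real.pi * ∑ j ∈ Finset.range (a + 1), alphaCoeff (a - j) *
        (s ^ (2 * j) / ((2 * j).factorial : ℝ)) := by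
  have hsplit : ∀ (F : ℕ → ℝ) (b : ℕ), ∑ k ∈ Finset.range (2 * b), F k =
      ∑ j ∈ Finset.range b, (F (2 * j) + F (2 * j + 1)) := by
    intro F b
    induction b with
    | zero => simp
    | succ b ih =>
      rw [show 2 * (b + 1) = 2 * b + 1 + 1 by ring, Finset.sum_range_succ, Finset.sum_range_succ, ih,
        Finset.sum_range_succ]
      ring
  -- In the binomial expansion only even powers of s meet odd powers of πi; the term with
  -- (πi)^(2d+1) supplies π times α_d.
  rw [add_pow, Finset.sum_div, Complex.im_sum, show 2 * a + 1 + 1 = 2 * (a + 1) by ring, hsplit,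
    Finset.mul_sum]
  refine Finset.sum_congr rfl fun j hj => ?_
  obtain ⟨d, rfl⟩ : ∃ d, a = j + d := Nat.exists_eq_add_of_le (by simp at hj; omega)
  have hI : Complex.I ^ (2 * d) = ((-1) ^ d : ℝ) := by rw [pow_mul, Complex.I_sq]; push_cast; rfl
  have h1 : ((s : ℂ) ^ (2 * j) * (Real.pi * Complex.I) ^ (2 * (j + d) + 1 - 2 * j) *
      ((2 * (j + d) + 1).choose (2 * j) : ℂ) / ((2 * (j + d) + 1).factorial : ℂ)) =
      ((s ^ (2 * j) * (Real.pi ^ (2 * d + 1) * (-1) ^ d) * ((2 * (j + d) + 1).choose (2 * j) : ℝ) /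
        ((2 * (j + d) + 1).factorial : ℝ) : ℝ) : ℂ) * Complex.I := by
    rw [show 2 * (j + d) + 1 - 2 * j = 2 * d + 1 by omega, mul_pow, pow_succ Complex.I, hI]
    push_cast
    ring
  have h2 : ((s : ℂ) ^ (2 * j + 1) * (Real.pi * Complex.I) ^ (2 * (j + d) + 1 - (2 * j + 1)) *
      ((2 * (j + d) + 1).choose (2 * j + 1) : ℂ) / ((2 * (j + d) + 1).factorial : ℂ)) =
      ((s ^ (2 * j + 1) * (Real.pi ^ (2 * d) * (-1) ^ d) *
        ((2 * (j + d) + 1).choose (2 * j + 1) : ℝ) / ((2 * (j + d) + 1).factorial : ℝ) : ℝ) : ℂ) := by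
    rw [show 2 * (j + d) + 1 - (2 * j + 1) = 2 * d by omega, mul_pow, hI]
    push_cast
    ring
  rw [h1, h2, Complex.im_ofReal_mul, Complex.I_im, Complex.ofReal_im, Nat.add_sub_cancel_left,
    Nat.cast_choose ℝ (show 2 * j ≤ 2 * (j + d) + 1 by omega),
    show 2 * (j + d) + 1 - 2 * j = 2 * d + 1 by omega, alphaCoeff]
  have hf1 : ((2 * j).factorial : ℝ) ≠ 0 := by positivity
  have hf2 : ((2 * d + 1).factorial : ℝ) ≠ 0 := by positivity
  have hf3 : ((2 * (j + d) + 1).factorial : ℝ) ≠ 0 := by positivity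
  field_simp
  ring

theorem hasDerivAt_comp_add_mul_I {g : ℂ → ℂ} {g' : ℂ} {x v : ℝ}
    (h : HasDerivAt g g' (x + v * Complex.I)) :
    HasDerivAt (fun v : ℝ => g (x + v * Complex.I)) (g' * Complex.I) v := by
  have h1 : HasDerivAt (fun v : ℝ => (x : ℂ) + v * Complex.I) (1 * Complex.I) v :=
    (Complex.ofRealCLM.hasDerivAt.mul_const Complex.I).const_add _
  rw [one_mul] at h1
  exact h.comp v h1

theorem hasDerivAt_comp_ofReal_add {g : ℂ → ℂ} {g' c : ℂ} {x : ℝ} (h : HasDerivAt g g' (x + c)) :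
    HasDerivAt (fun x : ℝ => g (x + c)) g' x := by
  have h1 : HasDerivAt (fun x : ℝ => (x : ℂ) + c) 1 x :=
    Complex.ofRealCLM.hasDerivAt.add_const _
  have h2 := h.comp x h1
  rw [mul_one] at h2
  exact h2

theorem add_mul_I_mem_slitDomain {x : ℝ} (hx : 0 < x) (v : ℝ) :
    (x : ℂ) + v * Complex.I ∈ slitDomain := by
  left; simpa using hx.ne'

theorem add_mul_I_ne_zero {x : ℝ} (hx : 0 < x) (v : ℝ) : (x : ℂ) + v * Complex.I ≠ 0 := by
  intro h
  have := congrArg Complex.re h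
  simp at this
  exact hx.ne' this

theorem abs_sinh_le_norm_sinh (x v : ℝ) :
    |Real.sinh x| ≤ ‖Complex.sinh (x + v * Complex.I)‖ := by
  refine abs_le_of_sq_le_sq ?_ (norm_nonneg _)
  rw [normSq_sinh]
  simp [sq_nonneg]

theorem abs_sin_le_norm_sinh (x v : ℝ) :
    |Real.sin v| ≤ ‖Complex.sinh (x + v * Complex.I)‖ := by
  refine abs_le_of_sq_le_sq ?_ (norm_nonneg _)
  rw [normSq_sinh]
  simp [sq_nonneg]

theorem abs_sinh_le_norm_cosh (x v : ℝ) :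
    |Real.sinh x| ≤ ‖Complex.cosh (x + v * Complex.I)‖ := by
  refine abs_le_of_sq_le_sq ?_ (norm_nonneg _)
  rw [normSq_cosh]
  simp [sq_nonneg]

theorem exists_norm_le_of_compact {g : ℂ → ℂ} {S : Set ℂ} (hg : ContinuousOn g S) {K : Set (ℝ × ℝ)}
    (hK : IsCompact K) (h : ∀ p ∈ K, (p.1 : ℂ) + p.2 * Complex.I ∈ S) :
    ∃ C, 0 ≤ C ∧ ∀ p ∈ K, ‖g (p.1 + p.2 * Complex.I)‖ ≤ C := by
  have h1 : ContinuousOn (fun p : ℝ × ℝ => g (p.1 + p.2 * Complex.I)) K :=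
    hg.comp (by fun_prop) h
  obtain ⟨C, hC⟩ := hK.exists_bound_of_continuousOn h1
  exact ⟨max C 0, le_max_right _ _, fun p hp => (hC p hp).trans (le_max_left _ _)⟩

/-- Division by sinh costs at least one power of x, and integration outwards from Re z = 1 restores
it. -/
theorem exists_norm_sinhIterate_le_pow {n : ℕ} (hn : Even n) (k : ℕ) :
    ∃ C, 0 ≤ C ∧ ∀ x v : ℝ, 1 ≤ x → 0 ≤ v → v ≤ Real.pi →
      ‖sinhIterate n k (x + v * Complex.I)‖ ≤ C * x ^ (n + 1) := by
  induction k with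
  | zero =>
    -- The modulus of x + iv is at most x + 4, hence at most 5x.
    refine ⟨5 ^ (n + 1), by positivity, fun x v hx h0 h1 => ?_⟩
    simp only [sinhIterate]
    rw [norm_div, norm_pow, Complex.norm_natCast, ← mul_pow]
    refine (div_le_self (by positivity) (Nat.one_le_cast.2 (Nat.factorial_pos _))).trans ?_
    refine pow_le_pow_left₀ (norm_nonneg _) ?_ _
    refine (norm_add_le _ _).trans ?_
    rw [norm_mul, Complex.norm_I, Complex.norm_real, Complex.norm_real,
      Real.norm_of_nonneg (by linarith), Real.norm_of_nonneg h0]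
    linarith [Real.pi_le_four]
  | succ k ih =>
    obtain ⟨C, hC0, hC⟩ := ih
    obtain ⟨C', hC'0, hC'⟩ := exists_norm_le_of_compact
      (sinhIterate_properties hn (k + 1)).1.continuousOn
      (K := {1} ×ˢ Set.Icc 0 Real.pi) (isCompact_singleton.prod isCompact_Icc)
      (by rintro ⟨a, b⟩ ⟨rfl, _⟩; exact add_mul_I_mem_slitDomain one_pos b)
    refine ⟨C + C', by positivity, fun x v hx h0 h1 => ?_⟩
    have hd : ∀ y : ℝ, 0 < y → HasDerivAt
        (fun y : ℝ => sinhIterate n (k + 1) (y + v * Complex.I))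
        (sinhIterate n k (y + v * Complex.I) / Complex.sinh (y + v * Complex.I)) y := by
      intro y hy
      rw [← sinhIterateDeriv_succ n k (add_mul_I_ne_zero hy v)]
      exact hasDerivAt_comp_ofReal_add (hasDerivAt_sinhIterate hn _ (add_mul_I_mem_slitDomain hy v))
    have hB : ∀ y : ℝ, HasDerivAt (fun y : ℝ => (C + C') * y ^ (n + 1))
        ((C + C') * ((n + 1 : ℕ) * y ^ n)) y := fun y => (hasDerivAt_pow (n + 1) y).const_mul _
    refine image_norm_le_of_norm_deriv_right_le_deriv_boundary (a := 1) (b := x)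
      (f := fun y : ℝ => sinhIterate n (k + 1) (y + v * Complex.I))
      (fun y hy => (hd y (by linarith [hy.1])).continuousAt.continuousWithinAt)
      (fun y hy => (hd y (by linarith [hy.1])).hasDerivWithinAt) ?_ hB ?_ ⟨hx, le_rfl⟩
    · have := hC' (1, v) ⟨rfl, h0, h1⟩
      simp only [one_pow, mul_one]
      linarith
    · intro y hy
      have hy0 : 0 < y := by linarith [hy.1]
      have h2 : y ≤ ‖Complex.sinh (y + v * Complex.I)‖ :=
        (Real.self_le_sinh_iff.2 hy0.le).trans ((le_abs_self _).trans (abs_sinh_le_norm_sinh y v))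
      rw [norm_div, div_le_iff₀ (hy0.trans_le h2)]
      calc _ ≤ C * y ^ (n + 1) := hC y v hy.1 h0 h1
        _ = C * (1 * y ^ n) * y := by ring
        _ ≤ (C + C') * ((n + 1 : ℕ) * y ^ n) * ‖Complex.sinh (y + v * Complex.I)‖ := by
          gcongr
          · linarith
          · push_cast; linarith [n.cast_nonneg (α := ℝ)]

/-- An integrable majorant near πi, uniform in x and stable under the iteration: dividing by |sinh|
≥ (π - v)/2 gives the exponent -3/2, and integrating upwards from v = π/2 returns to -1/2. -/
theorem exists_norm_sinhIterate_le_rpow {n : ℕ} (hn : Even n) (k : ℕ) :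
    ∃ C, 0 ≤ C ∧ ∀ x v : ℝ, 0 < x → x ≤ 1 → Real.pi / 2 ≤ v → v < Real.pi →
      ‖sinhIterate n k (x + v * Complex.I)‖ ≤ C * (Real.pi - v) ^ (-1 / 2 : ℝ) := by
  have hpi := Real.pi_pos
  induction k with
  | zero =>
    obtain ⟨C, hC0, hC⟩ := (isCompact_Icc (a := (0 : ℝ)) (b := 1)).prod
      (isCompact_Icc (a := (0 : ℝ)) (b := Real.pi)) |>.exists_bound_of_continuousOn
      (f := fun p : ℝ × ℝ => sinhIterate n 0 (p.1 + p.2 * Complex.I))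
      (by simp only [sinhIterate]; fun_prop) |>.imp fun C hC => And.intro (le_max_right C 0) hC
    refine ⟨max C 0 * 2, by positivity, fun x v h0 h1 h2 h3 => ?_⟩
    refine ((hC (x, v) ⟨⟨h0.le, h1⟩, by linarith, h3.le⟩).trans (le_max_left C 0)).trans ?_
    rw [mul_assoc]
    refine le_mul_of_one_le_right hC0 ?_
    have h4 : (4 : ℝ) ^ (-1 / 2 : ℝ) ≤ (Real.pi - v) ^ (-1 / 2 : ℝ) :=
      Real.rpow_le_rpow_of_nonpos (by linarith) (by linarith [Real.pi_le_four]) (by norm_num)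
    have h5 : (4 : ℝ) ^ (-1 / 2 : ℝ) = 1 / 2 := by
      rw [show (4 : ℝ) = 2 ^ (2 : ℝ) by norm_num, ← Real.rpow_mul (by norm_num)]
      norm_num [Real.rpow_neg_one]
    linarith
  | succ k ih =>
    obtain ⟨C, hC0, hC⟩ := ih
    obtain ⟨C', hC'0, hC'⟩ := exists_norm_le_of_compact
      (sinhIterate_properties hn (k + 1)).1.continuousOn
      (K := Set.Icc 0 1 ×ˢ {Real.pi / 2}) (isCompact_Icc.prod isCompact_singleton)
      (by
        rintro ⟨a, b⟩ ⟨_, rfl⟩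
        right
        simp only [Complex.add_im, Complex.ofReal_im, Complex.im_ofReal_mul, Complex.I_im, mul_one,
          zero_add, abs_of_pos (half_pos hpi)]
        linarith)
    -- The part 4C dominates the derivative; 2C' dominates the initial value, since (π/2)^(-1/2) ≥
    -- 1/2.
    set D := 4 * C + 2 * C' with hD
    refine ⟨D, by positivity, fun x v h0 h1 h2 h3 => ?_⟩
    have hd : ∀ y : ℝ, HasDerivAt (fun y : ℝ => sinhIterate n (k + 1) (x + y * Complex.I))
        (sinhIterate n k (x + y * Complex.I) / Complex.sinh (x + y * Complex.I) * Complex.I) y := by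
      intro y
      rw [← sinhIterateDeriv_succ n k (add_mul_I_ne_zero h0 y)]
      exact hasDerivAt_comp_add_mul_I (hasDerivAt_sinhIterate hn _ (add_mul_I_mem_slitDomain h0 y))
    have hB : ∀ y : ℝ, y < Real.pi → HasDerivAt (fun y : ℝ => D * (Real.pi - y) ^ (-1 / 2 : ℝ))
        (D * (1 / 2 * (Real.pi - y) ^ (-3 / 2 : ℝ))) y := by
      intro y hy
      refine ((((hasDerivAt_id y).const_sub Real.pi).rpow_const (p := -1 / 2)
        (Or.inl (by simp only [id]; linarith))).const_mul D).congr_deriv ?_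
      simp only [id]
      norm_num
    refine image_norm_le_of_norm_deriv_right_le_deriv_boundary' (a := Real.pi / 2) (b := v)
      (f := fun y : ℝ => sinhIterate n (k + 1) (x + y * Complex.I))
      (fun y hy => (hd y).continuousAt.continuousWithinAt)
      (fun y hy => (hd y).hasDerivWithinAt) ?_
      (fun y hy => (hB y (hy.2.trans_lt h3)).continuousAt.continuousWithinAt)
      (fun y hy => (hB y (hy.2.trans h3)).hasDerivWithinAt) ?_ ⟨h2, le_rfl⟩
    · have h4 : (4 : ℝ) ^ (-1 / 2 : ℝ) ≤ (Real.pi - Real.pi / 2) ^ (-1 / 2 : ℝ) :=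
        Real.rpow_le_rpow_of_nonpos (by linarith) (by linarith [Real.pi_le_four]) (by norm_num)
      have h5 : (4 : ℝ) ^ (-1 / 2 : ℝ) = 1 / 2 := by
        rw [show (4 : ℝ) = 2 ^ (2 : ℝ) by norm_num, ← Real.rpow_mul (by norm_num)]
        norm_num [Real.rpow_neg_one]
      have h6 := hC' (x, Real.pi / 2) ⟨⟨h0.le, h1⟩, rfl⟩
      have h7 : D * (1 / 2) ≤ D * (Real.pi - Real.pi / 2) ^ (-1 / 2 : ℝ) :=
        mul_le_mul_of_nonneg_left (by linarith) (by positivity)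
      refine h6.trans (le_trans ?_ h7)
      rw [hD]; linarith
    · intro y hy
      have hy1 : 0 < Real.pi - y := by linarith [hy.2]
      have h4 : (Real.pi - y) / 2 ≤ ‖Complex.sinh (x + y * Complex.I)‖ := by
        refine le_trans ?_ ((le_abs_self _).trans (abs_sin_le_norm_sinh x y))
        rw [← Real.sin_pi_sub]
        refine le_trans ?_ (Real.mul_le_sin hy1.le (by linarith [hy.1]))
        rw [div_mul_eq_mul_div, div_le_div_iff₀ two_pos hpi]
        nlinarith [Real.pi_le_four]
      rw [norm_mul, Complex.norm_I, mul_one, norm_div, div_le_iff₀ ((half_pos hy1).trans_le h4)]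
      have h5 : (Real.pi - y) ^ (-1 / 2 : ℝ) = (Real.pi - y) ^ (-3 / 2 : ℝ) * (Real.pi - y) := by
        rw [← Real.rpow_add_one hy1.ne']; norm_num
      calc _ ≤ C * (Real.pi - y) ^ (-1 / 2 : ℝ) := hC x y h0 h1 hy.1 (hy.2.trans h3)
        _ = 4 * C * (1 / 2 * (Real.pi - y) ^ (-3 / 2 : ℝ)) * ((Real.pi - y) / 2) := by
          rw [h5]; ring
        _ ≤ _ := by
          gcongr
          rw [hD]; linarith

theorem sinh_add_pi_mul_I' (x : ℝ) :
    Complex.sinh (x + Real.pi * Complex.I) = ((-Real.sinh x : ℝ) : ℂ) := by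
  rw [Complex.sinh_add_pi_mul_I]; push_cast; rfl

/-- The iterate is real at s, and along the vertical segment from s to s + πi its derivative is
O(s^(n+1) exp(-s)). -/
theorem tendsto_sinhIterate_im {n : ℕ} (hn : Even n) (k : ℕ) :
    Tendsto (fun s : ℝ => (sinhIterate n (k + 1) (s + Real.pi * Complex.I)).im) atTop (𝓝 0) := by
  obtain ⟨C, hC0, hC⟩ := exists_norm_sinhIterate_le_pow hn k
  have hlim : Tendsto (fun s : ℝ => C * 4 * (s ^ (n + 1) * Real.exp (-s)) * Real.pi) atTop (𝓝 0) := by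
    simpa using ((Real.tendsto_pow_mul_exp_neg_atTop_nhds_zero (n + 1)).const_mul (C * 4)).mul_const
      Real.pi
  refine squeeze_zero_norm' ?_ hlim
  filter_upwards [eventually_ge_atTop 1] with s hs
  have hs0 : 0 < s := by linarith
  have hsinh : Real.exp s / 4 ≤ Real.sinh s := by
    rw [Real.sinh_eq]
    have h1 := Real.add_one_le_exp s
    have h2 : Real.exp (-s) ≤ 1 := Real.exp_le_one_iff.2 (by linarith)
    linarith
  have hd : ∀ y : ℝ, HasDerivAt (fun y : ℝ => sinhIterate n (k + 1) (s + y * Complex.I))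
      (sinhIterate n k (s + y * Complex.I) / Complex.sinh (s + y * Complex.I) * Complex.I) y := by
    intro y
    rw [← sinhIterateDeriv_succ n k (add_mul_I_ne_zero hs0 y)]
    exact hasDerivAt_comp_add_mul_I (hasDerivAt_sinhIterate hn _ (add_mul_I_mem_slitDomain hs0 y))
  have hb := norm_image_sub_le_of_norm_deriv_le_segment' (a := 0) (b := Real.pi)
    (f := fun y : ℝ => sinhIterate n (k + 1) (s + y * Complex.I))
    (C := C * 4 * (s ^ (n + 1) * Real.exp (-s)))
    (fun y _ => (hd y).hasDerivWithinAt) (fun y hy => by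
      have h1 : Real.exp s / 4 ≤ ‖Complex.sinh (s + y * Complex.I)‖ :=
        hsinh.trans ((le_abs_self _).trans (abs_sinh_le_norm_sinh s y))
      have h2 := Real.exp_pos s
      rw [norm_mul, Complex.norm_I, mul_one, norm_div, div_le_iff₀ (by linarith)]
      calc _ ≤ C * s ^ (n + 1) := hC s y hs hy.1 hy.2.le
        _ = C * 4 * (s ^ (n + 1) * Real.exp (-s)) * (Real.exp s / 4) := by
          rw [Real.exp_neg]; field_simp
        _ ≤ _ := by gcongr) Real.pi ⟨Real.pi_pos.le, le_rfl⟩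
  simp only [sub_zero, Complex.ofReal_zero, zero_mul, add_zero] at hb
  have h3 : (sinhIterate n (k + 1) (s + Real.pi * Complex.I)).im =
      (sinhIterate n (k + 1) (s + Real.pi * Complex.I) - sinhIterate n (k + 1) s).im := by
    rw [Complex.sub_im, sinhIterate_ofReal_im hn, sub_zero]
  rw [h3]
  exact (Complex.abs_im_le_norm _).trans hb

theorem eq_of_hasDerivAt_of_tendsto {f g f' : ℝ → ℝ} (hf : ∀ s, 0 < s → HasDerivAt f (f' s) s)
    (hg : ∀ s, 0 < s → HasDerivAt g (f' s) s) (hf0 : Tendsto f atTop (𝓝 0))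
    (hg0 : Tendsto g atTop (𝓝 0)) {s : ℝ} (hs : 0 < s) : f s = g s := by
  have hd : ∀ x ∈ Set.Ioi (0 : ℝ), HasDerivAt (fun x => f x - g x) 0 x := fun x hx =>
    ((hf x hx).sub (hg x hx)).congr_deriv (sub_self _)
  have hconst : ∀ x ∈ Set.Ioi (0 : ℝ), f x - g x = f s - g s := by
    intro x hx
    exact isOpen_Ioi.is_const_of_deriv_eq_zero isPreconnected_Ioi
      (fun y hy => (hd y hy).differentiableAt.differentiableWithinAt)
      (fun y hy => (hd y hy).deriv) hx hs
  have h1 : Tendsto (fun x => f x - g x) atTop (𝓝 (f s - g s)) := by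
    refine tendsto_const_nhds.congr' ?_
    filter_upwards [eventually_gt_atTop 0] with x hx using (hconst x hx).symm
  have h2 := tendsto_nhds_unique h1 (hf0.sub hg0)
  linarith

/-- Both sides solve the same first-order equation, since sinh(s + πi) = -sinh s, and for k ≥ 1 both
vanish at infinity; k = 0 is the expansion that defines the α's. The range k ≤ l keeps all kernels
equal to 1/sinh. -/
theorem sinhIterate_add_pi_mul_I_im (l b : ℕ) : ∀ k ≤ l, ∀ s : ℝ, 0 < s →
    (sinhIterate (2 * b) k (s + Real.pi * Complex.I)).im =
      Real.pi * ∑ j ∈ Finset.range (b + 1), alphaCoeff (b - j) *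
        weightIntegral (stepSign l) k (2 * j) s := by
  have hn : Even (2 * b) := even_two_mul b
  intro k
  induction k with
  | zero =>
    intro _ s _
    simp only [weightIntegral_zero]
    exact im_add_pi_mul_I_pow b s
  | succ k ih =>
    intro hk s hs
    refine eq_of_hasDerivAt_of_tendsto
      (f := fun s : ℝ => (sinhIterate (2 * b) (k + 1) (s + Real.pi * Complex.I)).im)
      (g := fun s => Real.pi * ∑ j ∈ Finset.range (b + 1), alphaCoeff (b - j) *
        weightIntegral (stepSign l) (k + 1) (2 * j) s)
      (f' := fun s => -((sinhIterate (2 * b) k (s + Real.pi * Complex.I)).im / Real.sinh s))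
      (fun x hx => ?_) (fun x hx => ?_) (tendsto_sinhIterate_im hn k) ?_ hs
    · have h1 := hasDerivAt_comp_ofReal_add (hasDerivAt_sinhIterate hn (k + 1)
        (add_mul_I_mem_slitDomain hx Real.pi))
      rw [sinhIterateDeriv_succ _ _ (add_mul_I_ne_zero hx _), sinh_add_pi_mul_I'] at h1
      refine (Complex.imCLM.hasFDerivAt.comp_hasDerivAt x h1).congr_deriv ?_
      simp only [Complex.imCLM_apply, Complex.div_ofReal_im]
      rw [div_neg]
    · have h1 : ∀ j ∈ Finset.range (b + 1), HasDerivAt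
          (fun s => alphaCoeff (b - j) * weightIntegral (stepSign l) (k + 1) (2 * j) s)
          (alphaCoeff (b - j) * -(stepKernel (stepSign l k) x *
            weightIntegral (stepSign l) k (2 * j) x)) x := fun j _ =>
        (hasDerivAt_weightIntegral_succ (abs_stepSign l) k (2 * j) hx).const_mul _
      refine ((HasDerivAt.fun_sum h1).const_mul Real.pi).congr_deriv ?_
      rw [ih (by omega) x hx, show stepSign l k = 1 by simp [stepSign, show k < l by omega],
        stepKernel_one hx, mul_div_assoc, ← mul_neg]
      congr 1
      rw [div_eq_mul_inv, Finset.sum_mul, ← Finset.sum_neg_distrib]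
      refine Finset.sum_congr rfl fun j _ => ?_
      ring
    · have h1 : ∀ j ∈ Finset.range (b + 1), Tendsto
          (fun s => alphaCoeff (b - j) * weightIntegral (stepSign l) (k + 1) (2 * j) s) atTop
          (𝓝 (alphaCoeff (b - j) * 0)) := fun j _ => Tendsto.const_mul _ (by
        simpa using tendsto_pow_mul_weightIntegral_atTop (abs_stepSign l) k (2 * j) 0)
      simpa using (tendsto_finsetSum _ h1).const_mul Real.pi

/-! ### The contour integral and its edges -/

/-- The powers `(π - gd z) ^ (N + 1) / (N + 1)!`. -/
noncomputable def coGudermannPow (N : ℕ) (z : ℂ) : ℂ :=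
  coGudermann z ^ (N + 1) / ((N + 1).factorial : ℂ)

/-- The derivative of `coGudermannPow N`. -/
noncomputable def coGudermannPowDeriv (N : ℕ) (z : ℂ) : ℂ :=
  coGudermann z ^ N / (N.factorial : ℂ) * -(Complex.cosh z)⁻¹

theorem hasDerivAt_coGudermannPow (N : ℕ) {z : ℂ} (hz : z ∈ puncturedStrip) :
    HasDerivAt (coGudermannPow N) (coGudermannPowDeriv N z) z := by
  refine (((hasDerivAt_coGudermann hz).pow (N + 1)).div_const _).congr_deriv ?_
  rw [coGudermannPowDeriv, Nat.factorial_succ]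
  push_cast
  have : (N : ℂ) + 1 ≠ 0 := by exact_mod_cast N.succ_ne_zero
  have : (N.factorial : ℂ) ≠ 0 := by exact_mod_cast N.factorial_ne_zero
  field_simp

theorem cosh_ne_zero_of_mem_puncturedStrip {z : ℂ} (hz : z ∈ puncturedStrip) :
    Complex.cosh z ≠ 0 := by
  intro h
  have h1 := normSq_cosh z
  rw [h, norm_zero] at h1
  have h2 : Real.sinh z.re = 0 := by
    nlinarith [sq_nonneg (Real.sinh z.re), sq_nonneg (Real.cos z.im)]
  have h3 : Real.cos z.im = 0 := by
    nlinarith [sq_nonneg (Real.sinh z.re), sq_nonneg (Real.cos z.im)]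
  obtain ⟨-, h4, h5, h6⟩ := hz
  rcases h6 with h6 | h6
  · exact h6 (Real.sinh_eq_zero.1 h2)
  · refine h6 ?_
    have hpi := Real.pi_pos
    rcases lt_trichotomy z.im (Real.pi / 2) with h7 | h7 | h7
    · exact absurd h3 (Real.cos_pos_of_mem_Ioo ⟨by linarith, h7⟩).ne'
    · exact h7
    · exact absurd h3 (Real.cos_neg_of_pi_div_two_lt_of_lt h7 (by linarith)).ne

theorem differentiableAt_coGudermannPowDeriv (N : ℕ) {z : ℂ} (hz : z ∈ puncturedStrip) :
    DifferentiableAt ℂ (coGudermannPowDeriv N) z :=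
  (((hasDerivAt_coGudermann hz).differentiableAt.pow N).div_const _).mul
    (Complex.differentiableAt_cosh.inv (cosh_ne_zero_of_mem_puncturedStrip hz)).neg

theorem add_mul_I_mem_puncturedStrip {x v : ℝ} (hx : 0 ≤ x) (h0 : 0 ≤ v) (h1 : v ≤ Real.pi)
    (h : x ≠ 0 ∨ v ≠ Real.pi / 2) : (x : ℂ) + v * Complex.I ∈ puncturedStrip := by
  simp only [puncturedStrip, Set.mem_ofPred_eq, Complex.add_re, Complex.ofReal_re,
    Complex.re_ofReal_mul, Complex.I_re, mul_zero, add_zero, Complex.add_im, Complex.ofReal_im,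
    Complex.im_ofReal_mul, Complex.I_im, mul_one, zero_add]
  exact ⟨hx, h0, h1, h⟩

theorem ofReal_pow_div_im (x : ℝ) (N M : ℕ) : ((x : ℂ) ^ N / (M : ℂ)).im = 0 := by
  rw [show (x : ℂ) ^ N / (M : ℂ) = ((x ^ N / M : ℝ) : ℂ) by push_cast; rfl, Complex.ofReal_im]

theorem coGudermannPow_ofReal_im (N : ℕ) (x : ℝ) : (coGudermannPow N x).im = 0 := by
  rw [coGudermannPow, coGudermann_ofReal]
  exact ofReal_pow_div_im _ _ _

theorem coGudermannPowDeriv_ofReal_im (N : ℕ) (x : ℝ) : (coGudermannPowDeriv N x).im = 0 := by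
  have h : coGudermannPowDeriv N x = (((Real.pi / 2 + 2 * Real.arctan (Real.exp (-x))) ^ N /
      (N.factorial : ℝ) * -(Real.cosh x)⁻¹ : ℝ) : ℂ) := by
    rw [coGudermannPowDeriv, coGudermann_ofReal]
    push_cast; rfl
  rw [h, Complex.ofReal_im]

theorem coGudermannPowDeriv_add_pi_mul_I (N : ℕ) (s : ℝ) :
    coGudermannPowDeriv N (s + Real.pi * Complex.I) =
      ((gudermann s ^ N / (N.factorial : ℝ) / Real.cosh s : ℝ) : ℂ) := by
  rw [coGudermannPowDeriv, coGudermann_add_pi_mul_I, Complex.cosh_add_pi_mul_I, inv_neg, neg_neg]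
  push_cast
  rw [div_eq_mul_inv _ (Complex.cosh s)]

/-- The integrand of the contour integral. -/
noncomputable def contourIntegrand (n N l : ℕ) (z : ℂ) : ℂ :=
  sinhIterate n l z * coGudermannPowDeriv N z

theorem differentiableAt_contourIntegrand {n : ℕ} (hn : Even n) (N l : ℕ) {x v : ℝ} (hx : 0 < x)
    (h0 : 0 ≤ v) (h1 : v ≤ Real.pi) :
    DifferentiableAt ℂ (contourIntegrand n N l) (x + v * Complex.I) :=
  ((sinhIterate_properties hn l).1.differentiableAt
    (isOpen_slitDomain.mem_nhds (add_mul_I_mem_slitDomain hx v))).mul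
    (differentiableAt_coGudermannPowDeriv N (add_mul_I_mem_puncturedStrip hx.le h0 h1 (Or.inl hx.ne')))

theorem contourIntegrand_ofReal_im {n : ℕ} (hn : Even n) (N l : ℕ) (x : ℝ) :
    (contourIntegrand n N l x).im = 0 := by
  rw [contourIntegrand, Complex.mul_im, sinhIterate_ofReal_im hn, coGudermannPowDeriv_ofReal_im]
  ring

theorem contourIntegrand_add_pi_mul_I_im (n N l : ℕ) (s : ℝ) :
    (contourIntegrand n N l (s + Real.pi * Complex.I)).im =
      (sinhIterate n l (s + Real.pi * Complex.I)).im *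
        (gudermann s ^ N / (N.factorial : ℝ) / Real.cosh s) := by
  rw [contourIntegrand, coGudermannPowDeriv_add_pi_mul_I, Complex.im_mul_ofReal]

theorem continuousOn_contourIntegrand_vertical {n : ℕ} (hn : Even n) (N l : ℕ) {x : ℝ}
    (hx : 0 < x) :
    ContinuousOn (fun v : ℝ => contourIntegrand n N l (x + v * Complex.I)) (Set.Icc 0 Real.pi) := by
  intro v hv
  refine ContinuousAt.continuousWithinAt ?_
  exact (differentiableAt_contourIntegrand hn N l hx hv.1 hv.2).continuousAt.comp
    (f := fun v : ℝ => (x : ℂ) + v * Complex.I) (by fun_prop)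

/-- The imaginary part of Cauchy's theorem: the bottom edge is real, and the factor i on the
vertical edges turns their imaginary parts into real parts. -/
theorem contour_rectangle {n : ℕ} (hn : Even n) (N l : ℕ) {ε R : ℝ} (hε : 0 < ε) (hR : ε ≤ R) :
    ∫ x in ε..R, (contourIntegrand n N l (x + Real.pi * Complex.I)).im =
      (∫ v in (0 : ℝ)..Real.pi, contourIntegrand n N l (R + v * Complex.I)).re -
        (∫ v in (0 : ℝ)..Real.pi, contourIntegrand n N l (ε + v * Complex.I)).re := by
  have hpi := Real.pi_pos.le
  have hrect := Complex.integral_boundary_rect_eq_zero_of_differentiableOn (contourIntegrand n N l)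
    (ε : ℂ) (R + Real.pi * Complex.I) (by
      intro z hz
      rw [Complex.mem_reProdIm] at hz
      simp only [Complex.ofReal_re, Complex.add_re, Complex.re_ofReal_mul, Complex.I_re, mul_zero,
        add_zero, Complex.ofReal_im, Complex.add_im, Complex.im_ofReal_mul, Complex.I_im, mul_one,
        zero_add, Set.uIcc_of_le hR, Set.uIcc_of_le hpi, Set.mem_Icc] at hz
      have := differentiableAt_contourIntegrand hn N l (hε.trans_le hz.1.1) hz.2.1 hz.2.2
      rw [Complex.re_add_im] at this
      exact this.differentiableWithinAt)
  simp only [Complex.ofReal_re, Complex.add_re, Complex.re_ofReal_mul, Complex.I_re, mul_zero,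
    add_zero, Complex.ofReal_im, Complex.add_im, Complex.im_ofReal_mul, Complex.I_im, mul_one,
    zero_add, Complex.ofReal_zero, zero_mul] at hrect
  have him : ∀ f : ℝ → ℂ, ContinuousOn f (Set.uIcc ε R) →
      (∫ x in ε..R, f x).im = ∫ x in ε..R, (f x).im := fun f hf =>
    (Complex.imCLM.intervalIntegral_comp_comm hf.intervalIntegrable).symm
  have hcont : ∀ v : ℝ, 0 ≤ v → v ≤ Real.pi →
      ContinuousOn (fun x : ℝ => contourIntegrand n N l (x + v * Complex.I)) (Set.uIcc ε R) := by
    intro v h0 h1 x hx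
    rw [Set.uIcc_of_le hR] at hx
    exact ((differentiableAt_contourIntegrand hn N l (hε.trans_le hx.1) h0 h1).continuousAt.comp
      (f := fun x : ℝ => (x : ℂ) + v * Complex.I) (by fun_prop)).continuousWithinAt
  have h1 := congrArg Complex.im hrect
  simp only [Complex.sub_im, Complex.add_im, smul_eq_mul, Complex.I_mul_im, Complex.zero_im] at h1
  rw [him _ (hcont Real.pi hpi le_rfl), him _ (by simpa using hcont 0 le_rfl hpi)] at h1
  simp only [contourIntegrand_ofReal_im hn, intervalIntegral.integral_zero] at h1
  linarith

theorem tendsto_contour_right {n : ℕ} (hn : Even n) (N l : ℕ) :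
    Tendsto (fun R : ℝ => (∫ v in (0 : ℝ)..Real.pi,
      contourIntegrand n N l (R + v * Complex.I)).re) atTop (𝓝 0) := by
  obtain ⟨C, hC0, hC⟩ := exists_norm_sinhIterate_le_pow hn l
  have hlim : Tendsto (fun s : ℝ => C * 4 * 13 ^ N * (s ^ (n + 1) * Real.exp (-s)) *
      |Real.pi - 0|) atTop (𝓝 0) := by
    simpa using ((Real.tendsto_pow_mul_exp_neg_atTop_nhds_zero (n + 1)).const_mul
      (C * 4 * 13 ^ N)).mul_const |Real.pi - 0|
  refine squeeze_zero_norm' ?_ hlim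
  filter_upwards [eventually_ge_atTop 1] with s hs
  refine (Complex.abs_re_le_norm _).trans ?_
  refine intervalIntegral.norm_integral_le_of_norm_le_const fun v hv => ?_
  rw [Set.uIoc_of_le Real.pi_pos.le] at hv
  have hsinh : Real.exp s / 4 ≤ Real.sinh s := by
    rw [Real.sinh_eq]
    have h1 := Real.add_one_le_exp s
    have h2 : Real.exp (-s) ≤ 1 := Real.exp_le_one_iff.2 (by linarith)
    linarith
  have h1 : Real.exp s / 4 ≤ ‖Complex.cosh (s + v * Complex.I)‖ :=
    hsinh.trans ((le_abs_self _).trans (abs_sinh_le_norm_cosh s v))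
  have h2 : ‖coGudermann (s + v * Complex.I)‖ ≤ 13 :=
    norm_coGudermann_le_const (by simpa using hs) (by simpa using hv.1.le) (by simpa using hv.2)
  have h3 := hC s v hs hv.1.le hv.2
  have h4 : ‖Complex.cosh (s + v * Complex.I)‖⁻¹ ≤ 4 * Real.exp (-s) := by
    rw [Real.exp_neg, show 4 * (Real.exp s)⁻¹ = (Real.exp s / 4)⁻¹ by rw [inv_div]; rfl]
    exact inv_anti₀ (by positivity) h1
  have h5 : ‖coGudermann (s + v * Complex.I) ^ N / (N.factorial : ℂ)‖ ≤ 13 ^ N := by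
    rw [norm_div, norm_pow, Complex.norm_natCast]
    exact (div_le_self (by positivity) (Nat.one_le_cast.2 (Nat.factorial_pos _))).trans
      (pow_le_pow_left₀ (norm_nonneg _) h2 N)
  rw [contourIntegrand, coGudermannPowDeriv, norm_mul, norm_mul, norm_neg, norm_inv]
  calc _ ≤ C * s ^ (n + 1) * (13 ^ N * (4 * Real.exp (-s))) := by gcongr
    _ = _ := by ring

theorem intervalIntegrable_sub_rpow (c a b : ℝ) :
    IntervalIntegrable (fun v : ℝ => (c - v) ^ (-1 / 2 : ℝ)) volume a b ∧
      IntervalIntegrable (fun v : ℝ => (v - c) ^ (-1 / 2 : ℝ)) volume a b := by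
  have h : ∀ a b : ℝ, IntervalIntegrable (fun v : ℝ => v ^ (-1 / 2 : ℝ)) volume a b := fun a b =>
    intervalIntegral.intervalIntegrable_rpow' (by norm_num)
  constructor
  · simpa using (h (c - a) (c - b)).comp_sub_left c
  · simpa using (h (a - c) (b - c)).comp_sub_right c

/-- The real power of a negative base to the exponent -1/2 is 0, because it carries the factor
cos(π/2); each summand therefore acts on its own side. -/
theorem abs_rpow_le (d : ℝ) : |d| ^ (-1 / 2 : ℝ) ≤ d ^ (-1 / 2 : ℝ) + (-d) ^ (-1 / 2 : ℝ) := by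
  have hneg : ∀ d : ℝ, d < 0 → d ^ (-1 / 2 : ℝ) = 0 := by
    intro d hd
    rw [Real.rpow_def_of_neg hd, show (-1 / 2 * Real.pi : ℝ) = -(Real.pi / 2) by ring, Real.cos_neg,
      Real.cos_pi_div_two, mul_zero]
  rcases lt_trichotomy d 0 with hd | rfl | hd
  · rw [abs_of_neg hd, hneg d hd, zero_add]
  · norm_num
  · rw [abs_of_pos hd, hneg (-d) (by linarith), add_zero]

theorem exists_norm_coGudermannPow_le (N : ℕ) :
    ∃ K, 0 ≤ K ∧ ∀ x v : ℝ, 0 ≤ x → 0 ≤ v → v ≤ Real.pi → v ≠ Real.pi / 2 →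
      ‖coGudermannPow N (x + v * Complex.I)‖ ≤
        K * ((Real.pi / 2 - v) ^ (-1 / 2 : ℝ) + (v - Real.pi / 2) ^ (-1 / 2 : ℝ)) := by
  have hpi := Real.pi_pos
  -- Chosen so that (N + 1)δ = 1/2: bounding the logarithm by y^(-δ)/δ makes its power of order N +
  -- 1 at most a multiple of y^(-1/2), which is integrable.
  set δ : ℝ := 1 / (2 * (N + 1)) with hδ
  have hδ0 : 0 < δ := by positivity
  refine ⟨(12 + 1 / δ) ^ (N + 1) * 2, by positivity, fun x v hx h0 h1 h2 => ?_⟩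
  set d := Real.pi / 2 - v with hd
  have hd0 : 0 < |d| := abs_pos.2 (sub_ne_zero.2 (Ne.symm h2))
  have hcos : |d| / 2 ≤ |Real.cos v| := by
    have hd1 : |d| ≤ Real.pi / 2 := by rw [abs_le]; constructor <;> linarith
    have h3 := Real.mul_le_sin hd0.le hd1
    have h4 : Real.sin |d| = |Real.cos v| := by
      rw [← Real.sin_pi_div_two_sub, ← hd]
      rcases abs_cases d with h | h
      · rw [h.1, abs_of_nonneg (Real.sin_nonneg_of_nonneg_of_le_pi h.2 (by linarith))]
      · rw [h.1, Real.sin_neg, abs_of_nonpos]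
        exact Real.sin_nonpos_of_nonpos_of_neg_pi_le h.2.le (by linarith)
    rw [← h4]
    refine le_trans ?_ h3
    rw [div_mul_eq_mul_div, div_le_div_iff₀ two_pos hpi]
    nlinarith [Real.pi_le_four]
  set y := |Real.cos v| with hy
  have hy0 : 0 < y := (half_pos hd0).trans_le hcos
  have hy1 : y ≤ 1 := Real.abs_cos_le_one v
  have hlog : |Real.log y| ≤ 1 / δ * y ^ (-δ) := by
    have h3 := (Real.abs_log_mul_self_rpow_lt y δ hy0 hy1 hδ0).le
    rw [abs_mul, abs_of_pos (Real.rpow_pos_of_pos hy0 δ)] at h3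
    rwa [Real.rpow_neg hy0.le, ← div_eq_mul_inv, le_div_iff₀ (Real.rpow_pos_of_pos hy0 δ)]
  have hone : 1 ≤ y ^ (-δ) := Real.one_le_rpow_of_pos_of_le_one_of_nonpos hy0 hy1 (by linarith)
  have hV : ‖coGudermann (x + v * Complex.I)‖ ≤ (12 + 1 / δ) * y ^ (-δ) := by
    have him : ((x : ℂ) + v * Complex.I).im = v := by simp
    have hre : ((x : ℂ) + v * Complex.I).re = x := by simp
    have h3 := norm_coGudermann_le_log_cos (z := x + v * Complex.I) (by rwa [hre])
      (by rwa [him]) (by rwa [him]) (by rw [him]; exact abs_pos.1 hy0)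
    rw [him] at h3
    refine h3.trans ?_
    rw [add_mul]
    exact add_le_add (le_mul_of_one_le_right (by norm_num) hone) hlog
  have hpow : (y ^ (-δ)) ^ (N + 1) = y ^ (-1 / 2 : ℝ) := by
    rw [← Real.rpow_natCast, ← Real.rpow_mul hy0.le]
    congr 1
    rw [hδ]
    push_cast
    field_simp
  have hyd : y ^ (-1 / 2 : ℝ) ≤ 2 * |d| ^ (-1 / 2 : ℝ) := by
    refine (Real.rpow_le_rpow_of_nonpos (half_pos hd0) hcos (by norm_num)).trans ?_
    rw [Real.div_rpow hd0.le zero_le_two, div_eq_mul_inv, ← Real.rpow_neg zero_le_two, mul_comm]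
    refine mul_le_mul_of_nonneg_right ?_ (by positivity)
    calc (2 : ℝ) ^ (-(-1 / 2) : ℝ) ≤ 2 ^ (1 : ℝ) :=
          Real.rpow_le_rpow_of_exponent_le one_le_two (by norm_num)
      _ = 2 := Real.rpow_one 2
  rw [coGudermannPow, norm_div, norm_pow, Complex.norm_natCast]
  refine (div_le_self (by positivity) (Nat.one_le_cast.2 (Nat.factorial_pos _))).trans ?_
  calc _ ≤ ((12 + 1 / δ) * y ^ (-δ)) ^ (N + 1) := pow_le_pow_left₀ (norm_nonneg _) hV _
    _ = (12 + 1 / δ) ^ (N + 1) * y ^ (-1 / 2 : ℝ) := by rw [mul_pow, hpow]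
    _ ≤ (12 + 1 / δ) ^ (N + 1) * (2 * |d| ^ (-1 / 2 : ℝ)) := by gcongr
    _ ≤ (12 + 1 / δ) ^ (N + 1) * (2 * (d ^ (-1 / 2 : ℝ) + (-d) ^ (-1 / 2 : ℝ))) := by
        gcongr
        exact abs_rpow_le d
    _ = _ := by rw [hd, neg_sub]; ring

theorem mul_I_mem_slitDomain {x v : ℝ} (h0 : 0 ≤ v) (h1 : v < Real.pi) :
    (x : ℂ) + v * Complex.I ∈ slitDomain := by
  right
  simpa [abs_of_nonneg h0] using h1

theorem tendsto_add_mul_I {g : ℂ → ℂ} {v : ℝ} (h : ContinuousAt g (v * Complex.I)) :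
    Tendsto (fun ε : ℝ => g (ε + v * Complex.I)) (𝓝[>] 0) (𝓝 (g (v * Complex.I))) := by
  have h1 : Continuous fun ε : ℝ => (ε : ℂ) + v * Complex.I := by fun_prop
  have h2 := (h1.tendsto 0).mono_left (nhdsWithin_le_nhds (s := Set.Ioi 0))
  simp only [Complex.ofReal_zero, zero_add] at h2
  exact h.tendsto.comp h2

theorem mul_I_mem_puncturedStrip {v : ℝ} (h0 : 0 ≤ v) (h1 : v ≤ Real.pi) (h : v ≠ Real.pi / 2) :
    (v : ℂ) * Complex.I ∈ puncturedStrip := by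
  simpa using add_mul_I_mem_puncturedStrip le_rfl h0 h1 (Or.inr h)

theorem coGudermannPow_mul_I_re {N : ℕ} (hN : Even N) {v : ℝ} (h0 : Real.pi / 2 < v)
    (h1 : v ≤ Real.pi) : (coGudermannPow N (v * Complex.I)).re = 0 := by
  obtain ⟨a, rfl⟩ := hN
  have h2 : coGudermann (v * Complex.I) = ((coGudermann (v * Complex.I)).im : ℂ) * Complex.I :=
    Complex.ext (by rw [coGudermann_mul_I_re h0 h1]; simp) (by simp)
  generalize (coGudermann (v * Complex.I)).im = y at h2
  have h3 : coGudermannPow (a + a) (v * Complex.I) =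
      ((y ^ (a + a + 1) * (-1) ^ a / ((a + a + 1).factorial : ℝ) : ℝ) : ℂ) * Complex.I := by
    rw [coGudermannPow, h2, mul_pow, pow_succ Complex.I, ← two_mul, pow_mul Complex.I, Complex.I_sq]
    push_cast
    ring
  rw [h3, Complex.re_ofReal_mul, Complex.I_re, mul_zero]

theorem coGudermannPowDeriv_mul_I_im {N : ℕ} (hN : Even N) {v : ℝ} (h0 : Real.pi / 2 < v)
    (h1 : v ≤ Real.pi) : (coGudermannPowDeriv N (v * Complex.I)).im = 0 := by
  obtain ⟨a, rfl⟩ := hN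
  have h2 : coGudermann (v * Complex.I) = ((coGudermann (v * Complex.I)).im : ℂ) * Complex.I :=
    Complex.ext (by rw [coGudermann_mul_I_re h0 h1]; simp) (by simp)
  generalize (coGudermann (v * Complex.I)).im = y at h2
  have h3 : coGudermannPowDeriv (a + a) (v * Complex.I) =
      ((y ^ (a + a) * (-1) ^ a / ((a + a).factorial : ℝ) * -(Real.cos v)⁻¹ : ℝ) : ℂ) := by
    rw [coGudermannPowDeriv, h2, mul_pow, ← two_mul, pow_mul Complex.I, Complex.I_sq,
      Complex.cosh_mul_I]
    push_cast
    ring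
  rw [h3, Complex.ofReal_im]

/-- The real part of the iterate vanishes along the imaginary axis, and its derivative in v is minus
the imaginary part in question. -/
theorem sinhIterateDeriv_mul_I_im {n : ℕ} (hn : Even n) (k : ℕ) {v : ℝ} (h0 : 0 ≤ v)
    (h1 : v < Real.pi) : (sinhIterateDeriv n k (v * Complex.I)).im = 0 := by
  have hmem : ((0 : ℝ) : ℂ) + v * Complex.I ∈ slitDomain := mul_I_mem_slitDomain h0 h1
  have h2 := hasDerivAt_comp_add_mul_I (hasDerivAt_sinhIterate hn k hmem)
  have h3 := Complex.reCLM.hasFDerivAt.comp_hasDerivAt v h2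
  have h4 : (Complex.reCLM ∘ fun v : ℝ => sinhIterate n k ((0 : ℝ) + v * Complex.I)) =
      fun _ => (0 : ℝ) := by
    funext w
    simp [sinhIterate_mul_I_re hn k w]
  rw [h4] at h3
  have h5 := h3.unique (hasDerivAt_const v 0)
  simpa using h5

/-- The cut at 3π/4 separates the singularities at iπ/2 and iπ. On the upper piece the limiting
integrand is imaginary times real. -/
theorem tendsto_contour_left_upper {n N : ℕ} (hn : Even n) (hN : Even N) (l : ℕ) :
    Tendsto (fun ε : ℝ => ∫ v in (3 * Real.pi / 4)..Real.pi,
      (contourIntegrand n N l (ε + v * Complex.I)).re) (𝓝[>] 0) (𝓝 0) := by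
  have hpi := Real.pi_pos
  obtain ⟨C, hC0, hC⟩ := exists_norm_sinhIterate_le_rpow hn l
  obtain ⟨C', hC'0, hC'⟩ := exists_norm_le_of_compact (g := coGudermannPowDeriv N)
    (S := puncturedStrip)
    (fun z hz => (differentiableAt_coGudermannPowDeriv N hz).continuousAt.continuousWithinAt)
    (K := Set.Icc 0 1 ×ˢ Set.Icc (3 * Real.pi / 4) Real.pi) (isCompact_Icc.prod isCompact_Icc)
    (fun p hp => add_mul_I_mem_puncturedStrip hp.1.1 (by linarith [hp.2.1]) hp.2.2
      (Or.inr (by linarith [hp.2.1])))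
  have hle : 3 * Real.pi / 4 ≤ Real.pi := by linarith
  have hI : Set.Ioo (0 : ℝ) 1 ∈ 𝓝[>] (0 : ℝ) := Ioo_mem_nhdsGT one_pos
  suffices h : Tendsto (fun ε : ℝ => ∫ v in (3 * Real.pi / 4)..Real.pi,
      (contourIntegrand n N l (ε + v * Complex.I)).re) (𝓝[>] 0)
      (𝓝 (∫ _ in (3 * Real.pi / 4)..Real.pi, (0 : ℝ))) by
    rwa [intervalIntegral.integral_zero] at h
  refine intervalIntegral.tendsto_integral_filter_of_dominated_convergence
    (fun v => C * C' * (Real.pi - v) ^ (-1 / 2 : ℝ)) ?_ ?_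
    ((intervalIntegrable_sub_rpow Real.pi _ _).1.const_mul _) ?_
  · filter_upwards [hI] with ε hε
    have h1 : ContinuousOn (fun v : ℝ => (contourIntegrand n N l (ε + v * Complex.I)).re)
        (Set.uIcc (3 * Real.pi / 4) Real.pi) := by
      rw [Set.uIcc_of_le hle]
      exact Complex.continuous_re.comp_continuousOn
        ((continuousOn_contourIntegrand_vertical hn N l hε.1).mono
          (Set.Icc_subset_Icc (by linarith) le_rfl))
    exact (intervalIntegrable_iff.1 h1.intervalIntegrable).aestronglyMeasurable
  · filter_upwards [hI] with ε hε
    filter_upwards [compl_mem_ae_iff.2 (measure_singleton Real.pi)] with v hv hv'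
    rw [Set.uIoc_of_le hle] at hv'
    have hvpi : v < Real.pi := lt_of_le_of_ne hv'.2 hv
    refine (Complex.abs_re_le_norm _).trans ?_
    rw [contourIntegrand, norm_mul]
    calc _ ≤ C * (Real.pi - v) ^ (-1 / 2 : ℝ) * C' :=
          mul_le_mul (hC ε v hε.1 hε.2.le (by linarith [hv'.1]) hvpi)
            (hC' (ε, v) ⟨⟨hε.1.le, hε.2.le⟩, hv'.1.le, hv'.2⟩) (norm_nonneg _)
            (mul_nonneg hC0 (Real.rpow_nonneg (by linarith) _))
      _ = _ := by ring
  · filter_upwards [compl_mem_ae_iff.2 (measure_singleton Real.pi)] with v hv hv'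
    rw [Set.uIoc_of_le hle] at hv'
    have hvpi : v < Real.pi := lt_of_le_of_ne hv'.2 hv
    have hmem : (v : ℂ) * Complex.I ∈ slitDomain := by
      simpa using mul_I_mem_slitDomain (x := 0) (by linarith [hv'.1]) hvpi
    have hd := ((sinhIterate_properties hn l).1.differentiableAt
      (isOpen_slitDomain.mem_nhds hmem)).mul
      (differentiableAt_coGudermannPowDeriv N (mul_I_mem_puncturedStrip
        (by linarith [hv'.1]) hv'.2 (by linarith [hv'.1])))
    have h1 := (Complex.continuous_re.tendsto _).comp (tendsto_add_mul_I hd.continuousAt)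
    have h2 : ((sinhIterate n l * coGudermannPowDeriv N) (v * Complex.I)).re = 0 := by
      rw [Pi.mul_apply, Complex.mul_re, sinhIterate_mul_I_re hn,
        coGudermannPowDeriv_mul_I_im hN (by linarith [hv'.1]) hv'.2]
      ring
    rw [h2] at h1
    exact h1

/-- The integrand is the one obtained by parts: the powers of V have an integrable singularity at
iπ/2, unlike their derivatives with the factor 1/cosh. -/
theorem tendsto_contour_left_lower {n : ℕ} (hn : Even n) (N l : ℕ) :
    Tendsto (fun ε : ℝ => ∫ v in (0 : ℝ)..(3 * Real.pi / 4),
      (sinhIterateDeriv n l (ε + v * Complex.I) * coGudermannPow N (ε + v * Complex.I)).re)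
      (𝓝[>] 0) (𝓝 (∫ v in (0 : ℝ)..(3 * Real.pi / 4),
        (sinhIterateDeriv n l (v * Complex.I) * coGudermannPow N (v * Complex.I)).re)) := by
  have hpi := Real.pi_pos
  obtain ⟨C, hC0, hC⟩ := exists_norm_coGudermannPow_le N
  obtain ⟨C', hC'0, hC'⟩ := exists_norm_le_of_compact
    (differentiableOn_sinhIterateDeriv hn l).continuousOn
    (K := Set.Icc 0 1 ×ˢ Set.Icc 0 (3 * Real.pi / 4)) (isCompact_Icc.prod isCompact_Icc)
    (fun p hp => mul_I_mem_slitDomain hp.2.1 (by linarith [hp.2.2]))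
  have hle : 0 ≤ 3 * Real.pi / 4 := by linarith
  have hI : Set.Ioo (0 : ℝ) 1 ∈ 𝓝[>] (0 : ℝ) := Ioo_mem_nhdsGT one_pos
  refine intervalIntegral.tendsto_integral_filter_of_dominated_convergence
    (fun v => C' * (C * ((Real.pi / 2 - v) ^ (-1 / 2 : ℝ) + (v - Real.pi / 2) ^ (-1 / 2 : ℝ)))) ?_ ?_
    ((((intervalIntegrable_sub_rpow (Real.pi / 2) _ _).1.add
      (intervalIntegrable_sub_rpow (Real.pi / 2) _ _).2).const_mul _).const_mul _) ?_
  · filter_upwards [hI] with ε hε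
    have h1 : ContinuousOn (fun v : ℝ => (sinhIterateDeriv n l (ε + v * Complex.I) *
        coGudermannPow N (ε + v * Complex.I)).re) (Set.uIcc 0 (3 * Real.pi / 4)) := by
      rw [Set.uIcc_of_le hle]
      intro v hv
      have h2 := ((differentiableOn_sinhIterateDeriv hn l).differentiableAt
        (isOpen_slitDomain.mem_nhds (add_mul_I_mem_slitDomain hε.1 v))).mul
        (hasDerivAt_coGudermannPow N (add_mul_I_mem_puncturedStrip hε.1.le hv.1
          (by linarith [hv.2]) (Or.inl hε.1.ne'))).differentiableAt
      have h3 : Continuous fun v : ℝ => (ε : ℂ) + v * Complex.I := by fun_prop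
      exact (Complex.continuous_re.continuousAt.comp
        (ContinuousAt.comp (f := fun v : ℝ => (ε : ℂ) + v * Complex.I) h2.continuousAt
          h3.continuousAt)).continuousWithinAt
    exact (intervalIntegrable_iff.1 h1.intervalIntegrable).aestronglyMeasurable
  · filter_upwards [hI] with ε hε
    filter_upwards [compl_mem_ae_iff.2 (measure_singleton (Real.pi / 2))] with v hv hv'
    rw [Set.uIoc_of_le hle] at hv'
    refine (Complex.abs_re_le_norm _).trans ?_
    rw [norm_mul]
    exact mul_le_mul (hC' (ε, v) ⟨⟨hε.1.le, hε.2.le⟩, hv'.1.le, hv'.2⟩)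
      (hC ε v hε.1.le hv'.1.le (by linarith [hv'.2]) hv) (norm_nonneg _) hC'0
  · filter_upwards [compl_mem_ae_iff.2 (measure_singleton (Real.pi / 2))] with v hv hv'
    rw [Set.uIoc_of_le hle] at hv'
    have hmem : (v : ℂ) * Complex.I ∈ slitDomain := by
      simpa using mul_I_mem_slitDomain (x := 0) hv'.1.le (by linarith [hv'.2])
    have hd := ((differentiableOn_sinhIterateDeriv hn l).differentiableAt
      (isOpen_slitDomain.mem_nhds hmem)).mul
      (hasDerivAt_coGudermannPow N (mul_I_mem_puncturedStrip hv'.1.le (by linarith [hv'.2])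
        hv)).differentiableAt
    exact (Complex.continuous_re.tendsto _).comp (tendsto_add_mul_I hd.continuousAt)

/-! ### The imaginary axis in the coordinate gd, and the two values of the contour -/

theorem sin_gudermann_mul_cosh (s : ℝ) : Real.sin (gudermann s) * Real.cosh s = Real.sinh s := by
  have h1 : Real.exp s * Real.exp (-s) = 1 := by rw [← Real.exp_add, add_neg_cancel, Real.exp_zero]
  rw [gudermann, Real.sin_pi_div_two_sub, Real.cos_two_mul, Real.cos_sq_arctan, Real.cosh_eq,
    Real.sinh_eq]
  have h2 : 0 < Real.exp (-s) := Real.exp_pos _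
  have h3 : 0 < 1 + Real.exp (-s) ^ 2 := by positivity
  field_simp
  linear_combination (-2 * Real.exp (-s)) * h1

/-- The iterated integrals along the imaginary axis in the coordinate `gudermann`. -/
noncomputable def axisIterate (b k : ℕ) (s : ℝ) : ℝ :=
  (-1) ^ b * (sinhIterate (2 * b) k (gudermann s * Complex.I)).im

/-- The derivative of `axisIterate`. -/
noncomputable def axisIterateDeriv (b k : ℕ) (s : ℝ) : ℝ :=
  (-1) ^ b * (sinhIterateDeriv (2 * b) k (gudermann s * Complex.I)).re / Real.cosh s

theorem gudermann_mul_I_mem_slitDomain {s : ℝ} (hs : 0 ≤ s) :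
    (gudermann s : ℂ) * Complex.I ∈ slitDomain := by
  have h := mul_I_mem_slitDomain (x := 0) (v := gudermann s)
    (gudermann_zero ▸ strictMono_gudermann.monotone hs) (by linarith [gudermann_lt s, Real.pi_pos])
  rwa [Complex.ofReal_zero, zero_add] at h

theorem hasDerivAt_axisIterate (b k : ℕ) {s : ℝ} (hs : 0 ≤ s) :
    HasDerivAt (axisIterate b k) (axisIterateDeriv b k s) s := by
  have h1 := (hasDerivAt_gudermann s).ofReal_comp.mul_const Complex.I
  have h2 := (hasDerivAt_sinhIterate (even_two_mul b) k (gudermann_mul_I_mem_slitDomain hs)).comp s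
    h1
  refine ((Complex.imCLM.hasFDerivAt.comp_hasDerivAt s h2).const_mul ((-1) ^ b)).congr_deriv ?_
  simp only [Complex.imCLM_apply, axisIterateDeriv]
  rw [← mul_assoc, Complex.mul_I_im, Complex.mul_re, Complex.ofReal_im, Complex.ofReal_re]
  ring

theorem axisIterate_at_zero (b k : ℕ) : axisIterate b k 0 = 0 := by
  simp [axisIterate, gudermann_zero, sinhIterate_zero]

/-- Under z = i gd s, the relation sin(gd s) cosh s = sinh s turns dz/sinh z into ds/sinh s. -/
theorem axisIterateDeriv_succ (b k : ℕ) {s : ℝ} (hs : 0 < s) :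
    axisIterateDeriv b (k + 1) s = axisIterate b k s / Real.sinh s := by
  have h0 := gudermann_pos hs
  have h1 : Real.sin (gudermann s) ≠ 0 :=
    (Real.sin_pos_of_pos_of_lt_pi h0 (by linarith [gudermann_lt s, Real.pi_pos])).ne'
  have h2 : (gudermann s : ℂ) * Complex.I ≠ 0 :=
    mul_ne_zero (Complex.ofReal_ne_zero.2 h0.ne') Complex.I_ne_zero
  rw [axisIterateDeriv, axisIterate, sinhIterateDeriv_succ _ _ h2, Complex.sinh_mul_I,
    ← Complex.ofReal_sin, ← sin_gudermann_mul_cosh s, div_mul_eq_div_div, Complex.div_I,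
    Complex.neg_re, Complex.mul_I_re, neg_neg, Complex.div_ofReal_im]
  field_simp

theorem mul_I_pow_im_re (b : ℕ) (w : ℝ) (M : ℕ) :
    (((w : ℂ) * Complex.I) ^ (2 * b) / (M : ℂ)).re = (-1) ^ b * (w ^ (2 * b) / M) ∧
      (((w : ℂ) * Complex.I) ^ (2 * b + 1) / (M : ℂ)).im = (-1) ^ b * (w ^ (2 * b + 1) / M) := by
  have h1 : ((w : ℂ) * Complex.I) ^ (2 * b) / (M : ℂ) =
      (((-1) ^ b * (w ^ (2 * b) / M) : ℝ) : ℂ) := by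
    rw [mul_pow, pow_mul Complex.I, Complex.I_sq]; push_cast; ring
  have h2 : ((w : ℂ) * Complex.I) ^ (2 * b + 1) / (M : ℂ) =
      (((-1) ^ b * (w ^ (2 * b + 1) / M) : ℝ) : ℂ) * Complex.I := by
    rw [mul_pow, pow_succ Complex.I, pow_mul Complex.I, Complex.I_sq]; push_cast; ring
  rw [h1, h2, Complex.im_ofReal_mul, Complex.I_im, mul_one, Complex.ofReal_re]
  exact ⟨rfl, rfl⟩

theorem neg_one_pow_mul_self_mul (b : ℕ) (x : ℝ) : (-1) ^ b * ((-1) ^ b * x) = x := by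
  rw [← mul_assoc, ← mul_pow]; norm_num

theorem weightIntegral_mul_axisIterateDeriv_integral (b l q k n : ℕ) (h : n + k = l) :
    IntegrableOn (fun s => weightIntegral (stepSign l) n q s * axisIterateDeriv b k s)
        (Set.Ioi 0) ∧
      ∫ s in Set.Ioi 0, weightIntegral (stepSign l) n q s * axisIterateDeriv b k s =
        (-1) ^ (2 * b + 1) * weightedSumW l (q + (l + 2 * b + 1)) (l + 2 * b + 1) := by
  refine weightIntegral_mul_integral (Q := axisIterate b) (y := axisIterateDeriv b)
    (fun k s hs => (hasDerivAt_axisIterate b k hs).continuousAt.continuousWithinAt)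
    (axisIterate_at_zero b) (fun k s hs => hasDerivAt_axisIterate b k hs.le)
    (fun k s hs => axisIterateDeriv_succ b k hs) (fun s _ => ?_) (fun s _ => ?_) l q k n h
  · rw [axisIterate, sinhIterate, (mul_I_pow_im_re b _ _).2, neg_one_pow_mul_self_mul]
  · rw [axisIterateDeriv, sinhIterateDeriv, (mul_I_pow_im_re b _ _).1, neg_one_pow_mul_self_mul]

theorem weightIntegral_mul_gudermann_integral (a l q : ℕ) :
    IntegrableOn (fun s => weightIntegral (stepSign l) l q s *
        (gudermann s ^ (2 * a) / ((2 * a).factorial : ℝ) / Real.cosh s)) (Set.Ioi 0) ∧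
      ∫ s in Set.Ioi 0, weightIntegral (stepSign l) l q s *
        (gudermann s ^ (2 * a) / ((2 * a).factorial : ℝ) / Real.cosh s) =
        (-1) ^ (2 * a + 1) * weightedSumW l (q + (l + 2 * a + 1)) (l + 2 * a + 1) := by
  have h := weightIntegral_mul_axisIterateDeriv_integral a l q 0 l rfl
  simpa only [axisIterateDeriv, sinhIterateDeriv, (mul_I_pow_im_re a _ _).1,
    neg_one_pow_mul_self_mul] using h

theorem integral_sum_weighted {ι : Type*} (t : Finset ι) (c : ι → ℝ) {f : ι → ℝ → ℝ} {g h : ℝ → ℝ}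
    {v : ι → ℝ} (hf : ∀ j, IntegrableOn (fun s => f j s * g s) (Set.Ioi 0) ∧
      ∫ s in Set.Ioi 0, f j s * g s = v j)
    (hh : ∀ s, 0 < s → h s = (∑ j ∈ t, c j * f j s) * g s) :
    IntegrableOn h (Set.Ioi 0) ∧ ∫ s in Set.Ioi 0, h s = ∑ j ∈ t, c j * v j := by
  have h1 : Set.EqOn h (fun s => ∑ j ∈ t, c j * (f j s * g s)) (Set.Ioi 0) := fun s hs => by
    rw [hh s hs, Finset.sum_mul]
    exact Finset.sum_congr rfl fun j _ => mul_assoc _ _ _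
  have h2 : ∀ j ∈ t, Integrable (fun s => c j * (f j s * g s)) (volume.restrict (Set.Ioi 0)) :=
    fun j _ => (hf j).1.const_mul _
  refine ⟨(integrableOn_congr_fun h1 measurableSet_Ioi).2 (integrable_finsetSum _ h2), ?_⟩
  rw [setIntegral_congr_fun measurableSet_Ioi h1, integral_finsetSum _ h2]
  exact Finset.sum_congr rfl fun j _ => by rw [integral_const_mul, (hf j).2]

theorem contourIntegrand_add_pi_mul_I_integral (a b l : ℕ) :
    IntegrableOn (fun s : ℝ => (contourIntegrand (2 * b) (2 * a) l (s + Real.pi * Complex.I)).im)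
        (Set.Ioi 0) ∧
      ∫ s in Set.Ioi (0 : ℝ), (contourIntegrand (2 * b) (2 * a) l (s + Real.pi * Complex.I)).im =
        ∑ j ∈ Finset.range (b + 1), Real.pi * alphaCoeff (b - j) *
          ((-1) ^ (2 * a + 1) * weightedSumW l (2 * j + (l + 2 * a + 1)) (l + 2 * a + 1)) := by
  refine integral_sum_weighted _ _
    (fun j => weightIntegral_mul_gudermann_integral a l (2 * j)) (fun s hs => ?_)
  rw [contourIntegrand_add_pi_mul_I_im, sinhIterate_add_pi_mul_I_im l b l le_rfl s hs,
    Finset.mul_sum]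
  simp only [mul_assoc]

/-- Since π - is = -i(s + πi), the odd power of -i turns this real part into the imaginary part
already expanded on the top edge. -/
theorem coGudermannPow_gudermann_mul_I_re (a : ℕ) (s : ℝ) :
    (coGudermannPow (2 * a) (gudermann s * Complex.I)).re =
      (-1) ^ a * (Real.pi * ∑ j ∈ Finset.range (a + 1), alphaCoeff (a - j) *
        (s ^ (2 * j) / ((2 * j).factorial : ℝ))) := by
  rw [coGudermannPow, coGudermann_gudermann_mul_I, ← im_add_pi_mul_I_pow,
    show (Real.pi : ℂ) - s * Complex.I = -Complex.I * (s + Real.pi * Complex.I) by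
      linear_combination (Real.pi : ℂ) * Complex.I_sq,
    mul_pow, show (-Complex.I) ^ (2 * a + 1) = (((-1) ^ a : ℝ) : ℂ) * -Complex.I by
      rw [pow_succ, pow_mul, neg_sq, Complex.I_sq]; push_cast; rfl,
    mul_assoc, mul_div_assoc, Complex.re_ofReal_mul, neg_mul, neg_div, mul_div_assoc,
    Complex.neg_re, Complex.I_mul_re, neg_neg]

/-- The extreme case of the duality: all l kernels 1/sinh lie on the axis iterate, and the other
factor is the bare power of s that the α-expansion supplies. -/
theorem axis_integral (a b l : ℕ) :
    ∫ s in Set.Ioi (0 : ℝ), (Real.cosh s)⁻¹ *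
        (sinhIterateDeriv (2 * b) l (gudermann s * Complex.I) *
          coGudermannPow (2 * a) (gudermann s * Complex.I)).re =
      ∑ j ∈ Finset.range (a + 1), (-1) ^ (a + b) * Real.pi * alphaCoeff (a - j) *
        ((-1) ^ (2 * b + 1) * weightedSumW l (2 * j + (l + 2 * b + 1)) (l + 2 * b + 1)) := by
  refine (integral_sum_weighted _ _
    (fun j => weightIntegral_mul_axisIterateDeriv_integral b l (2 * j) l 0 (zero_add l))
    (fun s hs => ?_)).2
  have h0 := sinhIterateDeriv_mul_I_im (even_two_mul b) l (gudermann_pos hs).le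
    (by linarith [gudermann_lt s, Real.pi_pos])
  rw [Complex.mul_re, h0, zero_mul, sub_zero, coGudermannPow_gudermann_mul_I_re, axisIterateDeriv]
  simp only [weightIntegral_zero, mul_assoc]
  rw [← Finset.mul_sum, ← Finset.mul_sum, pow_add]
  have h1 := neg_one_pow_mul_self_mul b 1
  linear_combination (-((Real.cosh s)⁻¹ *
    (sinhIterateDeriv (2 * b) l (gudermann s * Complex.I)).re * (-1) ^ a * (Real.pi *
      ∑ j ∈ Finset.range (a + 1), alphaCoeff (a - j) * (s ^ (2 * j) / ((2 * j).factorial : ℝ)))))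
    * h1

/-! ### Passage to the limit and conclusion -/

theorem tendsto_integral_Ioi_nhdsGT {f : ℝ → ℝ} (hf : IntegrableOn f (Set.Ioi 0)) :
    Tendsto (fun ε => ∫ s in Set.Ioi ε, f s) (𝓝[>] 0) (𝓝 (∫ s in Set.Ioi 0, f s)) := by
  have h := (aecover_Ioi_of_Ioi (μ := volume) (A := (0 : ℝ)) (l := 𝓝[>] (0 : ℝ)) (a := fun ε => ε)
    (tendsto_id.mono_left nhdsWithin_le_nhds)).integral_tendsto_of_countably_generated hf
  refine h.congr' ?_
  filter_upwards [self_mem_nhdsWithin] with ε hε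
  rw [Measure.restrict_restrict measurableSet_Ioi, Set.inter_eq_left.2]
  exact Set.Ioi_subset_Ioi (le_of_lt hε)

theorem integral_Ioi_contour {n : ℕ} (hn : Even n) (N l : ℕ)
    (hint : IntegrableOn (fun s : ℝ => (contourIntegrand n N l (s + Real.pi * Complex.I)).im)
      (Set.Ioi 0)) {ε : ℝ} (hε : 0 < ε) :
    ∫ s in Set.Ioi ε, (contourIntegrand n N l (s + Real.pi * Complex.I)).im =
      -(∫ v in (0 : ℝ)..Real.pi, contourIntegrand n N l (ε + v * Complex.I)).re := by
  have h1 := intervalIntegral_tendsto_integral_Ioi ε (hint.mono_set (Set.Ioi_subset_Ioi hε.le))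
    tendsto_id
  have h2 := (tendsto_contour_right hn N l).sub_const
    (∫ v in (0 : ℝ)..Real.pi, contourIntegrand n N l (ε + v * Complex.I)).re
  rw [zero_sub] at h2
  refine tendsto_nhds_unique h1 (h2.congr' ?_)
  filter_upwards [eventually_ge_atTop ε] with R hR
  exact (contour_rectangle hn N l hε hR).symm

theorem contour_left_lower_by_parts {n : ℕ} (hn : Even n) (N l : ℕ) {ε : ℝ} (hε : 0 < ε) :
    (∫ v in (0 : ℝ)..(3 * Real.pi / 4), contourIntegrand n N l (ε + v * Complex.I)).re =
      ((sinhIterate n l * coGudermannPow N) (ε + (3 * Real.pi / 4 : ℝ) * Complex.I)).im -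
        ∫ v in (0 : ℝ)..(3 * Real.pi / 4),
          (sinhIterateDeriv n l (ε + v * Complex.I) * coGudermannPow N (ε + v * Complex.I)).re := by
  have hpi := Real.pi_pos
  have hle : 0 ≤ 3 * Real.pi / 4 := by linarith
  have hz : Continuous fun v : ℝ => (ε : ℂ) + v * Complex.I := by fun_prop
  have hs : ∀ v ∈ Set.uIcc 0 (3 * Real.pi / 4), (ε : ℂ) + v * Complex.I ∈ puncturedStrip := by
    intro v hv
    rw [Set.uIcc_of_le hle] at hv
    exact add_mul_I_mem_puncturedStrip hε.le hv.1 (by linarith [hv.2]) (Or.inl hε.ne')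
  have hg : ∀ v ∈ Set.uIcc 0 (3 * Real.pi / 4),
      HasDerivAt (fun v : ℝ => sinhIterate n l (ε + v * Complex.I))
        (sinhIterateDeriv n l (ε + v * Complex.I) * Complex.I) v := fun v _ =>
    hasDerivAt_comp_add_mul_I (hasDerivAt_sinhIterate hn l (add_mul_I_mem_slitDomain hε v))
  have hU : ∀ v ∈ Set.uIcc 0 (3 * Real.pi / 4),
      HasDerivAt (fun v : ℝ => coGudermannPow N (ε + v * Complex.I))
        (coGudermannPowDeriv N (ε + v * Complex.I) * Complex.I) v := fun v hv =>
    hasDerivAt_comp_add_mul_I (hasDerivAt_coGudermannPow N (hs v hv))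
  have hg' : ContinuousOn (fun v : ℝ => sinhIterateDeriv n l (ε + v * Complex.I))
      (Set.uIcc 0 (3 * Real.pi / 4)) :=
    (differentiableOn_sinhIterateDeriv hn l).continuousOn.comp hz.continuousOn
      fun v _ => add_mul_I_mem_slitDomain hε v
  have hU' : ContinuousOn (fun v : ℝ => coGudermannPowDeriv N (ε + v * Complex.I))
      (Set.uIcc 0 (3 * Real.pi / 4)) := fun v hv =>
    (ContinuousAt.comp (f := fun v : ℝ => (ε : ℂ) + v * Complex.I)
      (differentiableAt_coGudermannPowDeriv N (hs v hv)).continuousAt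
      hz.continuousAt).continuousWithinAt
  have hUc : ContinuousOn (fun v : ℝ => coGudermannPow N (ε + v * Complex.I))
      (Set.uIcc 0 (3 * Real.pi / 4)) := fun v hv => (hU v hv).continuousAt.continuousWithinAt
  have h1 := intervalIntegral.integral_mul_deriv_eq_deriv_mul hg hU
    (hg'.mul continuousOn_const).intervalIntegrable (hU'.mul continuousOn_const).intervalIntegrable
  simp only [← mul_assoc, mul_right_comm _ Complex.I] at h1
  rw [intervalIntegral.integral_mul_const, intervalIntegral.integral_mul_const] at h1
  have h2 := congrArg Complex.im h1
  rw [Complex.sub_im, Complex.sub_im, Complex.mul_I_im, Complex.mul_I_im] at h2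
  have h3 : (sinhIterate n l (ε + (0 : ℝ) * Complex.I) *
      coGudermannPow N (ε + (0 : ℝ) * Complex.I)).im = 0 := by
    rw [Complex.ofReal_zero, zero_mul, add_zero, Complex.mul_im, sinhIterate_ofReal_im hn,
      coGudermannPow_ofReal_im, mul_zero, zero_mul, add_zero]
  rw [h3, sub_zero] at h2
  have h4 : (∫ v in (0 : ℝ)..(3 * Real.pi / 4), sinhIterateDeriv n l (ε + v * Complex.I) *
      coGudermannPow N (ε + v * Complex.I)).re = ∫ v in (0 : ℝ)..(3 * Real.pi / 4),
        (sinhIterateDeriv n l (ε + v * Complex.I) * coGudermannPow N (ε + v * Complex.I)).re :=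
    (Complex.reCLM.intervalIntegral_comp_comm (hg'.mul hUc).intervalIntegrable).symm
  rw [h4] at h2
  exact h2

/-- The boundary term of the integration by parts at 3πi/4 tends to a product of two imaginary
numbers, so its imaginary part disappears in the limit. -/
theorem tendsto_contour_left {n N : ℕ} (hn : Even n) (hN : Even N) (l : ℕ) :
    Tendsto (fun ε : ℝ => -(∫ v in (0 : ℝ)..Real.pi,
      contourIntegrand n N l (ε + v * Complex.I)).re) (𝓝[>] 0)
      (𝓝 (∫ v in (0 : ℝ)..(3 * Real.pi / 4),
        (sinhIterateDeriv n l (v * Complex.I) * coGudermannPow N (v * Complex.I)).re)) := by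
  have hpi := Real.pi_pos
  have hmem : ((3 * Real.pi / 4 : ℝ) : ℂ) * Complex.I ∈ slitDomain := by
    simpa using mul_I_mem_slitDomain (x := 0) (v := 3 * Real.pi / 4) (by linarith) (by linarith)
  have hd := ((sinhIterate_properties hn l).1.differentiableAt
    (isOpen_slitDomain.mem_nhds hmem)).mul (hasDerivAt_coGudermannPow N
      (mul_I_mem_puncturedStrip (v := 3 * Real.pi / 4) (by linarith) (by linarith)
        (by linarith))).differentiableAt
  have h1 := (Complex.continuous_im.tendsto _).comp (tendsto_add_mul_I hd.continuousAt)
  have h2 : ((sinhIterate n l * coGudermannPow N) ((3 * Real.pi / 4 : ℝ) * Complex.I)).im = 0 := by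
    rw [Pi.mul_apply, Complex.mul_im, sinhIterate_mul_I_re hn,
      coGudermannPow_mul_I_re hN (by linarith) (by linarith)]
    ring
  rw [h2] at h1
  have h3 := ((tendsto_contour_left_lower hn N l).sub h1).sub (tendsto_contour_left_upper hn hN l)
  rw [sub_zero, sub_zero] at h3
  refine h3.congr' ?_
  filter_upwards [self_mem_nhdsWithin] with ε hε
  have hc := continuousOn_contourIntegrand_vertical (n := n) hn N l (x := ε) hε
  have h4 : IntervalIntegrable (fun v : ℝ => contourIntegrand n N l (ε + v * Complex.I)) volume 0
      (3 * Real.pi / 4) := ContinuousOn.intervalIntegrable (by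
    rw [Set.uIcc_of_le (by linarith)]
    exact hc.mono (Set.Icc_subset_Icc le_rfl (by linarith)))
  have h5 : IntervalIntegrable (fun v : ℝ => contourIntegrand n N l (ε + v * Complex.I)) volume
      (3 * Real.pi / 4) Real.pi := ContinuousOn.intervalIntegrable (by
    rw [Set.uIcc_of_le (by linarith)]
    exact hc.mono (Set.Icc_subset_Icc (by linarith) le_rfl))
  have h6 : (∫ v in (3 * Real.pi / 4)..Real.pi, contourIntegrand n N l (ε + v * Complex.I)).re =
      ∫ v in (3 * Real.pi / 4)..Real.pi, (contourIntegrand n N l (ε + v * Complex.I)).re :=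
    (Complex.reCLM.intervalIntegral_comp_comm h5).symm
  rw [← intervalIntegral.integral_add_adjacent_intervals h4 h5, Complex.add_re, h6,
    contour_left_lower_by_parts hn N l hε, Function.comp_apply]
  ring

/-- The substitution v = gd s covers only (0, π/2); beyond π/2 the integrand is the real part of a
real times an imaginary number. -/
theorem contour_axis_integral {n N : ℕ} (hn : Even n) (hN : Even N) (l : ℕ) :
    ∫ v in (0 : ℝ)..(3 * Real.pi / 4),
        (sinhIterateDeriv n l (v * Complex.I) * coGudermannPow N (v * Complex.I)).re =
      ∫ s in Set.Ioi (0 : ℝ), (Real.cosh s)⁻¹ *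
        (sinhIterateDeriv n l (gudermann s * Complex.I) *
          coGudermannPow N (gudermann s * Complex.I)).re := by
  have hpi := Real.pi_pos
  have h := integral_image_eq_integral_deriv_smul_of_monotoneOn (f := gudermann)
    (f' := fun s => (Real.cosh s)⁻¹) measurableSet_Ioi
    (fun s _ => (hasDerivAt_gudermann s).hasDerivWithinAt)
    (strictMono_gudermann.monotone.monotoneOn (Set.Ioi 0))
    (fun v : ℝ => (sinhIterateDeriv n l (v * Complex.I) * coGudermannPow N (v * Complex.I)).re)
  simp only [smul_eq_mul] at h
  rw [← h, image_gudermann_Ioi, ← integral_Ioc_eq_integral_Ioo,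
    intervalIntegral.integral_of_le (by linarith)]
  refine setIntegral_eq_of_subset_of_forall_sdiff_eq_zero measurableSet_Ioc
    (Set.Ioc_subset_Ioc le_rfl (by linarith)) fun v hv => ?_
  have h1 : Real.pi / 2 < v := by
    by_contra hv'
    exact hv.2 ⟨hv.1.1, not_lt.1 hv'⟩
  have h2 := hv.1.2
  rw [Complex.mul_re, sinhIterateDeriv_mul_I_im hn l hv.1.1.le (by linarith),
    coGudermannPow_mul_I_re hN h1 (by linarith)]
  ring

/-- Both sides, multiplied by -π, are the limit as ε → 0 of the same contour integral, read on the
top edge and on the imaginary axis. -/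
theorem sum_alphaCoeff_weightedSumW (a b l : ℕ) :
    ∑ j ∈ Finset.range (b + 1),
        alphaCoeff (b - j) * weightedSumW l (2 * j + (l + 2 * a + 1)) (l + 2 * a + 1) =
      (-1) ^ (a + b) * ∑ j ∈ Finset.range (a + 1),
        alphaCoeff (a - j) * weightedSumW l (2 * j + (l + 2 * b + 1)) (l + 2 * b + 1) := by
  obtain ⟨hint, hval⟩ := contourIntegrand_add_pi_mul_I_integral a b l
  have h1 := tendsto_integral_Ioi_nhdsGT hint
  have h2 := tendsto_contour_left (even_two_mul b) (even_two_mul a) l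
  have h3 := tendsto_nhds_unique (h1.congr' (by
    filter_upwards [self_mem_nhdsWithin] with ε hε
    exact integral_Ioi_contour (even_two_mul b) (2 * a) l hint hε)) h2
  rw [contour_axis_integral (even_two_mul b) (even_two_mul a), hval, axis_integral] at h3
  have hodd : ∀ a : ℕ, (-1 : ℝ) ^ (2 * a + 1) = -1 := fun a => by
    rw [pow_succ, pow_mul]; norm_num
  simp only [hodd] at h3
  refine mul_left_cancel₀ (neg_ne_zero.2 Real.pi_ne_zero) ?_
  simp only [Finset.mul_sum]
  convert h3 using 2 <;> ring

theorem mainTheorem3 (m p l : ℕ) (hm : 1 ≤ m) (hp : 1 ≤ p) :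
    (∀ j ∈ Finset.Icc 1 p, WConverges l (2 * j + 2 * m + l - 3) (2 * m + l - 1)) ∧
    (∀ j ∈ Finset.Icc 1 m, WConverges l (2 * j + 2 * p + l - 3) (2 * p + l - 1)) ∧
    (-1 : ℝ) ^ m * ∑ j ∈ Finset.Icc 1 p,
        alphaCoeff (p - j) * weightedSumW l (2 * j + 2 * m + l - 3) (2 * m + l - 1) =
      (-1 : ℝ) ^ p * ∑ j ∈ Finset.Icc 1 m,
        alphaCoeff (m - j) * weightedSumW l (2 * j + 2 * p + l - 3) (2 * p + l - 1) := by
  obtain ⟨a, rfl⟩ := Nat.exists_eq_add_of_le' hm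
  obtain ⟨b, rfl⟩ := Nat.exists_eq_add_of_le' hp
  have hr : ∀ c : ℕ, 2 * (c + 1) + l - 1 = l + 2 * c + 1 := fun c => by omega
  have hsum : ∀ c d : ℕ, ∑ j ∈ Finset.Icc 1 (d + 1), alphaCoeff (d + 1 - j) *
      weightedSumW l (2 * j + 2 * (c + 1) + l - 3) (l + 2 * c + 1) =
      ∑ j ∈ Finset.range (d + 1),
        alphaCoeff (d - j) * weightedSumW l (2 * j + (l + 2 * c + 1)) (l + 2 * c + 1) := by
    intro c d
    rw [Finset.range_eq_Ico, ← Finset.Ico_add_one_right_eq_Icc, Finset.sum_Ico_eq_sum_range,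
      Finset.sum_Ico_eq_sum_range]
    refine Finset.sum_congr (by simp) fun j _ => ?_
    congr 2 <;> omega
  rw [hr a, hr b, hsum, hsum]
  refine ⟨fun j _ => WConverges_of_le (by omega) _, fun j _ => WConverges_of_le (by omega) _, ?_⟩
  rw [sum_alphaCoeff_weightedSumW, ← mul_assoc]
  congr 1
  rw [pow_add, pow_succ, pow_succ]
  linear_combination (-(-1) ^ b) * neg_one_pow_mul_self_mul a 1
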